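/- \textbf{Conventions.} Let a discrete group $G$ act by homeomorphisms on the Cantor set $X$, with compatible metric $d$. The action is \emph{expansive} if there is $\epsilon>0$ such that for all $x\neq y$ in $X$ some $g\in G$ satisfies $d(gx,gy)>\epsilon$; \emph{minimal} if every orbit is dense; \emph{essentially free} if there is a dense invariant subset of $X$ on which $G$ acts freely. The transformation groupoid $G\ltimes X$ is the set $G\times X$ with the product topology ($G$ discrete), source $s(g,x)=x$, range $r(g,x)=gx$, product $(g,hx)(h,x)=(gh,x)$ and inverse $(g,x)^{-1}=(g^{-1},gx)$; the unit $(1,x)$ is identified with $x$. A bisection is an open set $B\subset G\ltimes X$ on which $s$ and $r$ are homeomorphisms onto their images. The topological full group $\mathsf F(G\ltimes X)$ is the group, under the product of sets, of the compact open bisections $B$ with $s(B)=r(B)=X$. For compact open bisections $B_1,B_2$ such that $r(B_1)=s(B_2)$ and $s(B_1),\ s(B_2),\ r(B_2)$ are pairwise disjoint, put $$\gamma_{B_1,B_2}=B_1\sqcup B_2\sqcup (B_2B_1)^{-1}\sqcup \bigl(X\setminus (s(B_1)\sqcup s(B_2)\sqcup r(B_2))\bigr)\in\mathsf F(G\ltimes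 X),$$ and let $\mathsf A(G\ltimes X)$ be the subgroup of $\mathsf F(G\ltimes X)$ generated by all these elements. For a countable dense additive subgroup $\Gamma$ of $\mathbb R$ with $1\in\Gamma$, let $IE(\Gamma)$ be the group of bijections $f$ of $[0,1]$ for which there are finitely many breakpoints in $\Gamma\cap[0,1]$, cutting $[0,1]$ into intervals that contain their left endpoint and not the breakpoint that ends them, such that on each interval $f$ is a translation by an element of $\Gamma$. Let $D(IE(\Gamma))$ be its derived subgroup. \textbf{Statement.} (1) Let $G$ be a countable discrete group with an expansive, minimal, essentially free action by homeomorphisms on the Cantor set $X$. Then $G$ is finitely generated if and only if $\mathsf A(G\ltimes X)$ is finitely generated. (2) Let $\Gamma$ be a countable dense additive subgroup of $\mathbb R$ with $1\in\Gamma$. Then $D(IE(\Gamma))$ is finitely generated if and only if $\Gamma$ is finitely generated. -/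

import Mathlib

open Set Topology

/-- The transformation groupoid `G ⋉ X` of an action of a discrete group `G` on `X`: its elements
are the pairs `⟨g, x⟩`, and its topology is that of the disjoint union of the copies `{g} × X`,
so that the sets `{g} × U` with `U` open form a basis. The unit `⟨1, x⟩` is identified with `x`. -/
@[ext]
structure TransformationGroupoid (G X : Type*) where
  /-- The group element `g` of `⟨g, x⟩`. -/
  elt : G
  /-- The source `x` of `⟨g, x⟩`. -/
  src : X

namespace TransformationGroupoid

variable {G X : Type*}

instance [TopologicalSpace X] : TopologicalSpace (TransformationGroupoid G X) :=
  ⨆ g : G, TopologicalSpace.coinduced (TransformationGroupoid.mk g) inferInstance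

theorem isOpen_iff [TopologicalSpace X] {B : Set (TransformationGroupoid G X)} :
    IsOpen B ↔ ∀ g : G, IsOpen {x : X | (⟨g, x⟩ : TransformationGroupoid G X) ∈ B} := by
  simp only [isOpen_iSup_iff, isOpen_coinduced]
  rfl

theorem continuous_src [TopologicalSpace X] :
    Continuous (src : TransformationGroupoid G X → X) :=
  continuous_def.2 fun _ hU => isOpen_iff.2 fun _ => hU

theorem isOpenMap_src [TopologicalSpace X] :
    IsOpenMap (src : TransformationGroupoid G X → X) := by
  intro B hB
  have : src '' B = ⋃ g : G, {x : X | (⟨g, x⟩ : TransformationGroupoid G X) ∈ B} := by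
    ext x
    simp only [mem_image, mem_iUnion]
    exact ⟨fun ⟨γ, h, e⟩ => ⟨γ.elt, e ▸ h⟩, fun ⟨g, h⟩ => ⟨⟨g, x⟩, h, rfl⟩⟩
  rw [this]
  exact isOpen_iUnion (isOpen_iff.1 hB)

variable [Group G] [MulAction G X]

/-- The range `g • x` of `⟨g, x⟩`. -/
def rng (γ : TransformationGroupoid G X) : X := γ.elt • γ.src

/-- The product `(g, h x)(h, x) = (g h, x)`; it is meaningful if `γ.src = δ.rng`. -/
def comp (γ δ : TransformationGroupoid G X) : TransformationGroupoid G X := ⟨γ.elt * δ.elt, δ.src⟩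

/-- The inverse `(g, x)⁻¹ = (g⁻¹, g x)`. -/
def inv (γ : TransformationGroupoid G X) : TransformationGroupoid G X := ⟨γ.elt⁻¹, γ.elt • γ.src⟩

/-- The units over a set `U` of points of `X`. -/
def units (U : Set X) : Set (TransformationGroupoid G X) := {γ | γ.elt = 1 ∧ γ.src ∈ U}

/-- The product of two sets: all products of composable pairs. -/
def setMul (B C : Set (TransformationGroupoid G X)) : Set (TransformationGroupoid G X) :=
  {γ | ∃ β ∈ B, ∃ δ ∈ C, β.src = δ.rng ∧ γ = β.comp δ}

/-- The pointwise inverse of a set. -/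
def setInv (B : Set (TransformationGroupoid G X)) : Set (TransformationGroupoid G X) :=
  inv '' B

variable [TopologicalSpace X]

/-- A bisection: an open set on which the source and range maps are homeomorphisms onto their
images. -/
structure IsBisection (B : Set (TransformationGroupoid G X)) : Prop where
  isOpen : IsOpen B
  src_emb : IsEmbedding (B.domRestrict src)
  rng_emb : IsEmbedding (B.domRestrict rng)

/-- Compact open bisections. -/
structure IsCompactBisection (B : Set (TransformationGroupoid G X)) : Prop
    extends IsBisection B where
  isCompact : IsCompact B

/-- The compact open bisections whose source and range are the whole unit space. -/
structure IsFullBisection (B : Set (TransformationGroupoid G X)) : Prop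
    extends IsCompactBisection B where
  src_image : src '' B = univ
  rng_image : rng '' B = univ

section
variable [ContinuousConstSMul G X]

theorem continuous_rng : Continuous (rng : TransformationGroupoid G X → X) :=
  continuous_def.2 fun _ hU => isOpen_iff.2 fun g => hU.preimage (continuous_const_smul g)

theorem isOpenMap_rng : IsOpenMap (rng : TransformationGroupoid G X → X) := by
  intro B hB
  have : rng '' B = ⋃ g : G,
      (fun x => g • x) '' {x : X | (⟨g, x⟩ : TransformationGroupoid G X) ∈ B} := by
    ext x
    simp only [mem_image, mem_iUnion]
    exact ⟨fun ⟨γ, h, e⟩ => ⟨γ.elt, γ.src, h, e⟩, fun ⟨g, y, h, e⟩ => ⟨⟨g, y⟩, h, e⟩⟩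
  rw [this]
  exact isOpen_iUnion fun g => isOpenMap_smul g _ (isOpen_iff.1 hB g)

theorem isBisection_iff {B : Set (TransformationGroupoid G X)} :
    IsBisection B ↔ IsOpen B ∧ InjOn src B ∧ InjOn rng B := by
  constructor
  · rintro ⟨h1, h2, h3⟩
    exact ⟨h1, injOn_iff_injective.2 h2.injective, injOn_iff_injective.2 h3.injective⟩
  · rintro ⟨h1, h2, h3⟩
    refine ⟨h1, ?_, ?_⟩
    · exact (IsOpenEmbedding.of_continuous_injective_isOpenMap
        (continuous_src.comp continuous_subtype_val) (injOn_iff_injective.1 h2)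
        (isOpenMap_src.comp h1.isOpenMap_subtype_val)).isEmbedding
    · exact (IsOpenEmbedding.of_continuous_injective_isOpenMap
        (continuous_rng.comp continuous_subtype_val) (injOn_iff_injective.1 h3)
        (isOpenMap_rng.comp h1.isOpenMap_subtype_val)).isEmbedding

theorem isFullBisection_iff [CompactSpace X] {B : Set (TransformationGroupoid G X)} :
    IsFullBisection B ↔
      IsOpen B ∧ InjOn src B ∧ InjOn rng B ∧ src '' B = univ ∧ rng '' B = univ := by
  constructor
  · intro h
    have := isBisection_iff.1 h.toIsBisection
    exact ⟨this.1, this.2.1, this.2.2, h.src_image, h.rng_image⟩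
  · rintro ⟨h1, h2, h3, h4, h5⟩
    have hb : IsBisection B := isBisection_iff.2 ⟨h1, h2, h3⟩
    refine ⟨⟨hb, ?_⟩, h4, h5⟩
    have hc : IsCompact (univ : Set B) := by
      rw [hb.src_emb.isCompact_iff, image_univ, Set.range_domRestrict, h4]
      exact isCompact_univ
    exact isCompact_iff_isCompact_univ.2 hc

theorem IsFullBisection.setMul [CompactSpace X] {B C : Set (TransformationGroupoid G X)}
    (hB : IsFullBisection B) (hC : IsFullBisection C) : IsFullBisection (setMul B C) := by
  rw [isFullBisection_iff] at *
  obtain ⟨b1, b2, b3, b4, b5⟩ := hB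
  obtain ⟨c1, c2, c3, c4, c5⟩ := hC
  have key : ∀ β δ : TransformationGroupoid G X, β.src = δ.rng → (β.comp δ).rng = β.rng := by
    rintro ⟨g, x⟩ ⟨h, y⟩ e
    simp only [rng, comp] at *
    rw [e, mul_smul]
  refine ⟨?_, ?_, ?_, ?_, ?_⟩
  · rw [isOpen_iff] at *
    intro k
    have : {x : X | (⟨k, x⟩ : TransformationGroupoid G X) ∈ TransformationGroupoid.setMul B C} =
        ⋃ h : G, {x : X | (⟨h, x⟩ : TransformationGroupoid G X) ∈ C} ∩
          (fun x => h • x) ⁻¹' {x : X | (⟨k * h⁻¹, x⟩ : TransformationGroupoid G X) ∈ B} := by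
      ext x
      simp only [mem_ofPred_eq, mem_iUnion, mem_inter_iff, mem_preimage]
      constructor
      · rintro ⟨⟨g, y⟩, hβ, ⟨h, z⟩, hδ, e, e'⟩
        simp only [rng, comp, mk.injEq] at e e'
        obtain ⟨rfl, rfl⟩ := e'
        subst e
        exact ⟨h, hδ, by simpa using hβ⟩
      · rintro ⟨h, h1, h2⟩
        refine ⟨_, h2, _, h1, rfl, ?_⟩
        simp [comp]
    rw [this]
    exact isOpen_iUnion fun h => (c1 h).inter ((b1 _).preimage (continuous_const_smul h))
  · rintro _ ⟨β, hβ, δ, hδ, e, rfl⟩ _ ⟨β', hβ', δ', hδ', e', rfl⟩ heq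
    obtain rfl : δ = δ' := c2 hδ hδ' heq
    obtain rfl : β = β' := b2 hβ hβ' (e.trans e'.symm)
    rfl
  · rintro _ ⟨β, hβ, δ, hδ, e, rfl⟩ _ ⟨β', hβ', δ', hδ', e', rfl⟩ heq
    rw [key _ _ e, key _ _ e'] at heq
    obtain rfl : β = β' := b3 hβ hβ' heq
    obtain rfl : δ = δ' := c3 hδ hδ' (e.symm.trans e')
    rfl
  · refine eq_univ_of_forall fun x => ?_
    obtain ⟨δ, hδ, rfl⟩ := (c4.symm ▸ mem_univ x : x ∈ src '' C)
    obtain ⟨β, hβ, e⟩ := (b4.symm ▸ mem_univ δ.rng : δ.rng ∈ src '' B)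
    exact ⟨_, ⟨β, hβ, δ, hδ, e, rfl⟩, rfl⟩
  · refine eq_univ_of_forall fun x => ?_
    obtain ⟨β, hβ, rfl⟩ := (b5.symm ▸ mem_univ x : x ∈ rng '' B)
    obtain ⟨δ, hδ, e⟩ := (c5.symm ▸ mem_univ β.src : β.src ∈ rng '' C)
    exact ⟨_, ⟨β, hβ, δ, hδ, e.symm, rfl⟩, key _ _ e.symm⟩

theorem inv_inv (γ : TransformationGroupoid G X) : γ.inv.inv = γ := by
  obtain ⟨g, x⟩ := γ
  simp [inv]

theorem rng_inv (γ : TransformationGroupoid G X) : γ.inv.rng = γ.src := by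
  obtain ⟨g, x⟩ := γ
  simp [inv, rng]

theorem src_inv (γ : TransformationGroupoid G X) : γ.inv.src = γ.rng := rfl

theorem mem_setInv {B : Set (TransformationGroupoid G X)} {γ : TransformationGroupoid G X} :
    γ ∈ setInv B ↔ γ.inv ∈ B :=
  ⟨by rintro ⟨δ, h, rfl⟩; rwa [inv_inv], fun h => ⟨_, h, inv_inv γ⟩⟩

theorem isOpen_setInv {B : Set (TransformationGroupoid G X)} (hB : IsOpen B) :
    IsOpen (setInv B) := by
  rw [isOpen_iff] at *
  intro g
  simp only [mem_setInv]
  exact (hB g⁻¹).preimage (continuous_const_smul g)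

theorem IsFullBisection.setInv [CompactSpace X] {B : Set (TransformationGroupoid G X)}
    (hB : IsFullBisection B) : IsFullBisection (setInv B) := by
  rw [isFullBisection_iff] at *
  obtain ⟨b1, b2, b3, b4, b5⟩ := hB
  refine ⟨isOpen_setInv b1, ?_, ?_, ?_, ?_⟩
  · rintro _ ⟨β, hβ, rfl⟩ _ ⟨β', hβ', rfl⟩ e
    exact congrArg inv (b3 hβ hβ' e)
  · rintro _ ⟨β, hβ, rfl⟩ _ ⟨β', hβ', rfl⟩ e
    rw [rng_inv, rng_inv] at e
    exact congrArg inv (b2 hβ hβ' e)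
  · rw [TransformationGroupoid.setInv, image_image]
    exact b5
  · rw [TransformationGroupoid.setInv, image_image]
    simpa only [rng_inv] using b4

theorem isOpen_units {U : Set X} (hU : IsOpen U) :
    IsOpen (units U : Set (TransformationGroupoid G X)) := by
  rw [isOpen_iff]
  intro g
  by_cases h : g = 1
  · simpa [units, h] using hU
  · simp [units, h]

theorem isFullBisection_units [CompactSpace X] :
    IsFullBisection (units univ : Set (TransformationGroupoid G X)) := by
  rw [isFullBisection_iff]
  refine ⟨isOpen_units isOpen_univ, ?_, ?_, ?_, ?_⟩
  · rintro ⟨g, x⟩ ⟨h1, -⟩ ⟨g', x'⟩ ⟨h2, -⟩ e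
    simp only at h1 h2 e
    subst h1 h2 e
    rfl
  · rintro ⟨g, x⟩ ⟨h1, -⟩ ⟨g', x'⟩ ⟨h2, -⟩ e
    simp only [rng] at *
    subst h1 h2
    simp only [one_smul] at e
    subst e
    rfl
  · exact eq_univ_of_forall fun x => ⟨⟨1, x⟩, ⟨rfl, mem_univ _⟩, rfl⟩
  · exact eq_univ_of_forall fun x => ⟨⟨1, x⟩, ⟨rfl, mem_univ _⟩, one_smul G x⟩

end

variable (G X) in
/-- The topological full group `F(G ⋉ X)`. -/
def FullGroup := {B : Set (TransformationGroupoid G X) // IsFullBisection B}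

/-- The group law of `F(G ⋉ X)` is the product of bisections. -/
instance [ContinuousConstSMul G X] [CompactSpace X] : Group (FullGroup G X) where
  mul B C := ⟨setMul B.1 C.1, B.2.setMul C.2⟩
  one := ⟨units univ, isFullBisection_units⟩
  inv B := ⟨setInv B.1, B.2.setInv⟩
  mul_assoc B C D := by
    refine Subtype.ext (Set.ext fun γ => ⟨?_, ?_⟩)
    · rintro ⟨_, ⟨β, hβ, δ, hδ, e, rfl⟩, ε, hε, e', rfl⟩
      refine ⟨β, hβ, δ.comp ε, ⟨δ, hδ, ε, hε, e', rfl⟩, ?_, ?_⟩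
      · rw [e]
        change δ.elt • δ.src = (δ.elt * ε.elt) • ε.src
        rw [mul_smul]
        exact congrArg (δ.elt • ·) e'
      · exact congrArg (fun k => (⟨k, ε.src⟩ : TransformationGroupoid G X)) (mul_assoc _ _ _)
    · rintro ⟨β, hβ, _, ⟨δ, hδ, ε, hε, e, rfl⟩, e', rfl⟩
      refine ⟨β.comp δ, ⟨β, hβ, δ, hδ, ?_, rfl⟩, ε, hε, e, ?_⟩
      · rw [e']
        change (δ.elt * ε.elt) • ε.src = δ.elt • δ.src
        rw [mul_smul]
        exact congrArg (δ.elt • ·) e.symm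
      · exact congrArg (fun k => (⟨k, ε.src⟩ : TransformationGroupoid G X)) (mul_assoc _ _ _).symm
  one_mul B := by
    refine Subtype.ext (Set.ext fun γ => ⟨?_, fun h => ?_⟩)
    · rintro ⟨⟨g, x⟩, ⟨h, -⟩, ⟨k, y⟩, hδ, e, rfl⟩
      change g = 1 at h
      subst h
      change (⟨1 * k, y⟩ : TransformationGroupoid G X) ∈ B.1
      rwa [one_mul]
    · exact ⟨⟨1, γ.rng⟩, ⟨rfl, mem_univ _⟩, γ, h, rfl,
        congrArg (fun k => (⟨k, γ.src⟩ : TransformationGroupoid G X)) (one_mul _).symm⟩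
  mul_one B := by
    refine Subtype.ext (Set.ext fun γ => ⟨?_, fun h => ?_⟩)
    · rintro ⟨⟨k, y⟩, hδ, ⟨g, x⟩, ⟨h, -⟩, e, rfl⟩
      change g = 1 at h
      subst h
      change y = (1 : G) • x at e
      rw [one_smul] at e
      subst e
      change (⟨k * 1, y⟩ : TransformationGroupoid G X) ∈ B.1
      rwa [mul_one]
    · exact ⟨γ, h, ⟨1, γ.src⟩, ⟨rfl, mem_univ _⟩, (one_smul G _).symm,
        congrArg (fun k => (⟨k, γ.src⟩ : TransformationGroupoid G X)) (mul_one _).symm⟩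
  inv_mul_cancel B := by
    refine Subtype.ext (Set.ext fun γ => ⟨?_, ?_⟩)
    · rintro ⟨_, ⟨β, hβ, rfl⟩, δ, hδ, e, rfl⟩
      obtain rfl : β = δ := (isFullBisection_iff.1 B.2).2.2.1 hβ hδ e
      exact ⟨inv_mul_cancel _, mem_univ _⟩
    · obtain ⟨g, x⟩ := γ
      rintro ⟨h, -⟩
      change g = 1 at h
      subst h
      obtain ⟨β, hβ, rfl⟩ := (B.2.src_image.symm ▸ mem_univ x : x ∈ src '' B.1)
      exact ⟨β.inv, ⟨β, hβ, rfl⟩, β, hβ, rfl,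
        congrArg (fun k => (⟨k, β.src⟩ : TransformationGroupoid G X)) (inv_mul_cancel _).symm⟩

/-- `B₁` and `B₂` are compact open bisections with `r(B₁) = s(B₂)`, and the three sets
`s(B₁)`, `r(B₁) = s(B₂)`, `r(B₂)` are pairwise disjoint. -/
structure IsCyclePair (B₁ B₂ : Set (TransformationGroupoid G X)) : Prop where
  left : IsCompactBisection B₁
  right : IsCompactBisection B₂
  rng_eq_src : rng '' B₁ = src '' B₂
  disj₁₂ : Disjoint (src '' B₁) (src '' B₂)
  disj₁₃ : Disjoint (src '' B₁) (rng '' B₂)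
  disj₂₃ : Disjoint (src '' B₂) (rng '' B₂)

/-- The full bisection that permutes `s(B₁)`, `s(B₂)`, `r(B₂)` cyclically by `B₁`, `B₂` and
`(B₂ B₁)⁻¹`, and consists of units elsewhere. -/
def cycle (B₁ B₂ : Set (TransformationGroupoid G X)) : Set (TransformationGroupoid G X) :=
  B₁ ∪ B₂ ∪ setInv (setMul B₂ B₁) ∪ units (src '' B₁ ∪ src '' B₂ ∪ rng '' B₂)ᶜ

variable (G X) in
/-- The alternating group `A(G ⋉ X)`: the subgroup of `F(G ⋉ X)` generated by the bisections
`cycle B₁ B₂`. -/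
def alternating [ContinuousConstSMul G X] [CompactSpace X] : Subgroup (FullGroup G X) :=
  Subgroup.closure {γ | ∃ B₁ B₂, IsCyclePair B₁ B₂ ∧ γ.1 = cycle B₁ B₂}

end TransformationGroupoid

/-- An action is expansive if some `ε > 0` is exceeded by `d(gx, gy)` for some `g`, for all
`x ≠ y`. -/
def IsExpansiveAction (G X : Type*) [MetricSpace X] [Group G] [MulAction G X] : Prop :=
  ∃ ε > 0, ∀ x y : X, x ≠ y → ∃ g : G, ε < dist (g • x) (g • y)

/-- An action is essentially free if it restricts to a free action on some dense invariant
subset. -/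
def IsEssentiallyFree (G X : Type*) [TopologicalSpace X] [Group G] [MulAction G X] : Prop :=
  ∃ Y : Set X, Dense Y ∧ (∀ (g : G), ∀ y ∈ Y, g • y ∈ Y) ∧ ∀ (g : G), ∀ y ∈ Y, g • y = y → g = 1

/-- `f` is a piecewise translation of `[0, 1]`, right continuous, with finitely many breakpoints
and finitely many angles `f t - t`, all in `Γ`. Two points lie in the same half-open piece
`[s, s')` cut out by the finite set `S` of breakpoints iff they lie above the same elements
of `S`. -/
def IsIntervalExchange (Γ : AddSubgroup ℝ) (f : Equiv.Perm (Icc (0 : ℝ) 1)) : Prop :=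
  (∀ t, (f t : ℝ) - t ∈ Γ) ∧
    ∃ S : Finset (Icc (0 : ℝ) 1), (∀ s ∈ S, (s : ℝ) ∈ Γ) ∧
      ∀ x y, (∀ s ∈ S, s ≤ x ↔ s ≤ y) → (f x : ℝ) - x = f y - y

namespace IsIntervalExchange

variable {Γ : AddSubgroup ℝ} {f g : Equiv.Perm (Icc (0 : ℝ) 1)}

theorem one : IsIntervalExchange Γ 1 :=
  ⟨fun t => by simp, ∅, by simp, fun x y _ => by simp⟩

theorem mul (hf : IsIntervalExchange Γ f) (hg : IsIntervalExchange Γ g) :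
    IsIntervalExchange Γ (f * g) := by
  classical
  obtain ⟨hf1, S, hS, hf2⟩ := hf
  obtain ⟨hg1, T, hT, hg2⟩ := hg
  refine ⟨fun t => ?_, T ∪ S.image g.symm, ?_, ?_⟩
  · have := Γ.add_mem (hf1 (g t)) (hg1 t)
    simpa using this
  · intro s hs
    rcases Finset.mem_union.1 hs with h | h
    · exact hT s h
    · obtain ⟨u, hu, rfl⟩ := Finset.mem_image.1 h
      have := Γ.sub_mem (hS u hu) (hg1 (g.symm u))
      simpa using this
  · have key : ∀ x y, x ≤ y → (∀ s ∈ T ∪ S.image g.symm, s ≤ x ↔ s ≤ y) →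
        ((f * g) x : ℝ) - x = (f * g) y - y := by
      intro x y hxy h
      have hg' := hg2 x y fun s hs => h s (Finset.mem_union_left _ hs)
      have hle : g x ≤ g y := by
        have : (x : ℝ) ≤ y := hxy
        change (g x : ℝ) ≤ g y
        linarith
      have := hf2 (g x) (g y) fun s hs => by
        refine ⟨fun h' => h'.trans hle, fun h' => ?_⟩
        by_contra hlt
        have hlt' : (g x : ℝ) < s := not_le.1 hlt
        have hle' : (s : ℝ) ≤ g y := h'
        let t : Icc (0 : ℝ) 1 := ⟨x + (s - g x), by linarith [x.2.1], by linarith [y.2.2]⟩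
        have ht1 : x < t := by change (x : ℝ) < x + (s - g x); linarith
        have ht2 : t ≤ y := by change (x : ℝ) + (s - g x) ≤ y; linarith
        have hgt := hg2 x t fun u hu => by
          have := h u (Finset.mem_union_left _ hu)
          exact ⟨fun h => h.trans ht1.le, fun h => this.2 (h.trans ht2)⟩
        have hgts : g t = s := by
          apply Subtype.ext
          have : (t : ℝ) = x + (s - g x) := rfl
          linarith
        have hm := h (g.symm s) (Finset.mem_union_right _ (Finset.mem_image_of_mem _ hs))
        rw [← hgts, Equiv.symm_apply_apply] at hm
        exact absurd (hm.2 ht2) (not_le.2 ht1)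
      simp only [Equiv.Perm.mul_apply]
      linarith
    intro x y h
    rcases le_total x y with hxy | hxy
    · exact key x y hxy h
    · exact (key y x hxy fun s hs => (h s hs).symm).symm

theorem inv (hf : IsIntervalExchange Γ f) (h1 : (1 : ℝ) ∈ Γ) : IsIntervalExchange Γ f⁻¹ := by
  classical
  obtain ⟨hf1, S₀, hS₀, hf2₀⟩ := hf
  obtain ⟨S, hS, h0S, h1S, hf2⟩ : ∃ S : Finset (Icc (0 : ℝ) 1), (∀ s ∈ S, (s : ℝ) ∈ Γ) ∧
      0 ∈ S ∧ 1 ∈ S ∧ ∀ x y, (∀ s ∈ S, s ≤ x ↔ s ≤ y) → (f x : ℝ) - x = f y - y := by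
    refine ⟨insert 0 (insert 1 S₀), ?_, by simp, by simp, fun x y h => hf2₀ x y fun s hs =>
      h s (by simp [hs])⟩
    intro s hs
    simp only [Finset.mem_insert] at hs
    rcases hs with rfl | rfl | hs
    · exact Γ.zero_mem
    · exact h1
    · exact hS₀ s hs
  have next : ∀ u : Icc (0 : ℝ) 1, u < 1 → ∃ b ∈ S, u < b ∧
      ∀ v, u ≤ v → v < b → (f u : ℝ) - u = f v - v := by
    intro u hu
    obtain ⟨b, hb, hmin⟩ := Finset.exists_min_image (S.filter (u < ·)) id
      ⟨1, Finset.mem_filter.2 ⟨h1S, hu⟩⟩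
    rw [Finset.mem_filter] at hb
    refine ⟨b, hb.1, hb.2, fun v huv hvb => hf2 u v fun s hs => ⟨fun h => h.trans huv, fun h => ?_⟩⟩
    by_contra hlt
    exact absurd (hmin s (Finset.mem_filter.2 ⟨hs, not_le.1 hlt⟩))
      (not_le.2 (h.trans_lt hvb))
  have prev : ∀ w : Icc (0 : ℝ) 1, w ∉ S → ∃ a, a < w ∧
      ∀ v, a < v → v ≤ w → (f v : ℝ) - v = f w - w := by
    intro w hw
    have hw0 : 0 < w := lt_of_le_of_ne w.2.1 fun h => hw (h ▸ h0S)
    obtain ⟨a, ha, hmax⟩ := Finset.exists_max_image (S.filter (· < w)) id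
      ⟨0, Finset.mem_filter.2 ⟨h0S, hw0⟩⟩
    rw [Finset.mem_filter] at ha
    refine ⟨a, ha.2, fun v hav hvw => hf2 v w fun s hs => ⟨fun h => h.trans hvw, fun h => ?_⟩⟩
    have hsw : s < w := lt_of_le_of_ne h fun h => hw (h ▸ hs)
    exact (hmax s (Finset.mem_filter.2 ⟨hs, hsw⟩)).trans hav.le
  have f1 : f 1 = 1 := by
    obtain ⟨w, hw⟩ := f.surjective 1
    rcases lt_or_eq_of_le (show w ≤ 1 from w.2.2) with hlt | rfl
    · exfalso
      obtain ⟨b, -, hwb, hb⟩ := next w hlt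
      have hwb' : (w : ℝ) < b := hwb
      let v : Icc (0 : ℝ) 1 := ⟨(w + b) / 2, by linarith [w.2.1, b.2.1], by linarith [w.2.2, b.2.2]⟩
      have hv : (v : ℝ) = (w + b) / 2 := rfl
      have := hb v (by change (w : ℝ) ≤ v; linarith) (by change (v : ℝ) < b; linarith)
      rw [hw] at this
      have h2 := (f v).2.2
      have h3 : ((1 : Icc (0 : ℝ) 1) : ℝ) = 1 := rfl
      linarith
    · exact hw
  have key : ∀ x y, x ≤ y → (∀ s ∈ S.image f, s ≤ x ↔ s ≤ y) →
      (f.symm x : ℝ) - x = f.symm y - y := by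
    intro x y hxy h
    obtain ⟨u, rfl⟩ := f.surjective x
    rw [Equiv.symm_apply_apply]
    rcases lt_or_eq_of_le (show u ≤ 1 from u.2.2) with hu | rfl
    · obtain ⟨b, hbS, hub, hb⟩ := next u hu
      have hub' : (u : ℝ) < b := hub
      have hxy' : (f u : ℝ) ≤ y := hxy
      rcases lt_or_ge ((y : ℝ) - (f u - u)) b with hlt | hge
      · let v : Icc (0 : ℝ) 1 := ⟨y - (f u - u), by linarith [u.2.1], by linarith [b.2.2]⟩
        have hv : (v : ℝ) = y - (f u - u) := rfl
        have := hb v (by change (u : ℝ) ≤ v; linarith) (by change (v : ℝ) < b; linarith)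
        have hfv : f v = y := Subtype.ext (by linarith)
        rw [← hfv, Equiv.symm_apply_apply]
        linarith
      · exfalso
        let z : Icc (0 : ℝ) 1 := ⟨b + (f u - u), by linarith [(f u).2.1], by linarith [y.2.2]⟩
        have hz : (z : ℝ) = b + (f u - u) := rfl
        obtain ⟨w, hw⟩ := f.surjective z
        have hwS : w ∉ S := by
          intro hwS
          have := (h (f w) (Finset.mem_image_of_mem _ hwS)).2
            (by rw [hw]; change (z : ℝ) ≤ y; linarith)
          rw [hw] at this
          have : (z : ℝ) ≤ f u := this
          linarith
        obtain ⟨a, haw, ha⟩ := prev w hwS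
        have haw' : (a : ℝ) < w := haw
        obtain ⟨δ, hδ0, hδ1, hδ2⟩ : ∃ δ : ℝ, 0 < δ ∧ δ < w - a ∧ δ < b - u := by
          obtain ⟨δ, h1, h2⟩ := exists_between (lt_min (sub_pos.2 haw') (sub_pos.2 hub'))
          exact ⟨δ, h1, lt_of_lt_of_le h2 (min_le_left _ _), lt_of_lt_of_le h2 (min_le_right _ _)⟩
        let v : Icc (0 : ℝ) 1 := ⟨w - δ, by linarith [a.2.1], by linarith [w.2.2]⟩
        let v' : Icc (0 : ℝ) 1 := ⟨b - δ, by linarith [u.2.1], by linarith [b.2.2]⟩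
        have hv : (v : ℝ) = w - δ := rfl
        have hv' : (v' : ℝ) = b - δ := rfl
        have e1 := ha v (by change (a : ℝ) < v; linarith) (by change (v : ℝ) ≤ w; linarith)
        have e2 := hb v' (by change (u : ℝ) ≤ v'; linarith) (by change (v' : ℝ) < b; linarith)
        rw [hw] at e1
        have : v = v' := f.injective (Subtype.ext (by linarith))
        have hwb : (w : ℝ) = b := by
          have : (v : ℝ) = v' := congrArg _ this
          linarith
        exact hwS ((Subtype.ext hwb : w = b) ▸ hbS)
    · have : y = 1 := le_antisymm y.2.2 (f1 ▸ hxy)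
      subst this
      have : f.symm 1 = 1 := by rw [Equiv.symm_apply_eq, f1]
      rw [this, f1]
  refine ⟨fun t => ?_, S.image f, ?_, ?_⟩
  · have := Γ.neg_mem (hf1 (f.symm t))
    simpa using this
  · intro s hs
    obtain ⟨u, hu, rfl⟩ := Finset.mem_image.1 hs
    have := Γ.add_mem (hf1 u) (hS u hu)
    simpa using this
  · intro x y h
    rcases le_total x y with hxy | hxy
    · exact key x y hxy h
    · exact (key y x hxy fun s hs => (h s hs).symm).symm

end IsIntervalExchange

/-- The group `IE(Γ)` of interval exchanges of `[0, 1]` with breakpoints and angles in `Γ`. -/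
def IE (Γ : AddSubgroup ℝ) (h1 : (1 : ℝ) ∈ Γ) : Subgroup (Equiv.Perm (Icc (0 : ℝ) 1)) where
  carrier := {f | IsIntervalExchange Γ f}
  mul_mem' := IsIntervalExchange.mul
  one_mem' := IsIntervalExchange.one
  inv_mem' hf := hf.inv h1

/-! Both groups are, up to isomorphism, permutation groups `alt3 G 𝓑` generated by three-cycles of
pieces: `cyc U a b c` carries aU to bU to cU to aU by translations, and U runs through a G-invariant
Boolean algebra 𝓑. In (1), 𝓑 consists of the clopen sets; essential freeness makes the full group
act faithfully on X, and by compactness each generator of the alternating group acts as a finite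
product of such three-cycles (`map_alternating`). In (2), G is Γ acting on [0, 1) by rotations, with
the endpoint 1 fixed, and 𝓑 is generated by the intervals with endpoints in Γ.

The engine is the commutator of two three-cycles with exactly one common position: the commutator of
(a b p) over U₁ and (a c q) over U₂ is (a b c) over U₁ ∩ U₂, because over a point of only one of the
two sets one of the factors is trivial (`permute_commutator`). Intersections of domains thus become
group operations; disjoint unions become products, and complements become quotients.

If G is finitely generated, so is `alt3 G 𝓑` (`alt3_fg`). Let K be generated by the three-cycles
with domain in a suitable finite Boolean algebra 𝒲 and positions in a suitable finite set F. The
sets whose intersections with members of 𝒲 carry three-cycles in K form a Boolean algebra. It is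
invariant under the generators of G, since translating the domain amounts to multiplying the
positions on the right (`cyc_preimage`). Expansiveness, or for rotations the presence of one short
interval, then forces it to be all of 𝓑. Induction on word length (`cyc_mem_step`) extends the
positions from F to G. Large orbits supply the auxiliary positions, and since these are available
only locally, every step is made on the members of a finite cover and multiplied together.

Conversely, finitely many generators involve only finitely many group elements (angles, in (2)). The
subgroup these generate contains every value of every element of the group, and three-cycles on
small pieces attain all g in G, respectively all small angles.

For (2), the derived subgroup of IE(Γ) is `alt3` (`commutator_IE`). A three-cycle is a commutator of
two transpositions of pieces. In the other direction, IE(Γ) is generated by exchanges supported in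
short intervals; a three-cycle moves one short interval off another, so any two of these generators
commute modulo the normal subgroup `alt3`. -/

open scoped commutatorElement
set_option linter.unusedSectionVars false

namespace FullGroups

/-! ### Permuting the pieces of a jointly injective family -/

section Permute

variable {X ι : Type*}

/-- The maps `φ i` are injective on `U`, with pairwise disjoint images. -/
def JointlyInjOn (φ : ι → X → X) (U : Set X) : Prop :=
  ∀ i j, ∀ u ∈ U, ∀ v ∈ U, φ i u = φ j v → i = j ∧ u = v

theorem JointlyInjOn.mono {φ : ι → X → X} {U V : Set X} (h : JointlyInjOn φ V) (hUV : U ⊆ V) :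
    JointlyInjOn φ U :=
  fun i j u hu v hv => h i j u (hUV hu) v (hUV hv)

open Classical in
/-- The permutation of `X` that permutes the sets `φ i '' U` by means of `σ`, and fixes
all other points. -/
noncomputable def permute (φ : ι → X → X) (U : Set X) (σ : Equiv.Perm ι) : Equiv.Perm X :=
  if h : JointlyInjOn φ U then
    Equiv.Perm.viaEmbedding (α := ι × U) (σ.prodCongr (Equiv.refl U))
      ⟨fun p => φ p.1 p.2, fun p q e =>
        have := h p.1 q.1 p.2 p.2.2 q.2 q.2.2 e
        Prod.ext this.1 (Subtype.ext this.2)⟩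
  else 1

variable {φ : ι → X → X} {U V : Set X}

theorem permute_apply (h : JointlyInjOn φ U) (σ : Equiv.Perm ι) (i : ι) {u : X} (hu : u ∈ U) :
    permute φ U σ (φ i u) = φ (σ i) u := by
  rw [permute, dif_pos h]
  exact Equiv.Perm.viaEmbedding_apply (α := ι × U) _ _ (i, ⟨u, hu⟩)

theorem permute_apply_of_ne (h : JointlyInjOn φ U) (σ : Equiv.Perm ι) {y : X}
    (hy : ∀ i, ∀ u ∈ U, φ i u ≠ y) : permute φ U σ y = y := by
  rw [permute, dif_pos h]
  refine Equiv.Perm.viaEmbedding_apply_of_notMem _ _ _ ?_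
  rintro ⟨⟨i, u⟩, e⟩
  exact hy i u u.2 e

theorem eq_permute (h : JointlyInjOn φ U) {σ : Equiv.Perm ι} {τ : Equiv.Perm X}
    (h1 : ∀ i, ∀ u ∈ U, τ (φ i u) = φ (σ i) u)
    (h2 : ∀ y, (∀ i, ∀ u ∈ U, φ i u ≠ y) → τ y = y) : τ = permute φ U σ := by
  ext y
  by_cases hy : ∃ i, ∃ u ∈ U, φ i u = y
  · obtain ⟨i, u, hu, rfl⟩ := hy
    rw [h1 i u hu, permute_apply h _ _ hu]
  · push Not at hy
    rw [h2 y hy, permute_apply_of_ne h _ hy]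

theorem permute_mul (h : JointlyInjOn φ U) (σ τ : Equiv.Perm ι) :
    permute φ U (σ * τ) = permute φ U σ * permute φ U τ := by
  refine (eq_permute h (fun i u hu => ?_) fun y hy => ?_).symm
  · simp [permute_apply h _ _ hu]
  · simp [permute_apply_of_ne h _ hy]

theorem permute_one (h : JointlyInjOn φ U) : permute φ U 1 = 1 :=
  (eq_permute h (by simp) (by simp)).symm

theorem permute_inv (h : JointlyInjOn φ U) (σ : Equiv.Perm ι) :
    permute φ U σ⁻¹ = (permute φ U σ)⁻¹ := by
  rw [eq_inv_iff_mul_eq_one, ← permute_mul h, inv_mul_cancel, permute_one h]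

open Classical in
theorem permute_apply_ite (h : JointlyInjOn φ V) (hUV : U ⊆ V) (σ : Equiv.Perm ι) (i : ι)
    {v : X} (hv : v ∈ V) : permute φ U σ (φ i v) = φ (if v ∈ U then σ i else i) v := by
  split_ifs with hu
  · exact permute_apply (h.mono hUV) σ i hu
  · exact permute_apply_of_ne (h.mono hUV) σ fun j u hu' e =>
      hu ((h j i u (hUV hu') v hv e).2 ▸ hu')

theorem permute_empty (σ : Equiv.Perm ι) : permute φ ∅ σ = 1 :=
  (eq_permute (fun _ _ u hu => absurd hu (notMem_empty u)) (by simp) (by simp)).symm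

theorem permute_union (h : JointlyInjOn φ (U ∪ V)) (hd : Disjoint U V) (σ : Equiv.Perm ι) :
    permute φ (U ∪ V) σ = permute φ U σ * permute φ V σ := by
  refine (eq_permute h (fun i u hu => ?_) fun y hy => ?_).symm
  · rw [Equiv.Perm.mul_apply, permute_apply_ite h subset_union_right σ i hu,
      permute_apply_ite h subset_union_left σ _ hu]
    rcases hu with hu | hu
    · simp [hu, disjoint_left.1 hd hu]
    · simp [hu, disjoint_right.1 hd hu]
  · rw [Equiv.Perm.mul_apply,
      permute_apply_of_ne (h.mono subset_union_right) σ fun i u hu => hy i u (Or.inr hu),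
      permute_apply_of_ne (h.mono subset_union_left) σ fun i u hu => hy i u (Or.inl hu)]

/-- Over a point outside U₁ or outside U₂ one of the two permutations does nothing, so the
commutator is trivial there; over the intersection it is the commutator in the symmetric group of
the indices. -/
theorem permute_commutator {U₁ U₂ : Set X} (h : JointlyInjOn φ V) (h1 : U₁ ⊆ V) (h2 : U₂ ⊆ V)
    (σ τ : Equiv.Perm ι) :
    ⁅permute φ U₁ σ, permute φ U₂ τ⁆ = permute φ (U₁ ∩ U₂) ⁅σ, τ⁆ := by
  have h12 : U₁ ∩ U₂ ⊆ V := inter_subset_left.trans h1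
  ext y
  rw [commutatorElement_def, ← permute_inv (h.mono h1), ← permute_inv (h.mono h2)]
  simp only [Equiv.Perm.mul_apply]
  by_cases hy : ∃ i, ∃ u ∈ V, φ i u = y
  · obtain ⟨i, u, hu, rfl⟩ := hy
    simp only [permute_apply_ite h h1 _ _ hu, permute_apply_ite h h2 _ _ hu,
      permute_apply_ite h h12 _ _ hu]
    by_cases hu1 : u ∈ U₁ <;> by_cases hu2 : u ∈ U₂ <;> simp [hu1, hu2, commutatorElement_def]
  · push Not at hy
    rw [permute_apply_of_ne (h.mono h2) _ fun i u hu => hy i u (h2 hu),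
      permute_apply_of_ne (h.mono h1) _ fun i u hu => hy i u (h1 hu),
      permute_apply_of_ne (h.mono h2) _ fun i u hu => hy i u (h2 hu),
      permute_apply_of_ne (h.mono h1) _ fun i u hu => hy i u (h1 hu),
      permute_apply_of_ne (h.mono h12) _ fun i u hu => hy i u (h12 hu)]

theorem permute_congr {ψ : ι → X → X} (h : ∀ i, ∀ u ∈ U, φ i u = ψ i u) (σ : Equiv.Perm ι) :
    permute φ U σ = permute ψ U σ := by
  have key : ∀ {φ ψ : ι → X → X}, (∀ i, ∀ u ∈ U, φ i u = ψ i u) → JointlyInjOn φ U →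
      JointlyInjOn ψ U := by
    intro φ ψ h hφ i j u hu v hv e
    exact hφ i j u hu v hv (by rw [h i u hu, h j v hv, e])
  by_cases hφ : JointlyInjOn φ U
  · refine eq_permute (key h hφ) (fun i u hu => ?_) fun y hy => ?_
    · rw [← h i u hu, ← h _ u hu, permute_apply hφ _ _ hu]
    · exact permute_apply_of_ne hφ _ fun i u hu => h i u hu ▸ hy i u hu
  · rw [permute, permute, dif_neg hφ, dif_neg fun hψ => hφ (key (fun i u hu => (h i u hu).symm) hψ)]

/-- Compares a permutation of some members of a family with its extension to the whole family, so
that several three-cycles can be computed in one symmetric group. -/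
theorem permute_reindex {κ : Type*} (h : JointlyInjOn φ U) (e : κ → ι) (he : e.Injective)
    (σ : Equiv.Perm ι) (σ' : Equiv.Perm κ) (h1 : ∀ k, σ (e k) = e (σ' k))
    (h2 : ∀ i, (∀ k, e k ≠ i) → σ i = i) :
    permute (fun k => φ (e k)) U σ' = permute φ U σ := by
  have h' : JointlyInjOn (fun k => φ (e k)) U := fun i j u hu v hv e' =>
    have := h _ _ u hu v hv e'
    ⟨he this.1, this.2⟩
  refine eq_permute h (fun i u hu => ?_) fun y hy => ?_
  · by_cases hi : ∃ k, e k = i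
    · obtain ⟨k, rfl⟩ := hi
      rw [permute_apply h' σ' k hu, h1]
    · push Not at hi
      rw [h2 i hi, permute_apply_of_ne h']
      intro k v hv e'
      exact hi k (h _ _ v hv u hu e').1
  · exact permute_apply_of_ne h' _ fun k u hu => hy _ u hu

/-- Conjugation of a permutation of pieces moves the pieces. -/
theorem permute_conj (h : JointlyInjOn φ U) (f : Equiv.Perm X) (σ : Equiv.Perm ι) :
    f * permute φ U σ * f⁻¹ = permute (fun i x => f (φ i x)) U σ := by
  have h' : JointlyInjOn (fun i x => f (φ i x)) U := fun i j u hu v hv e =>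
    h i j u hu v hv (f.injective e)
  refine eq_permute h' (fun i u hu => ?_) fun y hy => ?_
  · simp [permute_apply h _ _ hu]
  · rw [Equiv.Perm.mul_apply, Equiv.Perm.mul_apply, permute_apply_of_ne h]
    · simp
    · rintro i u hu e
      exact hy i u hu (by rw [e]; simp)

end Permute

/-! ### Three-cycles of translates and their relations -/

section Cyc

variable {G X : Type*} [Group G] [MulAction G X]

/-- The sets `a U` and `b U` are disjoint. -/
def Sep (U : Set X) (a b : G) : Prop := ∀ u ∈ U, ∀ v ∈ U, a • u ≠ b • v

theorem Sep.symm {U : Set X} {a b : G} (h : Sep U a b) : Sep U b a :=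
  fun u hu v hv e => h v hv u hu e.symm

theorem Sep.mono {U V : Set X} {a b : G} (h : Sep V a b) (hUV : U ⊆ V) : Sep U a b :=
  fun u hu v hv => h u (hUV hu) v (hUV hv)

theorem jointlyInjOn_smul {ι : Type*} {g : ι → G} {U : Set X}
    (h : ∀ i j, i ≠ j → Sep U (g i) (g j)) : JointlyInjOn (fun i (x : X) => g i • x) U := by
  intro i j u hu v hv e
  by_cases hij : i = j
  · subst hij
    exact ⟨rfl, MulAction.injective _ e⟩
  · exact absurd e (h i j hij u hu v hv)

/-- The permutation that maps `a U` to `b U` to `c U` to `a U` by translations. -/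
noncomputable def cyc (U : Set X) (a b c : G) : Equiv.Perm X :=
  permute (fun i (x : X) => ![a, b, c] i • x) U (finRotate 3)

/-- The sets `a U`, `b U`, `c U` are pairwise disjoint. -/
structure Sep3 (U : Set X) (a b c : G) : Prop where
  ab : Sep U a b
  bc : Sep U b c
  ac : Sep U a c

theorem Sep3.mono {U V : Set X} {a b c : G} (h : Sep3 V a b c) (hUV : U ⊆ V) : Sep3 U a b c :=
  ⟨h.1.mono hUV, h.2.mono hUV, h.3.mono hUV⟩

theorem pairwise_sep {U : Set X} {n : ℕ} {g : Fin n → G}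
    (h : (List.ofFn g).Pairwise (Sep U)) : ∀ i j, i ≠ j → Sep U (g i) (g j) := by
  rw [List.pairwise_ofFn] at h
  intro i j hij
  rcases lt_or_gt_of_ne hij with h' | h'
  · exact h h'
  · exact (h h').symm

theorem Sep3.jointlyInjOn {U : Set X} {a b c : G} (h : Sep3 U a b c) :
    JointlyInjOn (fun i (x : X) => ![a, b, c] i • x) U :=
  jointlyInjOn_smul (pairwise_sep (by simp [h.1, h.2, h.3]))

/-- Reduces relations between three-cycles with positions among g to relations in the symmetric
group on `Fin n`, which `decide` settles. -/
theorem cyc_eq_permute {U : Set X} {n : ℕ} {g : Fin n → G}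
    (h : JointlyInjOn (fun i (x : X) => g i • x) U) (i j k : Fin n) (σ : Equiv.Perm (Fin n))
    (hij : i ≠ j) (hik : i ≠ k) (hjk : j ≠ k)
    (h1 : σ i = j) (h2 : σ j = k) (h3 : σ k = i) (h4 : ∀ l, l ≠ i → l ≠ j → l ≠ k → σ l = l) :
    cyc U (g i) (g j) (g k) = permute (fun i (x : X) => g i • x) U σ := by
  have hinj : Function.Injective ![i, j, k] := by
    intro a b; fin_cases a <;> fin_cases b <;> simp [hij, hik, hjk, hij.symm, hik.symm, hjk.symm]
  rw [← permute_reindex h ![i, j, k] hinj σ (finRotate 3)]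
  · refine permute_congr (fun l u _ => ?_) _
    fin_cases l <;> rfl
  · intro l
    fin_cases l <;> simpa
  · intro l hl
    exact h4 l (fun e => hl 0 e.symm) (fun e => hl 1 e.symm) fun e => hl 2 e.symm

theorem cyc_empty (a b c : G) : cyc (∅ : Set X) a b c = 1 := permute_empty _

theorem cyc_union {U V : Set X} {a b c : G} (h : Sep3 (U ∪ V) a b c) (hd : Disjoint U V) :
    cyc (U ∪ V) a b c = cyc U a b c * cyc V a b c :=
  permute_union h.jointlyInjOn hd _

/-- The pieces are the same, because (as)(s⁻¹U) = aU: a change of base point. -/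
theorem cyc_preimage {U : Set X} {a b c : G} (s : G) :
    cyc ((fun x => s • x) ⁻¹' U) (a * s) (b * s) (c * s) = cyc U a b c := by
  have e1 : ∀ i, ![a * s, b * s, c * s] i = ![a, b, c] i * s := by
    intro i; fin_cases i <;> rfl
  have key : ∀ (g : Fin 3 → G), JointlyInjOn (fun i (x : X) => g i • x) U ↔
      JointlyInjOn (fun i (x : X) => (g i * s) • x) ((fun x => s • x) ⁻¹' U) := by
    intro g
    constructor
    · intro h i j u hu v hv e
      simp only [mul_smul] at e
      have := h i j _ hu _ hv e
      exact ⟨this.1, MulAction.injective _ this.2⟩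
    · intro h i j u hu v hv e
      have := h i j (s⁻¹ • u) (by simpa) (s⁻¹ • v) (by simpa) (by simpa [mul_smul] using e)
      exact ⟨this.1, MulAction.injective _ this.2⟩
  simp only [cyc, e1]
  by_cases h : JointlyInjOn (fun i (x : X) => ![a, b, c] i • x) U
  · have h' := (key _).1 h
    refine eq_permute h (fun i u hu => ?_) fun y hy => ?_
    · have := permute_apply h' (finRotate 3) i (u := s⁻¹ • u) (by simpa)
      simpa [mul_smul] using this
    · exact permute_apply_of_ne h' _ fun i u hu => by simpa [mul_smul] using hy i _ hu
  -- Without joint injectivity both sides take the default value 1, so no separation hypothesis is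
  -- needed.
  · rw [permute, permute, dif_neg h, dif_neg fun h' => h ((key _).2 h')]

theorem Sep3.preimage {U : Set X} {a b c : G} (h : Sep3 U a b c) (s : G) :
    Sep3 ((fun x => s • x) ⁻¹' U) (a * s) (b * s) (c * s) := by
  constructor <;> intro u hu v hv e <;> simp only [mul_smul] at e
  exacts [h.1 _ hu _ hv e, h.2 _ hu _ hv e, h.3 _ hu _ hv e]

variable {K : Subgroup (Equiv.Perm X)} {U : Set X} {a b c p q r t : G}

theorem cyc_rotate_mem (hs : Sep3 U a b c) (h : cyc U a b c ∈ K) : cyc U b c a ∈ K := by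
  have := cyc_eq_permute hs.jointlyInjOn 1 2 0 (finRotate 3) (by decide) (by decide) (by decide)
    (by decide) (by decide) (by decide) (by decide)
  exact this ▸ h

theorem cyc_swap_mem (hs : Sep3 U a b c) (h : cyc U a b c ∈ K) : cyc U b a c ∈ K := by
  have := cyc_eq_permute hs.jointlyInjOn 1 0 2 (finRotate 3)⁻¹ (by decide) (by decide) (by decide)
    (by decide) (by decide) (by decide) (by decide)
  rw [permute_inv hs.jointlyInjOn] at this
  exact this ▸ inv_mem h

/-- The three-cycles (a b p) and (a c q) have only a in common, and their commutator is (a b c). -/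
theorem cyc_commutator_mem {V U₁ U₂ : Set X} (hs : [a, b, p, c, q].Pairwise (Sep V))
    (h1 : U₁ ⊆ V) (h2 : U₂ ⊆ V) (m1 : cyc U₁ a b p ∈ K) (m2 : cyc U₂ a c q ∈ K) :
    cyc (U₁ ∩ U₂) a b c ∈ K := by
  have hV : JointlyInjOn (fun i (x : X) => ![a, b, p, c, q] i • x) V :=
    jointlyInjOn_smul (pairwise_sep (by simpa using hs))
  let σ : Equiv.Perm (Fin 5) := Equiv.swap 0 1 * Equiv.swap 1 2
  let τ : Equiv.Perm (Fin 5) := Equiv.swap 0 3 * Equiv.swap 3 4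
  have e1 := cyc_eq_permute (hV.mono h1) 0 1 2 σ
    (by decide) (by decide) (by decide) (by decide) (by decide) (by decide) (by decide)
  have e2 := cyc_eq_permute (hV.mono h2) 0 3 4 τ
    (by decide) (by decide) (by decide) (by decide) (by decide) (by decide) (by decide)
  have e3 := cyc_eq_permute (hV.mono ((inter_subset_left (t := U₂)).trans h1)) 0 1 3 ⁅σ, τ⁆
    (by decide) (by decide) (by decide) (by decide) (by decide) (by decide) (by decide)
  rw [← permute_commutator hV h1 h2, ← e1, ← e2] at e3
  have e3' : cyc (U₁ ∩ U₂) a b c = ⁅cyc U₁ a b p, cyc U₂ a c q⁆ := e3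
  rw [e3', commutatorElement_def]
  exact mul_mem (mul_mem (mul_mem m1 m2) (inv_mem m1)) (inv_mem m2)

/-- Conjugating (b p q) by (a p q) gives (b q a), which is (a b q). -/
theorem cyc_conj_mem (hs : [a, b, p, q].Pairwise (Sep U)) (m1 : cyc U a p q ∈ K)
    (m2 : cyc U b p q ∈ K) : cyc U a b q ∈ K := by
  have hU : JointlyInjOn (fun i (x : X) => ![a, b, p, q] i • x) U :=
    jointlyInjOn_smul (pairwise_sep (by simpa using hs))
  let σ : Equiv.Perm (Fin 4) := Equiv.swap 0 2 * Equiv.swap 2 3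
  let τ : Equiv.Perm (Fin 4) := Equiv.swap 1 2 * Equiv.swap 2 3
  have e1 := cyc_eq_permute hU 0 2 3 σ
    (by decide) (by decide) (by decide) (by decide) (by decide) (by decide) (by decide)
  have e2 := cyc_eq_permute hU 1 2 3 τ
    (by decide) (by decide) (by decide) (by decide) (by decide) (by decide) (by decide)
  have e3 := cyc_eq_permute hU 0 1 3 (σ * τ * σ⁻¹)
    (by decide) (by decide) (by decide) (by decide) (by decide) (by decide) (by decide)
  rw [permute_mul hU, permute_mul hU, permute_inv hU, ← e1, ← e2] at e3
  have e3' : cyc U a b q = cyc U a p q * cyc U b p q * (cyc U a p q)⁻¹ := e3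
  rw [e3']
  exact mul_mem (mul_mem m1 m2) (inv_mem m1)

/-- Three-cycles through two fixed letters p, q generate the alternating group. This reduces
arbitrary positions to the treatment of one position at a time. -/
theorem cyc_mem_of_three (hs : [a, b, c, p, q].Pairwise (Sep U)) (m1 : cyc U a p q ∈ K)
    (m2 : cyc U b p q ∈ K) (m3 : cyc U c p q ∈ K) : cyc U a b c ∈ K := by
  simp only [List.pairwise_cons, List.mem_cons, forall_eq_or_imp, List.not_mem_nil,
    IsEmpty.forall_iff, implies_true, List.Pairwise.nil, and_true] at hs
  obtain ⟨⟨ab, ac, ap, aq⟩, ⟨bc, bp, bq⟩, ⟨cp, cq⟩, pq⟩ := hs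
  have h1 : cyc U a c q ∈ K := cyc_conj_mem (p := p) (by simp [*]) m1 m3
  have h2 : cyc U b c q ∈ K := cyc_conj_mem (p := p) (by simp [*]) m2 m3
  have h3 : cyc U a q c ∈ K := cyc_rotate_mem ⟨ac.symm, aq, cq⟩ (cyc_swap_mem ⟨ac, cq, aq⟩ h1)
  have h4 : cyc U b q c ∈ K := cyc_rotate_mem ⟨bc.symm, bq, cq⟩ (cyc_swap_mem ⟨bc, cq, bq⟩ h2)
  exact cyc_conj_mem (p := q) (by simp [*, cq.symm]) h3 h4

end Cyc

/-! ### Finite covers and positions in general position -/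

section Covers

variable (G : Type*) {X : Type*} [Group G] [MulAction G X]

/-- The group generated by the `cyc U a b c` with `U` in the Boolean algebra `𝓑`. -/
def alt3 (𝓑 : BooleanSubalgebra (Set X)) : Subgroup (Equiv.Perm X) :=
  Subgroup.closure {τ | ∃ U ∈ 𝓑, ∃ a b c : G, Sep3 U a b c ∧ τ = cyc U a b c}

/-- A finite family in `𝓑` that covers all points not fixed by `G`. -/
structure Covers (𝓑 : BooleanSubalgebra (Set X)) (𝒱 : Finset (Set X)) : Prop where
  mem : ∀ V ∈ 𝒱, V ∈ 𝓑
  cover : ∀ x : X, (∃ V ∈ 𝒱, x ∈ V) ∨ ∀ g : G, g • x = x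

variable {G}

/-- Local to global: U is cut along the members of the cover one after the other, each cut being a
disjoint union inside 𝓑. -/
theorem cover_induction {𝓑 : BooleanSubalgebra (Set X)} (Q : Set X → Prop) {U : Set X}
    (hU : U ∈ 𝓑) (h0 : Q ∅) (hu : ∀ A ∈ 𝓑, ∀ B ∈ 𝓑, Disjoint A B → A ∪ B ⊆ U → Q A → Q B → Q (A ∪ B))
    (𝒱 : Finset (Set X)) (h𝒱 : ∀ V ∈ 𝒱, V ∈ 𝓑) (hcov : ∀ x ∈ U, ∃ V ∈ 𝒱, x ∈ V)
    (hloc : ∀ V ∈ 𝒱, ∀ A ∈ 𝓑, A ⊆ U → A ⊆ V → Q A) : Q U := by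
  classical
  have key : ∀ 𝒱' ⊆ 𝒱, ∀ A ∈ 𝓑, A ⊆ U → (∀ x ∈ A, ∃ V ∈ 𝒱', x ∈ V) → Q A := by
    intro 𝒱'
    induction 𝒱' using Finset.induction_on with
    | empty =>
      intro _ A _ _ h
      have : A = ∅ := eq_empty_of_forall_notMem fun x hx => by simpa using h x hx
      exact this ▸ h0
    | insert V 𝒱' _ ih =>
      intro hsub A hA hAU h
      have hV := hsub (Finset.mem_insert_self V 𝒱')
      rw [← inter_union_sdiff A V]
      have h1 : A ∩ V ∈ 𝓑 := 𝓑.inf_mem hA (h𝒱 V hV)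
      have h2 : A \ V ∈ 𝓑 := BooleanSubalgebra.sdiff_mem hA (h𝒱 V hV)
      refine hu _ h1 _ h2 disjoint_sdiff_inter.symm (by rwa [inter_union_sdiff])
        (hloc V hV _ h1 (inter_subset_left.trans hAU) inter_subset_right)
        (ih ((Finset.subset_insert _ _).trans hsub) _ h2 (sdiff_subset.trans hAU) ?_)
      rintro x ⟨hx, hxV⟩
      obtain ⟨V', hV', hxV'⟩ := h x hx
      rcases Finset.mem_insert.1 hV' with rfl | h'
      · exact absurd hxV' hxV
      · exact ⟨V', h', hxV'⟩
  exact key 𝒱 subset_rfl U hU subset_rfl hcov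

theorem cyc_inter_mem_of_cover {𝓑 : BooleanSubalgebra (Set X)} {K : Subgroup (Equiv.Perm X)}
    {U W : Set X} {a b c : G} (hs : Sep3 W a b c) (hW : W ∈ 𝓑) {𝒱 : Finset (Set X)}
    (h𝒱 : Covers G 𝓑 𝒱)
    (hloc : ∀ V ∈ 𝒱, ∀ A ∈ 𝓑, A ⊆ W → A ⊆ V → cyc (U ∩ A) a b c ∈ K) :
    cyc (U ∩ W) a b c ∈ K := by
  refine cover_induction (fun A => cyc (U ∩ A) a b c ∈ K) hW ?_ ?_ 𝒱 h𝒱.mem ?_ hloc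
  · rw [inter_empty, cyc_empty]
    exact one_mem K
  · intro A _ B _ hd hAB h1 h2
    rw [inter_union_distrib_left, cyc_union]
    · exact mul_mem h1 h2
    · rw [← inter_union_distrib_left]
      exact hs.mono (inter_subset_right.trans hAB)
    · exact hd.mono inter_subset_right inter_subset_right
  · intro x hx
    refine (h𝒱.cover x).resolve_right fun h => ?_
    -- A point fixed by G has equal images under a and b, so it cannot lie in a set with separated
    -- translates; covers may therefore omit such points.
    exact hs.1 x hx x hx ((h a).trans (h b).symm)

theorem cyc_mem_of_cover {𝓑 : BooleanSubalgebra (Set X)} {K : Subgroup (Equiv.Perm X)}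
    {W : Set X} {a b c : G} (hs : Sep3 W a b c) (hW : W ∈ 𝓑) {𝒱 : Finset (Set X)}
    (h𝒱 : Covers G 𝓑 𝒱) (hloc : ∀ V ∈ 𝒱, ∀ A ∈ 𝓑, A ⊆ W → A ⊆ V → cyc A a b c ∈ K) :
    cyc W a b c ∈ K := by
  have := cyc_inter_mem_of_cover (U := univ) hs hW h𝒱 (by simpa using hloc)
  simpa using this

/-- Every set generated by T is a preimage under the map that records which members of T contain a
point, and that map takes values in a finite set. -/
theorem exists_finite_booleanSubalgebra {T : Set (Set X)} (hT : T.Finite) :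
    ∃ 𝒲 : BooleanSubalgebra (Set X), T ⊆ 𝒲 ∧ (𝒲 : Set (Set X)).Finite ∧
      ∀ 𝓑 : BooleanSubalgebra (Set X), T ⊆ 𝓑 → 𝒲 ≤ 𝓑 := by
  refine ⟨BooleanSubalgebra.closure T, BooleanSubalgebra.subset_closure, ?_,
    fun 𝓑 h => BooleanSubalgebra.closure_le.2 h⟩
  have := hT.to_subtype
  let φ : X → Set T := fun x => {V | x ∈ V.1}
  let M : BooleanSubalgebra (Set X) :=
    { carrier := range (fun A : Set (Set T) => φ ⁻¹' A)
      supClosed' := by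
        rintro _ ⟨A, rfl⟩ _ ⟨B, rfl⟩
        exact ⟨A ∪ B, rfl⟩
      infClosed' := by
        rintro _ ⟨A, rfl⟩ _ ⟨B, rfl⟩
        exact ⟨A ∩ B, rfl⟩
      compl_mem' := by
        rintro _ ⟨A, rfl⟩
        exact ⟨Aᶜ, rfl⟩
      bot_mem' := ⟨∅, rfl⟩ }
  have hM : BooleanSubalgebra.closure T ≤ M :=
    BooleanSubalgebra.closure_le.2 fun V hV => ⟨{A | ⟨V, hV⟩ ∈ A}, rfl⟩
  exact (finite_range _).subset hM

/-- If nonfixed points have large orbits under `F₀` and can be separated by small sets, then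
locally there are elements of `F₀` in general position. -/
theorem exists_generic {𝓑 : BooleanSubalgebra (Set X)} (F₀ : Finset G)
    (horb : ∀ x : X, (∃ g : G, g • x ≠ x) → ∀ s : Set X, s.Finite → s.ncard < 8 →
      ∃ f ∈ F₀, f • x ∉ s)
    (hsep : ∀ E : Set G, E.Finite → ∃ 𝒱 : Finset (Set X), Covers G 𝓑 𝒱 ∧
      ∀ V ∈ 𝒱, ∃ x : X, (∃ g : G, g • x ≠ x) ∧ ∀ a ∈ E, ∀ b ∈ E, a • x ≠ b • x → Sep V a b)
    (E : Set G) (hE : E.Finite) (b b' : G) :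
    ∃ 𝒱 : Finset (Set X), Covers G 𝓑 𝒱 ∧ ∀ V ∈ 𝒱, ∀ e₀ ∈ E, ∀ e₁ ∈ E, ∀ e₂ ∈ E, ∀ e₃ ∈ E,
      ∃ p ∈ F₀, ∃ q ∈ F₀, ∃ r ∈ F₀, ∃ t ∈ F₀, [p * b, q * b, r * b', t * b'].Pairwise (Sep V) ∧
        ∀ x ∈ [p * b, q * b, r * b', t * b'], ∀ y ∈ [e₀, e₁, e₂, e₃], Sep V y x := by
  have hfin : (E ∪ (fun f => f * b) '' F₀ ∪ (fun f => f * b') '' F₀).Finite :=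
    (hE.union (F₀.finite_toSet.image _)).union (F₀.finite_toSet.image _)
  obtain ⟨𝒱, h1, h2⟩ := hsep _ hfin
  refine ⟨𝒱, h1, fun V hV e₀ he₀ e₁ he₁ e₂ he₂ e₃ he₃ => ?_⟩
  obtain ⟨x, hx, hxs⟩ := h2 V hV
  have hx' : ∀ c : G, ∃ g : G, g • (c • x) ≠ c • x := by
    intro c
    by_contra! h
    obtain ⟨g, hg⟩ := hx
    have h3 : x = c • x := by simpa using h c⁻¹
    rw [← h3] at h
    exact hg (h g)
  -- The last choice has to avoid seven points, namely the images under the four elements of E and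
  -- under the three elements already chosen. This is the source of the bound 8.
  have pick : ∀ (c : G) (l : List X), l.length < 8 → ∃ f ∈ F₀, ∀ y ∈ l, y ≠ (f * c) • x := by
    classical
    intro c l hl
    obtain ⟨f, hf, h⟩ := horb (c • x) (hx' c) {y | y ∈ l} l.finite_toSet (by
      refine lt_of_le_of_lt ?_ hl
      rw [show {y | y ∈ l} = (l.toFinset : Set X) by ext; simp, ncard_coe_finset]
      exact l.toFinset_card_le)
    refine ⟨f, hf, fun y hy e => h ?_⟩
    rw [← mul_smul, ← e]
    exact hy
  obtain ⟨p, hp, hp'⟩ := pick b [e₀ • x, e₁ • x, e₂ • x, e₃ • x] (by simp)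
  obtain ⟨q, hq, hq'⟩ := pick b [e₀ • x, e₁ • x, e₂ • x, e₃ • x, (p * b) • x] (by simp)
  obtain ⟨r, hr, hr'⟩ := pick b' [e₀ • x, e₁ • x, e₂ • x, e₃ • x, (p * b) • x, (q * b) • x]
    (by simp)
  obtain ⟨t, ht, ht'⟩ := pick b' [e₀ • x, e₁ • x, e₂ • x, e₃ • x, (p * b) • x, (q * b) • x,
    (r * b') • x] (by simp)
  simp only [List.mem_cons, forall_eq_or_imp, List.not_mem_nil, IsEmpty.forall_iff, implies_true,
    and_true] at hp' hq' hr' ht'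
  have m1 : ∀ f ∈ F₀, f * b ∈ E ∪ (fun f => f * b) '' F₀ ∪ (fun f => f * b') '' F₀ :=
    fun f hf => Or.inl (Or.inr ⟨f, hf, rfl⟩)
  have m2 : ∀ f ∈ F₀, f * b' ∈ E ∪ (fun f => f * b) '' F₀ ∪ (fun f => f * b') '' F₀ :=
    fun f hf => Or.inr ⟨f, hf, rfl⟩
  have m3 : ∀ e ∈ E, e ∈ E ∪ (fun f => f * b) '' F₀ ∪ (fun f => f * b') '' F₀ :=
    fun e he => Or.inl (Or.inl he)
  refine ⟨p, hp, q, hq, r, hr, t, ht, ?_, ?_⟩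
  · simp only [List.pairwise_cons, List.mem_cons, forall_eq_or_imp, List.not_mem_nil,
      IsEmpty.forall_iff, implies_true, and_true, List.Pairwise.nil]
    refine ⟨⟨?_, ?_, ?_⟩, ⟨?_, ?_⟩, ?_⟩ <;> apply hxs <;> first | simp only [*] | tauto
  · simp only [List.mem_cons, forall_eq_or_imp, List.not_mem_nil,
      IsEmpty.forall_iff, implies_true, and_true]
    refine ⟨⟨?_, ?_, ?_, ?_⟩, ⟨?_, ?_, ?_, ?_⟩, ⟨?_, ?_, ?_, ?_⟩, ⟨?_, ?_, ?_, ?_⟩⟩ <;>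
      apply hxs <;> first | simp only [*] | tauto

end Covers

/-! ### The Boolean algebra of good sets -/

section Generation

variable {G X : Type*} [Group G] [MulAction G X] {𝓑 𝒲 : BooleanSubalgebra (Set X)}
  {K : Subgroup (Equiv.Perm X)} {F₀ F : Set G} {𝒱 : Finset (Set X)}

/-- On the members of `𝒱` there are four elements of `F₀` in general position with respect to
any three elements of `F`. -/
def Generic (F₀ F : Set G) (𝒱 : Finset (Set X)) : Prop :=
  ∀ V ∈ 𝒱, ∀ a ∈ F, ∀ b ∈ F, ∀ c ∈ F, ∃ p ∈ F₀, ∃ q ∈ F₀, ∃ r ∈ F₀, ∃ t ∈ F₀,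
    [p, q, r, t].Pairwise (Sep V) ∧ ∀ x ∈ [p, q, r, t], ∀ y ∈ [a, b, c], Sep V y x

/-- The sets whose intersections with members of `𝒲` carry three-cycles in `K`. -/
def goodSets (𝓑 𝒲 : BooleanSubalgebra (Set X)) (K : Subgroup (Equiv.Perm X)) (F : Set G) :
    Set (Set X) :=
  {U | U ∈ 𝓑 ∧ ∀ W ∈ 𝒲, ∀ a ∈ F, ∀ b ∈ F, ∀ c ∈ F, Sep3 W a b c → cyc (U ∩ W) a b c ∈ K}

/-- Take the commutator of (a b p) over U₁ with (a c q) over U₂. The letters p and q are separated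
from the others only over members of the cover, hence the localization. -/
theorem goodSets_inter (hF : F₀ ⊆ F) (h𝒱 : Covers G 𝒲 𝒱) (hgen : Generic F₀ F 𝒱) {U₁ U₂ : Set X}
    (h1 : U₁ ∈ goodSets 𝓑 𝒲 K F) (h2 : U₂ ∈ goodSets 𝓑 𝒲 K F) :
    U₁ ∩ U₂ ∈ goodSets 𝓑 𝒲 K F := by
  refine ⟨𝓑.inf_mem h1.1 h2.1, fun W hW a ha b hb c hc hs =>
    cyc_inter_mem_of_cover hs hW h𝒱 fun V hV A hA hAW hAV => ?_⟩
  obtain ⟨p, hp, q, hq, r, -, t, -, g1, g2⟩ := hgen V hV a ha b hb c hc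
  simp only [List.pairwise_cons, List.mem_cons, forall_eq_or_imp, List.not_mem_nil,
      IsEmpty.forall_iff, implies_true, and_true, List.Pairwise.nil] at g1 g2
  have s1 : ∀ {x y : G}, Sep V x y → Sep A x y := fun h => h.mono hAV
  have hsA := hs.mono hAW
  have e : U₁ ∩ U₂ ∩ A = (U₁ ∩ A) ∩ (U₂ ∩ A) := by
    ext x; simp only [mem_inter_iff]; tauto
  rw [e]
  refine cyc_commutator_mem (V := A) (p := p) (q := q) ?_ inter_subset_right inter_subset_right
    (h1.2 A hA a ha b hb p (hF hp) ⟨hsA.1, s1 g2.1.2.1, s1 g2.1.1⟩)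
    (h2.2 A hA a ha c hc q (hF hq) ⟨hsA.3, s1 g2.2.1.2.2, s1 g2.2.1.1⟩)
  simp [hsA.1, hsA.2, hsA.3, s1 g2.1.1, s1 g2.1.2.1, (s1 g2.1.2.2).symm, s1 g2.2.1.1,
    s1 g2.2.1.2.1, s1 g2.2.1.2.2, s1 g1.1.1]

/-- The three-cycle over W is a generator of K and is the product of those over U ∩ W and its
complement in W. -/
theorem goodSets_compl (hK : ∀ W ∈ 𝒲, ∀ a ∈ F, ∀ b ∈ F, ∀ c ∈ F, Sep3 W a b c → cyc W a b c ∈ K)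
    {U : Set X} (h : U ∈ goodSets 𝓑 𝒲 K F) : Uᶜ ∈ goodSets 𝓑 𝒲 K F := by
  refine ⟨𝓑.compl_mem h.1, fun W hW a ha b hb c hc hs => ?_⟩
  have e : (U ∩ W) ∪ (Uᶜ ∩ W) = W := by rw [← union_inter_distrib_right]; simp
  have := cyc_union (U := U ∩ W) (V := Uᶜ ∩ W) (a := a) (b := b) (c := c) (by rwa [e])
    (disjoint_compl_right.mono inter_subset_left inter_subset_left)
  rw [e] at this
  rw [← inv_mul_eq_iff_eq_mul.2 this]
  exact mul_mem (inv_mem (h.2 W hW a ha b hb c hc hs)) (hK W hW a ha b hb c hc hs)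

/-- By a change of base point, (p q t) over the preimage of U is the three-cycle over U with
positions ps⁻¹, qs⁻¹, ts⁻¹; these lie in F, so K contains it. Its commutator with a generator (p x
r) replaces t by an arbitrary x in F, and three such x recombine. -/
theorem goodSets_preimage (hF : F₀ ⊆ F) (h𝒱 : Covers G 𝒲 𝒱) (hgen : Generic F₀ F 𝒱)
    (hK : ∀ W ∈ 𝒲, ∀ a ∈ F, ∀ b ∈ F, ∀ c ∈ F, Sep3 W a b c → cyc W a b c ∈ K)
    (s : G) (hs𝓑 : ∀ U ∈ 𝓑, (fun x => s • x) ⁻¹' U ∈ 𝓑)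
    (hs𝒲 : ∀ V ∈ 𝒱, (fun x => s⁻¹ • x) ⁻¹' V ∈ 𝒲) (hsF : ∀ f ∈ F₀, f * s⁻¹ ∈ F)
    {U : Set X} (h : U ∈ goodSets 𝓑 𝒲 K F) :
    (fun x => s • x) ⁻¹' U ∈ goodSets 𝓑 𝒲 K F := by
  refine ⟨hs𝓑 U h.1, fun W hW a ha b hb c hc hs =>
    cyc_inter_mem_of_cover hs hW h𝒱 fun V hV A hA hAW hAV => ?_⟩
  obtain ⟨p, hp, q, hq, r, hr, t, ht, g1, g2⟩ := hgen V hV a ha b hb c hc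
  simp only [List.pairwise_cons, List.mem_cons, List.not_mem_nil,
      IsEmpty.forall_iff, implies_true, and_true, List.Pairwise.nil, forall_eq_or_imp] at g1
  have s1 : ∀ {x y : G}, Sep V x y → Sep A x y := fun h => h.mono hAV
  have hsA := hs.mono hAW
  have key : ∀ x ∈ [a, b, c], x ∈ F → cyc ((fun x => s • x) ⁻¹' U ∩ A) x p q ∈ K := by
    intro x hx hxF
    have xp : Sep V x p := g2 p (by simp) x hx
    have xq : Sep V x q := g2 q (by simp) x hx
    have xr : Sep V x r := g2 r (by simp) x hx
    have xt : Sep V x t := g2 t (by simp) x hx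
    have m1 : cyc A p x r ∈ K := hK A hA p (hF hp) x hxF r (hF hr)
      ⟨s1 xp.symm, s1 xr, s1 g1.1.2.1⟩
    have m2 : cyc ((fun x => s • x) ⁻¹' U ∩ V) p q t ∈ K := by
      have hV3 : Sep3 V p q t := ⟨g1.1.1, g1.2.1.2, g1.1.2.2⟩
      have := h.2 _ (hs𝒲 V hV) _ (hsF p hp) _ (hsF q hq) _ (hsF t ht) (hV3.preimage s⁻¹)
      rw [← cyc_preimage s] at this
      simpa [preimage_preimage] using this
    have m3 := cyc_commutator_mem (V := V) (p := r) (q := t)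
      (by simp [xp.symm, g1, xr, xq, xt, g1.2.1.1.symm]) hAV inter_subset_right m1 m2
    have e : A ∩ ((fun x => s • x) ⁻¹' U ∩ V) = (fun x => s • x) ⁻¹' U ∩ A := by
      ext y
      simp only [mem_inter_iff]
      exact ⟨fun hy => ⟨hy.2.1, hy.1⟩, fun hy => ⟨hy.2, hy.1, hAV hy.2⟩⟩
    rw [e] at m3
    exact cyc_swap_mem (Sep3.mono ⟨xp.symm, xq, g1.1.1⟩ (inter_subset_right.trans hAV)) m3
  refine cyc_mem_of_three (p := p) (q := q) ?_ (key a (by simp) ha) (key b (by simp) hb)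
    (key c (by simp) hc)
  have s2 : ∀ {x y : G}, Sep V x y → Sep ((fun x => s • x) ⁻¹' U ∩ A) x y :=
    fun h => h.mono (inter_subset_right.trans hAV)
  have hs' : Sep3 ((fun x => s • x) ⁻¹' U ∩ A) a b c := hsA.mono inter_subset_right
  simp [hs'.1, hs'.2, hs'.3, s2 g1.1.1, s2 (g2 p (by simp) a (by simp)),
    s2 (g2 p (by simp) b (by simp)), s2 (g2 p (by simp) c (by simp)),
    s2 (g2 q (by simp) a (by simp)), s2 (g2 q (by simp) b (by simp)),
    s2 (g2 q (by simp) c (by simp))]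

/-- The definition of a good set asks for separation over a member V of 𝒲, whereas a, b, c are
separated only over U. The letters p, q are in general position over all of V, so the detour through
(a p q), (b p q), (c p q) is legitimate. -/
theorem cyc_mem_of_goodSets (hF : F₀ ⊆ F) (h𝒱 : Covers G 𝓑 𝒱) (h𝒱' : ∀ V ∈ 𝒱, V ∈ 𝒲)
    (hgen : Generic F₀ F 𝒱) (hgood : ∀ U ∈ 𝓑, U ∈ goodSets 𝓑 𝒲 K F) :
    ∀ U ∈ 𝓑, ∀ a ∈ F, ∀ b ∈ F, ∀ c ∈ F, Sep3 U a b c → cyc U a b c ∈ K := by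
  intro U hU a ha b hb c hc hs
  refine cyc_mem_of_cover hs hU h𝒱 fun V hV A hA hAU hAV => ?_
  obtain ⟨p, hp, q, hq, r, hr, t, ht, g1, g2⟩ := hgen V hV a ha b hb c hc
  simp only [List.pairwise_cons, List.mem_cons, List.not_mem_nil,
      IsEmpty.forall_iff, implies_true, and_true, List.Pairwise.nil, forall_eq_or_imp] at g1
  have s1 : ∀ {x y : G}, Sep V x y → Sep A x y := fun h => h.mono hAV
  have hsA := hs.mono hAU
  have key : ∀ x ∈ [a, b, c], x ∈ F → cyc A x p q ∈ K := by
    intro x hx hxF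
    have := (hgood A hA).2 V (h𝒱' V hV) x hxF p (hF hp) q (hF hq)
      ⟨g2 p (by simp) x hx, g1.1.1, g2 q (by simp) x hx⟩
    rwa [inter_eq_left.2 hAV] at this
  refine cyc_mem_of_three (p := p) (q := q) ?_ (key a (by simp) ha) (key b (by simp) hb)
    (key c (by simp) hc)
  simp [hsA.1, hsA.2, hsA.3, s1 g1.1.1, s1 (g2 p (by simp) a (by simp)),
    s1 (g2 p (by simp) b (by simp)), s1 (g2 p (by simp) c (by simp)),
    s1 (g2 q (by simp) a (by simp)), s1 (g2 q (by simp) b (by simp)),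
    s1 (g2 q (by simp) c (by simp))]

end Generation

/-! ### Word length and the finite generation theorem -/

section Generation

variable {G X : Type*} [Group G] [MulAction G X] {𝓑 : BooleanSubalgebra (Set X)}
  {K : Subgroup (Equiv.Perm X)} {F₀ F : Set G}

/-- Two three-cycles with one common letter generate the alternating group on the five letters
involved. -/
theorem cyc_mem_of_share {U : Set X} {y p q f f' : G} (hs : [y, p, q, f, f'].Pairwise (Sep U))
    (m1 : cyc U y p q ∈ K) (m2 : cyc U y f f' ∈ K) : cyc U p f f' ∈ K := by
  simp only [List.pairwise_cons, List.mem_cons, List.not_mem_nil,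
      IsEmpty.forall_iff, implies_true, and_true, List.Pairwise.nil, forall_eq_or_imp] at hs
  obtain ⟨⟨yp, yq, yf, yf'⟩, ⟨pq, pf, pf'⟩, ⟨qf, qf'⟩, ff'⟩ := hs
  have m3 : cyc U y f' f ∈ K :=
    cyc_rotate_mem ⟨yf.symm, yf', ff'⟩ (cyc_swap_mem ⟨yf, ff', yf'⟩ m2)
  have h1 : cyc U y p f ∈ K := by
    have := cyc_commutator_mem (V := U) (a := y) (b := p) (p := q) (c := f) (q := f')
      (by simp [*]) subset_rfl subset_rfl m1 m2
    rwa [inter_self] at this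
  have h2 : cyc U y p f' ∈ K := by
    have := cyc_commutator_mem (V := U) (a := y) (b := p) (p := q) (c := f') (q := f)
      (by simp [*, ff'.symm]) subset_rfl subset_rfl m1 m3
    rwa [inter_self] at this
  have h3 : cyc U f y p ∈ K :=
    cyc_rotate_mem ⟨pf, yf.symm, yp.symm⟩ (cyc_rotate_mem ⟨yp, pf, yf⟩ h1)
  have h4 : cyc U f' y p ∈ K :=
    cyc_rotate_mem ⟨pf', yf'.symm, yp.symm⟩ (cyc_rotate_mem ⟨yp, pf', yf'⟩ h2)
  have h5 : cyc U f f' p ∈ K :=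
    cyc_conj_mem (p := y) (by simp [*, yf.symm, yf'.symm, pf.symm, pf'.symm]) h3 h4
  exact cyc_rotate_mem ⟨pf'.symm, pf, ff'.symm⟩ (cyc_rotate_mem ⟨ff', pf'.symm, pf.symm⟩ h5)

theorem cyc_mul_right_mem (h𝓑 : ∀ g : G, ∀ U ∈ 𝓑, (fun x => g • x) ⁻¹' U ∈ 𝓑)
    (hK : ∀ U ∈ 𝓑, ∀ a ∈ F, ∀ b ∈ F, ∀ c ∈ F, Sep3 U a b c → cyc U a b c ∈ K) (y : G)
    {U : Set X} (hU : U ∈ 𝓑) {a b c : G} (ha : a ∈ F) (hb : b ∈ F) (hc : c ∈ F)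
    (hs : Sep3 U (a * y) (b * y) (c * y)) : cyc U (a * y) (b * y) (c * y) ∈ K := by
  have h1 := hs.preimage y⁻¹
  simp only [mul_inv_cancel_right] at h1
  have := hK _ (h𝓑 y⁻¹ U hU) a ha b hb c hc h1
  rw [← cyc_preimage y] at this
  simpa [preimage_preimage] using this

/-- Prolongs a word y by a letter s. Locally K contains (y r t) by induction, and it contains (y fy
f'y) and (sy fy f'y) as right translates by y of three-cycles with positions in F. The first two
give (r fy f'y) and (t fy f'y); together with the third these give (sy r t). Finally r, t are traded
for p, q by three-cycles with positions in F₀. -/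
theorem cyc_mem_step (h𝓑 : ∀ g : G, ∀ U ∈ 𝓑, (fun x => g • x) ⁻¹' U ∈ 𝓑)
    (hF : F₀ ⊆ F) (hF1 : 1 ∈ F)
    (hgen : ∀ E : Set G, E.Finite → ∀ b b' : G, ∃ 𝒱 : Finset (Set X), Covers G 𝓑 𝒱 ∧
      ∀ V ∈ 𝒱, ∀ e₀ ∈ E, ∀ e₁ ∈ E, ∀ e₂ ∈ E, ∀ e₃ ∈ E,
      ∃ p ∈ F₀, ∃ q ∈ F₀, ∃ r ∈ F₀, ∃ t ∈ F₀, [p * b, q * b, r * b', t * b'].Pairwise (Sep V) ∧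
        ∀ x ∈ [p * b, q * b, r * b', t * b'], ∀ y ∈ [e₀, e₁, e₂, e₃], Sep V y x)
    (hK : ∀ U ∈ 𝓑, ∀ a ∈ F, ∀ b ∈ F, ∀ c ∈ F, Sep3 U a b c → cyc U a b c ∈ K)
    {s y : G} (hs : s ∈ F)
    (ih : ∀ U ∈ 𝓑, ∀ p ∈ F₀, ∀ q ∈ F₀, Sep3 U y p q → cyc U y p q ∈ K) :
    ∀ U ∈ 𝓑, ∀ p ∈ F₀, ∀ q ∈ F₀, Sep3 U (s * y) p q → cyc U (s * y) p q ∈ K := by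
  intro U hU p hp q hq h3
  obtain ⟨𝒱, h𝒱, hg⟩ := hgen {y, s * y, p, q} (by simp) y 1
  refine cyc_mem_of_cover h3 hU h𝒱 fun V hV A hA hAU hAV => ?_
  obtain ⟨f, hf, f', hf', r, hr, t, ht, g1, g2⟩ := hg V hV y (by simp) (s * y) (by simp)
    p (by simp) q (by simp)
  have g1 := g1.imp fun {_ _} h => Sep.mono h hAV
  have g2 : ∀ x ∈ [f * y, f' * y, r * 1, t * 1], ∀ e ∈ [y, s * y, p, q], Sep A e x :=
    fun x hx e he => (g2 x hx e he).mono hAV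
  have h3 := h3.mono hAU
  simp only [mul_one, List.pairwise_cons, List.mem_cons, List.not_mem_nil,
      IsEmpty.forall_iff, implies_true, and_true, List.Pairwise.nil, forall_eq_or_imp] at g1 g2
  obtain ⟨⟨ff', fr, ft⟩, ⟨f'r, f't⟩, rt⟩ := g1
  obtain ⟨⟨yf, sf, pf, qf⟩, ⟨yf', sf', pf', qf'⟩, ⟨yr, sr, pr, qr⟩, ⟨yt, st, pt, qt⟩⟩ := g2
  have m1 : cyc A y r t ∈ K := ih A hA r hr t ht ⟨yr, rt, yt⟩
  have m2 : cyc A y (f * y) (f' * y) ∈ K := by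
    have := cyc_mul_right_mem h𝓑 hK y hA hF1 (hF hf) (hF hf') (by
      rw [one_mul]
      exact ⟨yf, ff', yf'⟩)
    rwa [one_mul] at this
  have m3 : cyc A (s * y) (f * y) (f' * y) ∈ K :=
    cyc_mul_right_mem h𝓑 hK y hA hs (hF hf) (hF hf') ⟨sf, ff', sf'⟩
  have m4 : cyc A r (f * y) (f' * y) ∈ K :=
    cyc_mem_of_share (q := t) (by simp [*, fr.symm, f'r.symm, ft.symm, f't.symm]) m1 m2
  have m1' : cyc A y t r ∈ K :=
    cyc_rotate_mem ⟨yr.symm, yt, rt⟩ (cyc_swap_mem ⟨yr, rt, yt⟩ m1)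
  have m5 : cyc A t (f * y) (f' * y) ∈ K :=
    cyc_mem_of_share (q := r) (by simp [*, fr.symm, f'r.symm, ft.symm, f't.symm, rt.symm]) m1' m2
  have m6 : cyc A (s * y) r t ∈ K :=
    cyc_mem_of_three (p := f * y) (q := f' * y)
      (by simp [*, fr.symm, f'r.symm, ft.symm, f't.symm]) m3 m4 m5
  exact cyc_mem_of_three (p := r) (q := t) (by simp [*, h3.1, h3.2, h3.3]) m6
    (hK A hA p (hF hp) r (hF hr) t (hF ht) ⟨pr, rt, pt⟩)
    (hK A hA q (hF hq) r (hF hr) t (hF ht) ⟨qr, rt, qt⟩)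

/-- If a finitely generated group acts expansively on the sets of a Boolean algebra, has large
orbits and separates nearby points, then the group of its three-cycles is finitely generated. -/
theorem alt3_fg [hG : Group.FG G] (h𝓑 : ∀ g : G, ∀ U ∈ 𝓑, (fun x => g • x) ⁻¹' U ∈ 𝓑)
    (P : Set (Set X)) (hPfin : P.Finite) (hP : ∀ U ∈ P, U ∈ 𝓑)
    (hexp : ∀ 𝒞 : BooleanSubalgebra (Set X), (∀ U ∈ P, U ∈ 𝒞) →
      (∀ g : G, ∀ U ∈ 𝒞, (fun x => g • x) ⁻¹' U ∈ 𝒞) → 𝓑 ≤ 𝒞)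
    (F₀ : Finset G)
    (horb : ∀ x : X, (∃ g : G, g • x ≠ x) → ∀ s : Set X, s.Finite → s.ncard < 8 →
      ∃ f ∈ F₀, f • x ∉ s)
    (hsep : ∀ E : Set G, E.Finite → ∃ 𝒱 : Finset (Set X), Covers G 𝓑 𝒱 ∧
      ∀ V ∈ 𝒱, ∃ x : X, (∃ g : G, g • x ≠ x) ∧ ∀ a ∈ E, ∀ b ∈ E, a • x ≠ b • x → Sep V a b) :
    (alt3 G 𝓑).FG := by
  obtain ⟨S, hSc⟩ := Group.fg_def.1 hG
  let S' : Set G := S ∪ (fun s => s⁻¹) '' S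
  have hS'fin : S'.Finite := S.finite_toSet.union (S.finite_toSet.image _)
  -- The unit and the letters serve to prolong words, F₀ supplies auxiliary letters, and the
  -- products fs absorb the change of base point in `goodSets_preimage`.
  let F : Set G := {1} ∪ S' ∪ F₀ ∪ image2 (fun f s => f * s) F₀ S'
  have hFfin : F.Finite := (((finite_singleton 1).union hS'fin).union F₀.finite_toSet).union
    (F₀.finite_toSet.image2 _ hS'fin)
  have hS'F : S' ⊆ F := fun s hs => Or.inl (Or.inl (Or.inr hs))
  have hF₀F : (F₀ : Set G) ⊆ F := fun s hs => Or.inl (Or.inr hs)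
  have hF1 : 1 ∈ F := Or.inl (Or.inl (Or.inl rfl))
  have hFS : ∀ s ∈ S', ∀ f ∈ (F₀ : Set G), f * s ∈ F := fun s hs f hf => Or.inr ⟨f, hf, s, hs, rfl⟩
  have hSinv : ∀ s ∈ S', s⁻¹ ∈ S' := by
    rintro s (hs | ⟨s, hs, rfl⟩)
    · exact Or.inr ⟨s, hs, rfl⟩
    · exact Or.inl (by simpa using hs)
  have hgen := exists_generic F₀ horb hsep
  obtain ⟨𝒱, h𝒱, hg⟩ := hgen F hFfin 1 1
  have hg' : Generic (F₀ : Set G) F 𝒱 := by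
    intro V hV a ha b hb c hc
    obtain ⟨p, hp, q, hq, r, hr, t, ht, g1, g2⟩ := hg V hV a ha b hb c hc c hc
    simp only [mul_one] at g1 g2
    exact ⟨p, hp, q, hq, r, hr, t, ht, g1, fun x hx y hy => g2 x hx y (by
      simp only [List.mem_cons, List.not_mem_nil, or_false] at hy ⊢; tauto)⟩
  -- P starts the expansiveness argument, 𝒱 allows localization, and its translates are needed when
  -- a base point is changed by a letter.
  let T : Set (Set X) := P ∪ 𝒱 ∪ image2 (fun s V => (fun x => s • x) ⁻¹' V) S' 𝒱
  have hTfin : T.Finite := (hPfin.union 𝒱.finite_toSet).union (hS'fin.image2 _ 𝒱.finite_toSet)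
  obtain ⟨𝒲, hT𝒲, h𝒲fin, h𝒲⟩ := exists_finite_booleanSubalgebra hTfin
  have h𝒲𝓑 : 𝒲 ≤ 𝓑 := h𝒲 𝓑 <| by
    rintro V ((hV | hV) | ⟨s, -, V, hV, rfl⟩)
    · exact hP V hV
    · exact h𝒱.mem V hV
    · exact h𝓑 s V (h𝒱.mem V hV)
  have h𝒱𝒲 : ∀ V ∈ 𝒱, V ∈ 𝒲 := fun V hV => hT𝒲 (Or.inl (Or.inr hV))
  let gens : Set (Equiv.Perm X) :=
    {τ | ∃ W ∈ 𝒲, ∃ a ∈ F, ∃ b ∈ F, ∃ c ∈ F, Sep3 W a b c ∧ τ = cyc W a b c}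
  have hgens : gens.Finite := by
    have h1 : ((𝒲 : Set (Set X)) ×ˢ F ×ˢ F ×ˢ F).Finite :=
      h𝒲fin.prod (hFfin.prod (hFfin.prod hFfin))
    refine (h1.image fun w => cyc w.1 w.2.1 w.2.2.1 w.2.2.2).subset ?_
    rintro _ ⟨W, hW, a, ha, b, hb, c, hc, -, rfl⟩
    exact ⟨(W, a, b, c), ⟨hW, ha, hb, hc⟩, rfl⟩
  let K := Subgroup.closure gens
  have hK : ∀ W ∈ 𝒲, ∀ a ∈ F, ∀ b ∈ F, ∀ c ∈ F, Sep3 W a b c → cyc W a b c ∈ K :=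
    fun W hW a ha b hb c hc hs => Subgroup.subset_closure ⟨W, hW, a, ha, b, hb, c, hc, hs, rfl⟩
  have h𝒱W : Covers G 𝒲 𝒱 := ⟨h𝒱𝒲, h𝒱.cover⟩
  let 𝒞 : BooleanSubalgebra (Set X) :=
    { carrier := goodSets 𝓑 𝒲 K F
      supClosed' := by
        intro A hA B hB
        have := goodSets_compl hK (goodSets_inter hF₀F h𝒱W hg' (goodSets_compl hK hA)
          (goodSets_compl hK hB))
        rwa [← compl_union, compl_compl] at this
      infClosed' := fun A hA B hB => goodSets_inter hF₀F h𝒱W hg' hA hB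
      compl_mem' := fun h => goodSets_compl hK h
      bot_mem' := ⟨𝓑.bot_mem, fun W _ a _ b _ c _ _ => by
        change cyc (∅ ∩ W) a b c ∈ K
        rw [empty_inter, cyc_empty]
        exact one_mem K⟩ }
  have hgood : ∀ U ∈ 𝓑, U ∈ goodSets 𝓑 𝒲 K F := by
    -- The good sets contain P, since U ∩ W is in 𝒲 for U in P, and they are invariant under each
    -- letter, hence under G.
    refine hexp 𝒞 (fun U hU => ⟨hP U hU, fun W hW a ha b hb c hc hs => ?_⟩) ?_
    · exact hK _ (𝒲.inf_mem (hT𝒲 (Or.inl (Or.inl hU))) hW) a ha b hb c hc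
        (hs.mono inter_subset_right)
    · have step : ∀ s ∈ S', ∀ U ∈ 𝒞, (fun x => s • x) ⁻¹' U ∈ 𝒞 := fun s hs U hU =>
        goodSets_preimage hF₀F h𝒱W hg' hK s (h𝓑 s)
          (fun V hV => hT𝒲 (Or.inr ⟨s⁻¹, hSinv s hs, V, hV, rfl⟩))
          (hFS s⁻¹ (hSinv s hs)) hU
      have hmul : ∀ g h : G, ∀ U : Set X,
          (fun x => (g * h) • x) ⁻¹' U = (fun x => h • x) ⁻¹' ((fun x => g • x) ⁻¹' U) := by
        intro g h U; ext x; simp [mul_smul]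
      intro g
      have hgS : g ∈ Subgroup.closure (S : Set G) := hSc ▸ Subgroup.mem_top g
      induction hgS using Subgroup.closure_induction_left with
      | one => intro U hU; simpa using hU
      | mul_left s hs y _ ih => exact fun U hU => hmul s y U ▸ ih _ (step s (Or.inl hs) U hU)
      | inv_mul_cancel s hs y _ ih =>
        exact fun U hU => hmul s⁻¹ y U ▸ ih _ (step s⁻¹ (Or.inr ⟨s, hs, rfl⟩) U hU)
  have hKF := cyc_mem_of_goodSets hF₀F h𝒱 h𝒱𝒲 hg' hgood
  have hone : ∀ g : G, ∀ U ∈ 𝓑, ∀ p ∈ (F₀ : Set G), ∀ q ∈ (F₀ : Set G), Sep3 U g p q →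
      cyc U g p q ∈ K := by
    intro g
    have hgS : g ∈ Subgroup.closure (S : Set G) := hSc ▸ Subgroup.mem_top g
    induction hgS using Subgroup.closure_induction_left with
    | one => exact fun U hU p hp q hq hs => hKF U hU 1 hF1 p (hF₀F hp) q (hF₀F hq) hs
    | mul_left s hs y _ ih =>
      exact cyc_mem_step h𝓑 hF₀F hF1 hgen hKF (hS'F (Or.inl hs)) ih
    | inv_mul_cancel s hs y _ ih =>
      exact cyc_mem_step h𝓑 hF₀F hF1 hgen hKF (hS'F (Or.inr ⟨s, hs, rfl⟩)) ih
  have hall : alt3 G 𝓑 ≤ K := by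
    refine (Subgroup.closure_le _).2 ?_
    rintro _ ⟨U, hU, a, b, c, hs, rfl⟩
    obtain ⟨𝒱', h𝒱', hg2⟩ := hgen {a, b, c} (by simp) 1 1
    refine cyc_mem_of_cover hs hU h𝒱' fun V hV A hA hAU hAV => ?_
    obtain ⟨p, hp, q, hq, r, hr, t, ht, g1, g2⟩ := hg2 V hV a (by simp) b (by simp)
      c (by simp) c (by simp)
    have g1 := g1.imp fun {_ _} h => Sep.mono h hAV
    have g2 : ∀ x ∈ [p * 1, q * 1, r * 1, t * 1], ∀ e ∈ [a, b, c, c], Sep A e x :=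
      fun x hx e he => (g2 x hx e he).mono hAV
    have h3 := hs.mono hAU
    simp only [mul_one, List.pairwise_cons, List.mem_cons, List.not_mem_nil,
      IsEmpty.forall_iff, implies_true, and_true, List.Pairwise.nil, forall_eq_or_imp] at g1 g2
    obtain ⟨⟨ap, bp, cp, -⟩, ⟨aq, bq, cq, -⟩, -⟩ := g2
    exact cyc_mem_of_three (p := p) (q := q) (by simp [*, h3.1, h3.2, h3.3, g1.1.1])
      (hone a A hA p hp q hq ⟨ap, g1.1.1, aq⟩) (hone b A hA p hp q hq ⟨bp, g1.1.1, bq⟩)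
      (hone c A hA p hp q hq ⟨cp, g1.1.1, cq⟩)
  have hle : K ≤ alt3 G 𝓑 := by
    refine (Subgroup.closure_le _).2 ?_
    rintro _ ⟨W, hW, a, -, b, -, c, -, hs, rfl⟩
    exact Subgroup.subset_closure ⟨W, h𝒲𝓑 hW, a, b, c, hs, rfl⟩
  rw [le_antisymm hall hle]
  exact ⟨hgens.toFinset, by simp [K]⟩

/-- A three-cycle of pieces whose positions are piecewise given by the group. -/
theorem permute_mem_alt3 {U : Set X} (hU : U ∈ 𝓑) {φ : Fin 3 → X → X} (hφ : JointlyInjOn φ U)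
    {𝒱 : Finset (Set X)} (h𝒱 : ∀ V ∈ 𝒱, V ∈ 𝓑) (hcov : ∀ x ∈ U, ∃ V ∈ 𝒱, x ∈ V)
    (hloc : ∀ V ∈ 𝒱, ∀ i, ∃ g : G, ∀ x ∈ U, x ∈ V → φ i x = g • x) :
    permute φ U (finRotate 3) ∈ alt3 G 𝓑 := by
  refine cover_induction (fun A => permute φ A (finRotate 3) ∈ alt3 G 𝓑) hU ?_ ?_ 𝒱 h𝒱 hcov ?_
  · rw [permute_empty]
    exact one_mem _
  · intro A _ B _ hd hAB h1 h2
    rw [permute_union (hφ.mono hAB) hd]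
    exact mul_mem h1 h2
  · intro V hV A hA hAU hAV
    choose g hg using hloc V hV
    have hφA := hφ.mono hAU
    have e : ∀ i, ∀ u ∈ A, φ i u = ![g 0, g 1, g 2] i • u := by
      intro i u hu
      rw [hg i u (hAU hu) (hAV hu)]
      fin_cases i <;> rfl
    have hs : ∀ i j, i ≠ j → Sep A (g i) (g j) := by
      intro i j hij u hu v hv e'
      rw [← hg i u (hAU hu) (hAV hu), ← hg j v (hAU hv) (hAV hv)] at e'
      exact hij (hφA i j u hu v hv e').1
    rw [permute_congr e]
    exact Subgroup.subset_closure ⟨A, hA, g 0, g 1, g 2,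
      ⟨hs _ _ (by decide), hs _ _ (by decide), hs _ _ (by decide)⟩, rfl⟩

/-- Permutations that are piecewise given by the group normalize the group of three-cycles. -/
theorem alt3_conj_mem (h𝓑 : ∀ g : G, ∀ U ∈ 𝓑, (fun x => g • x) ⁻¹' U ∈ 𝓑)
    {f : Equiv.Perm X} {𝒱 : Finset (Set X)} (h𝒱 : ∀ V ∈ 𝒱, V ∈ 𝓑) (hcov : ∀ x, ∃ V ∈ 𝒱, x ∈ V)
    (hf : ∀ V ∈ 𝒱, ∃ g : G, ∀ x ∈ V, f x = g • x) {τ : Equiv.Perm X} (hτ : τ ∈ alt3 G 𝓑) :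
    f * τ * f⁻¹ ∈ alt3 G 𝓑 := by
  classical
  suffices h : alt3 G 𝓑 ≤ (alt3 G 𝓑).comap (MulAut.conj f).toMonoidHom from h hτ
  refine (Subgroup.closure_le _).2 ?_
  rintro _ ⟨U, hU, a, b, c, hs, rfl⟩
  have hinj := hs.jointlyInjOn
  change f * permute _ U (finRotate 3) * f⁻¹ ∈ alt3 G 𝓑
  rw [permute_conj hinj]
  -- The pieces of f are pulled back by a, b and c, so that over each piece f acts on all three
  -- translates by single group elements.
  refine permute_mem_alt3 (𝒱 := (𝒱 ×ˢ 𝒱 ×ˢ 𝒱).image fun w => (fun x => a • x) ⁻¹' w.1 ∩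
    ((fun x => b • x) ⁻¹' w.2.1 ∩ (fun x => c • x) ⁻¹' w.2.2)) hU
    (fun i j u hu v hv e => hinj i j u hu v hv (f.injective e)) ?_ ?_ ?_
  · intro V hV
    simp only [Finset.mem_image, Finset.mem_product] at hV
    obtain ⟨⟨V₁, V₂, V₃⟩, ⟨h1, h2, h3⟩, rfl⟩ := hV
    exact 𝓑.inf_mem (h𝓑 a _ (h𝒱 _ h1)) (𝓑.inf_mem (h𝓑 b _ (h𝒱 _ h2)) (h𝓑 c _ (h𝒱 _ h3)))
  · intro x _
    obtain ⟨V₁, h1, m1⟩ := hcov (a • x)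
    obtain ⟨V₂, h2, m2⟩ := hcov (b • x)
    obtain ⟨V₃, h3, m3⟩ := hcov (c • x)
    exact ⟨_, Finset.mem_image_of_mem _ (Finset.mk_mem_product h1 (Finset.mk_mem_product h2 h3)),
      m1, m2, m3⟩
  · intro V hV i
    simp only [Finset.mem_image, Finset.mem_product] at hV
    obtain ⟨⟨V₁, V₂, V₃⟩, ⟨h1, h2, h3⟩, rfl⟩ := hV
    obtain ⟨g₁, e1⟩ := hf V₁ h1
    obtain ⟨g₂, e2⟩ := hf V₂ h2
    obtain ⟨g₃, e3⟩ := hf V₃ h3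
    refine ⟨![g₁ * a, g₂ * b, g₃ * c] i, fun x _ hx => ?_⟩
    obtain ⟨m1, m2, m3⟩ := hx
    fin_cases i
    · exact (e1 _ m1).trans (mul_smul _ _ _).symm
    · exact (e2 _ m2).trans (mul_smul _ _ _).symm
    · exact (e3 _ m3).trans (mul_smul _ _ _).symm

end Generation

/-! ### Clopen sets of a totally disconnected compact space -/

section Clopen

variable (X : Type*) [TopologicalSpace X]

/-- The Boolean algebra of clopen sets. -/
def clopenAlgebra : BooleanSubalgebra (Set X) where
  carrier := {U | IsClopen U}
  supClosed' := fun _ hA _ hB => hA.union hB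
  infClosed' := fun _ hA _ hB => hA.inter hB
  compl_mem' := fun h => h.compl
  bot_mem' := isClopen_empty

variable {X}

theorem exists_clopen_cover {C : Set X} (hC : IsCompact C) {R : Set X → Prop}
    (h : ∀ x ∈ C, ∃ V, IsClopen V ∧ x ∈ V ∧ R V) :
    ∃ 𝒱 : Finset (Set X), (∀ V ∈ 𝒱, IsClopen V ∧ R V) ∧ ∀ x ∈ C, ∃ V ∈ 𝒱, x ∈ V := by
  classical
  refine hC.induction_on (p := fun S => ∃ 𝒱 : Finset (Set X), (∀ V ∈ 𝒱, IsClopen V ∧ R V) ∧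
    ∀ x ∈ S, ∃ V ∈ 𝒱, x ∈ V) ⟨∅, by simp, by simp⟩ ?_ ?_ fun x hx => ?_
  · rintro s t hst ⟨𝒱, h1, h2⟩
    exact ⟨𝒱, h1, fun x hx => h2 x (hst hx)⟩
  · rintro s t ⟨𝒱, h1, h2⟩ ⟨𝒱', h1', h2'⟩
    refine ⟨𝒱 ∪ 𝒱', fun V hV => (Finset.mem_union.1 hV).elim (h1 V) (h1' V), fun x hx => ?_⟩
    rcases hx with hx | hx
    · obtain ⟨V, hV, h⟩ := h2 x hx
      exact ⟨V, Finset.mem_union_left _ hV, h⟩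
    · obtain ⟨V, hV, h⟩ := h2' x hx
      exact ⟨V, Finset.mem_union_right _ hV, h⟩
  · obtain ⟨V, hV, hxV, hR⟩ := h x hx
    exact ⟨V, mem_nhdsWithin_of_mem_nhds (hV.isOpen.mem_nhds hxV), {V}, by simp [hV, hR],
      fun y hy => ⟨V, by simp, hy⟩⟩

variable [CompactSpace X] [T2Space X] [TotallyDisconnectedSpace X]
variable {G : Type*} [Group G] [MulAction G X] [ContinuousConstSMul G X]

theorem preimage_mem_clopenAlgebra (g : G) (U : Set X) (hU : U ∈ clopenAlgebra X) :
    (fun x => g • x) ⁻¹' U ∈ clopenAlgebra X :=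
  IsClopen.preimage hU (continuous_const_smul g)

/-- Only finitely many pairs of distinct images of x have to be kept apart, which continuity grants
on a neighbourhood. -/
theorem exists_clopen_forall_sep (E : Set G) (hE : E.Finite) (x : X) :
    ∃ V, IsClopen V ∧ x ∈ V ∧ ∀ a ∈ E, ∀ b ∈ E, a • x ≠ b • x → Sep V a b := by
  have h : ∀ᶠ V in (𝓝 x).smallSets, ∀ a ∈ E, ∀ b ∈ E, a • x ≠ b • x → Sep V a b := by
    refine (Filter.eventually_all_finite hE).2 fun a _ => (Filter.eventually_all_finite hE).2
      fun b _ => ?_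
    by_cases hab : a • x = b • x
    · exact Filter.Eventually.of_forall fun V h => absurd hab h
    obtain ⟨A, B, hA, hB, ha, hb, hd⟩ := t2_separation hab
    refine Filter.eventually_smallSets.2 ⟨(fun y => a • y) ⁻¹' A ∩ (fun y => b • y) ⁻¹' B, ?_, ?_⟩
    · exact Filter.inter_mem ((hA.preimage (continuous_const_smul a)).mem_nhds ha)
        ((hB.preimage (continuous_const_smul b)).mem_nhds hb)
    · intro V hV _ u hu v hv e
      exact disjoint_left.1 hd (hV hu).1 (show a • u ∈ B by rw [e]; exact (hV hv).2)
  obtain ⟨N, hN, h⟩ := Filter.eventually_smallSets.1 h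
  obtain ⟨O, hON, hO, hxO⟩ := mem_nhds_iff.1 hN
  obtain ⟨V, hV, hxV, hVO⟩ := compact_exists_isClopen_in_isOpen hO hxO
  exact ⟨V, hV, hxV, h V (hVO.trans hON)⟩

/-- Two compactness arguments: finite intersections separate a point of U from the complement of U,
and finite unions of the resulting sets exhaust U. -/
theorem mem_of_separates (𝒞 : BooleanSubalgebra (Set X))
    (hsep : ∀ x y : X, x ≠ y → ∃ C ∈ 𝒞, IsClopen C ∧ x ∈ C ∧ y ∉ C) {U : Set X}
    (hU : IsClopen U) : U ∈ 𝒞 := by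
  have h1 : ∀ x ∈ U, ∃ C ∈ 𝒞, IsClopen C ∧ x ∈ C ∧ Disjoint C Uᶜ := by
    intro x hx
    refine IsCompact.induction_on (p := fun S => ∃ C ∈ 𝒞, IsClopen C ∧ x ∈ C ∧ Disjoint C S)
      hU.compl.isClosed.isCompact ⟨univ, 𝒞.top_mem, isClopen_univ, mem_univ x, by simp⟩ ?_ ?_ ?_
    · rintro s t hst ⟨C, h1, h2, h3, h4⟩
      exact ⟨C, h1, h2, h3, h4.mono_right hst⟩
    · rintro s t ⟨C, h1, h2, h3, h4⟩ ⟨C', h1', h2', h3', h4'⟩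
      exact ⟨C ∩ C', 𝒞.inf_mem h1 h1', h2.inter h2', ⟨h3, h3'⟩,
        disjoint_union_right.2 ⟨h4.mono_left inter_subset_left, h4'.mono_left inter_subset_right⟩⟩
    · intro y hy
      obtain ⟨C, h1, h2, h3, h4⟩ := hsep x y fun e => hy (e ▸ hx)
      exact ⟨Cᶜ, mem_nhdsWithin_of_mem_nhds (h2.compl.isOpen.mem_nhds h4), C, h1, h2, h3,
        disjoint_compl_right⟩
  obtain ⟨C, h2, h3, h4⟩ := IsCompact.induction_on (s := U) (p := fun S => ∃ C ∈ 𝒞, S ⊆ C ∧ C ⊆ U)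
    hU.isClosed.isCompact ⟨∅, 𝒞.bot_mem, subset_rfl, empty_subset _⟩
    (fun s t hst ⟨C, h1, h2, h3⟩ => ⟨C, h1, hst.trans h2, h3⟩)
    (fun s t ⟨C, h1, h2, h3⟩ ⟨C', h1', h2', h3'⟩ =>
      ⟨C ∪ C', 𝒞.sup_mem h1 h1', union_subset_union h2 h2', union_subset h3 h3'⟩)
    (fun x hx => by
      obtain ⟨C, h2, h3, h4, h5⟩ := h1 x hx
      exact ⟨C, mem_nhdsWithin_of_mem_nhds (h3.isOpen.mem_nhds h4), C, h2, subset_rfl,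
        disjoint_compl_right_iff_subset.1 h5⟩)
  exact (h4.antisymm h3) ▸ h2

end Clopen

/-! ### Minimal expansive actions on an infinite totally disconnected space -/

section Cantor

variable {G X : Type*} [Group G] [MetricSpace X] [CompactSpace X] [TotallyDisconnectedSpace X]
  [Infinite X] [MulAction G X] [ContinuousConstSMul G X] [MulAction.IsMinimal G X]

-- A finite orbit is closed and dense, hence all of the infinite space X.
variable (G) in
theorem orbit_infinite (x : X) : (MulAction.orbit G x).Infinite := by
  intro h
  have := (MulAction.dense_orbit G x).closure_eq
  rw [h.isClosed.closure_eq] at this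
  exact infinite_univ (this ▸ h)

theorem exists_smul_injective (x : X) : ∃ g : Fin 8 → G, Function.Injective fun i => g i • x := by
  have := (orbit_infinite G x).to_subtype
  let e := Infinite.natEmbedding (MulAction.orbit G x)
  choose g hg using fun n => (e n).2
  refine ⟨fun i => g i, fun i j h => ?_⟩
  have h' : g i • x = g j • x := h
  have := (hg i).symm.trans (h'.trans (hg j))
  exact Fin.ext (e.injective (Subtype.ext this))

/-- Eight elements with distinct images at a point have distinct images nearby, and finitely many
such neighbourhoods cover X. -/
theorem exists_large_orbits : ∃ F₀ : Finset G, ∀ x : X, ∀ s : Set X, s.Finite → s.ncard < 8 →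
    ∃ f ∈ F₀, f • x ∉ s := by
  classical
  obtain ⟨𝒱, h1, h2⟩ := exists_clopen_cover (X := X) isCompact_univ
    (R := fun V => ∃ g : Fin 8 → G, ∀ x ∈ V, Function.Injective fun i => g i • x) (by
      intro x _
      obtain ⟨g, hg⟩ := exists_smul_injective (G := G) x
      obtain ⟨V, hV, hxV, h⟩ := exists_clopen_forall_sep (range g) (finite_range g) x
      refine ⟨V, hV, hxV, g, fun y hy i j e => ?_⟩
      by_contra hij
      exact h _ ⟨i, rfl⟩ _ ⟨j, rfl⟩ (fun e' => hij (hg e')) y hy y hy e)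
  choose g hg using fun V : 𝒱 => (h1 V V.2).2
  refine ⟨Finset.univ.image fun p : 𝒱 × Fin 8 => g p.1 p.2, fun x s hs hcard => ?_⟩
  obtain ⟨V, hV, hxV⟩ := h2 x (mem_univ x)
  by_contra! h
  have := ncard_le_ncard (s := range fun i => g ⟨V, hV⟩ i • x) (t := s) (by
    rintro _ ⟨i, rfl⟩
    exact h _ (Finset.mem_image.2 ⟨(⟨V, hV⟩, i), Finset.mem_univ _, rfl⟩)) hs
  rw [← Nat.card_coe_set_eq, Nat.card_range_of_injective (hg ⟨V, hV⟩ x hxV)] at this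
  simp at this
  omega

/-- Take for P a finite clopen cover by sets of diameter at most the expansiveness constant. If
d(gx, gy) exceeds it, a member of P containing gx omits gy, so the translates of P separate points
and generate all clopen sets. -/
theorem alt3_clopen_fg [Group.FG G] (hexp : IsExpansiveAction G X) :
    (alt3 G (clopenAlgebra X)).FG := by
  obtain ⟨F₀, hF₀⟩ := exists_large_orbits (G := G) (X := X)
  obtain ⟨ε, hε, hexp⟩ := hexp
  obtain ⟨P, hP1, hP2⟩ := exists_clopen_cover (X := X) isCompact_univ
    (R := fun V => ∀ x ∈ V, ∀ y ∈ V, dist x y ≤ ε) (by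
      intro x _
      obtain ⟨V, hV, hxV, h⟩ := compact_exists_isClopen_in_isOpen
        (Metric.isOpen_ball (x := x) (ε := ε / 2)) (Metric.mem_ball_self (half_pos hε))
      refine ⟨V, hV, hxV, fun y hy z hz => ?_⟩
      have h1 := Metric.mem_ball.1 (h hy)
      have h2 := Metric.mem_ball.1 (h hz)
      linarith [dist_triangle_right y z x])
  refine alt3_fg preimage_mem_clopenAlgebra (P : Set (Set X)) P.finite_toSet
    (fun V hV => (hP1 V hV).1) (fun 𝒞 hP hinv U hU => mem_of_separates 𝒞 (fun x y hxy => ?_) hU)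
    F₀ (fun x _ => hF₀ x) (fun E hE => ?_)
  · obtain ⟨g, hg⟩ := hexp x y hxy
    obtain ⟨V, hV, hxV⟩ := hP2 (g • x) (mem_univ _)
    exact ⟨_, hinv g V (hP V hV), preimage_mem_clopenAlgebra g V (hP1 V hV).1, hxV,
      fun hy => not_lt.2 ((hP1 V hV).2 _ hxV _ hy) hg⟩
  · obtain ⟨𝒱, h1, h2⟩ := exists_clopen_cover (X := X) isCompact_univ
      (R := fun V => ∃ x : X, (∃ g : G, g • x ≠ x) ∧ ∀ a ∈ E, ∀ b ∈ E, a • x ≠ b • x → Sep V a b)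
      (by
        intro x _
        obtain ⟨V, hV, hxV, h⟩ := exists_clopen_forall_sep E hE x
        refine ⟨V, hV, hxV, x, ?_, h⟩
        by_contra! hfix
        refine orbit_infinite G x ((finite_singleton x).subset ?_)
        rintro _ ⟨g, rfl⟩
        exact hfix g)
    exact ⟨𝒱, ⟨fun V hV => (h1 V hV).1, fun x => Or.inl (h2 x (mem_univ x))⟩,
      fun V hV => (h1 V hV).2⟩

end Cantor

open TransformationGroupoid

/-! ### The action of the topological full group on the unit space -/

section Action

variable {G X : Type*} [Group G] [MulAction G X] [TopologicalSpace X]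
  [ContinuousConstSMul G X]

open Classical in
/-- The map that takes the source of each arrow of `B` to its range. -/
noncomputable def transport (B : Set (TransformationGroupoid G X)) (x : X) : X :=
  if h : ∃ g : G, ⟨g, x⟩ ∈ B then h.choose • x else x

theorem transport_eq {B : Set (TransformationGroupoid G X)} (hB : InjOn src B) {g : G} {x : X}
    (h : ⟨g, x⟩ ∈ B) : transport B x = g • x := by
  have h' : ∃ g : G, ⟨g, x⟩ ∈ B := ⟨g, h⟩
  rw [transport, dif_pos h']
  have := hB h'.choose_spec h rfl
  exact congrArg (fun γ => γ.elt • x) this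

variable [CompactSpace X]

theorem exists_elt_mem (B : FullGroup G X) (x : X) : ∃ g : G, ⟨g, x⟩ ∈ B.1 := by
  obtain ⟨β, hβ, rfl⟩ := (B.2.src_image.symm ▸ mem_univ x : x ∈ src '' B.1)
  exact ⟨β.elt, hβ⟩

theorem transport_val_eq (B : FullGroup G X) {g : G} {x : X} (h : ⟨g, x⟩ ∈ B.1) :
    transport B.1 x = g • x :=
  transport_eq (isFullBisection_iff.1 B.2).2.1 h

/-- The action of the topological full group on the unit space. -/
noncomputable instance : MulAction (FullGroup G X) X where
  smul B x := transport B.1 x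
  one_smul x := (transport_val_eq (1 : FullGroup G X) (g := 1)
    (show (⟨1, x⟩ : TransformationGroupoid G X) ∈ units univ from ⟨rfl, mem_univ x⟩)).trans
      (one_smul G x)
  mul_smul B C x := by
    obtain ⟨h, hh⟩ := exists_elt_mem C x
    obtain ⟨g, hg⟩ := exists_elt_mem B (h • x)
    change transport (B * C).1 x = transport B.1 (transport C.1 x)
    rw [transport_val_eq C hh, transport_val_eq B hg, ← mul_smul]
    exact transport_val_eq (B * C) ⟨_, hg, _, hh, rfl, rfl⟩

theorem fullGroup_smul_eq (B : FullGroup G X) {g : G} {x : X} (h : ⟨g, x⟩ ∈ B.1) :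
    B • x = g • x := transport_val_eq B h

/-- If B acts trivially and contains an arrow with label g, then the open set of sources of such
arrows meets the dense free part, so g = 1. -/
theorem toPermHom_injective (hfree : IsEssentiallyFree G X) :
    Function.Injective (MulAction.toPermHom (FullGroup G X) X) := by
  obtain ⟨Y, hY, -, hfree⟩ := hfree
  refine (injective_iff_map_eq_one _).2 fun B hB => ?_
  have hB' : ∀ x : X, B • x = x := fun x => congrArg (fun τ : Equiv.Perm X => τ x) hB
  have hunit : ∀ (g : G) (x : X), ⟨g, x⟩ ∈ B.1 → g = 1 := by
    intro g x h
    obtain ⟨y, hy, hyY⟩ := hY.inter_open_nonempty _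
      (isOpen_iff.1 B.2.isOpen g) ⟨x, h⟩
    exact hfree g y hyY (by rw [← fullGroup_smul_eq B hy, hB'])
  refine Subtype.ext (Set.ext fun γ => ⟨fun h => ⟨hunit _ _ h, mem_univ _⟩, ?_⟩)
  obtain ⟨g, x⟩ := γ
  rintro ⟨h, -⟩
  change g = 1 at h
  subst h
  obtain ⟨g, hg⟩ := exists_elt_mem B x
  rwa [hunit g x hg] at hg

end Action

/-! ### The alternating group as a group of three-cycles -/

section Cycle

variable {G X : Type*} [Group G] [MulAction G X] [TopologicalSpace X]
  [ContinuousConstSMul G X]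

theorem jointlyInjOn_of_disjoint {ι : Type*} {φ : ι → X → X} {U : Set X} (D : ι → Set X)
    (hD : ∀ i j, i ≠ j → Disjoint (D i) (D j)) (hm : ∀ i, MapsTo (φ i) U (D i))
    (hinj : ∀ i, InjOn (φ i) U) : JointlyInjOn φ U := by
  intro i j u hu v hv e
  by_cases hij : i = j
  · subst hij
    exact ⟨rfl, hinj i hu hv e⟩
  · exact absurd (e ▸ hm i hu) (disjoint_right.1 (hD i j hij) (hm j hv))

variable [CompactSpace X] [T2Space X] [TotallyDisconnectedSpace X]

/-- The bisection permutes cyclically the images of s(B₁) under the identity, B₁ and B₂B₁. These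
maps are locally given by group elements, and s(B₁) is compact. -/
theorem toPerm_mem_alt3 {B₁ B₂ : Set (TransformationGroupoid G X)} (h : IsCyclePair B₁ B₂)
    {γ : FullGroup G X} (hγ : γ.1 = cycle B₁ B₂) :
    MulAction.toPermHom (FullGroup G X) X γ ∈ alt3 G (clopenAlgebra X) := by
  obtain ⟨o1, s1, r1⟩ := isBisection_iff.1 h.left.toIsBisection
  obtain ⟨o2, s2, r2⟩ := isBisection_iff.1 h.right.toIsBisection
  set U := src '' B₁ with hU
  have hUc : IsCompact U := h.left.isCompact.image continuous_src
  have hUcl : IsClopen U := ⟨hUc.isClosed, isOpenMap_src _ o1⟩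
  have key : ∀ x ∈ U, ∃ g h' : G, (⟨g, x⟩ : TransformationGroupoid G X) ∈ B₁ ∧
      (⟨h', g • x⟩ : TransformationGroupoid G X) ∈ B₂ := by
    rintro _ ⟨β, hβ, rfl⟩
    obtain ⟨δ, hδ, e⟩ := (h.rng_eq_src ▸ mem_image_of_mem rng hβ : β.rng ∈ src '' B₂)
    refine ⟨β.elt, δ.elt, hβ, ?_⟩
    change (⟨δ.elt, β.rng⟩ : TransformationGroupoid G X) ∈ B₂
    rwa [← e]
  let φ : Fin 3 → X → X := ![id, transport B₁, transport B₂ ∘ transport B₁]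
  have φ1 : ∀ {g : G} {x : X}, (⟨g, x⟩ : TransformationGroupoid G X) ∈ B₁ → φ 1 x = g • x :=
    fun h => transport_eq s1 h
  have φ2 : ∀ {g g' : G} {x : X}, (⟨g, x⟩ : TransformationGroupoid G X) ∈ B₁ →
      (⟨g', g • x⟩ : TransformationGroupoid G X) ∈ B₂ → φ 2 x = g' • g • x := by
    intro g g' x h h'
    change transport B₂ (transport B₁ x) = _
    rw [transport_eq s1 h, transport_eq s2 h']
  have hφ : JointlyInjOn φ U := by
    refine jointlyInjOn_of_disjoint ![U, src '' B₂, rng '' B₂] ?_ ?_ ?_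
    · intro i j hij
      fin_cases i <;> fin_cases j <;> first
        | exact absurd rfl hij
        | exact h.disj₁₂
        | exact h.disj₁₃
        | exact h.disj₂₃
        | exact h.disj₁₂.symm
        | exact h.disj₁₃.symm
        | exact h.disj₂₃.symm
    · intro i x hx
      obtain ⟨g, g', hg, hg'⟩ := key x hx
      fin_cases i
      · exact hx
      · exact ⟨_, hg', (φ1 hg).symm⟩
      · exact ⟨_, hg', (φ2 hg hg').symm⟩
    · intro i x hx y hy e
      obtain ⟨g, g', hg, hg'⟩ := key x hx
      obtain ⟨k, k', hk, hk'⟩ := key y hy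
      have h1 : g • x = k • y → x = y := fun e => congrArg src (r1 hg hk e)
      fin_cases i
      · exact e
      · exact h1 ((φ1 hg).symm.trans (e.trans (φ1 hk)))
      · exact h1 (congrArg src (r2 hg' hk' ((φ2 hg hg').symm.trans (e.trans (φ2 hk hk')))))
  have hγφ : MulAction.toPermHom (FullGroup G X) X γ = permute φ U (finRotate 3) := by
    refine eq_permute hφ (fun i x hx => ?_) fun y hy => ?_
    · obtain ⟨g, g', hg, hg'⟩ := key x hx
      fin_cases i
      · change γ • x = φ 1 x
        rw [φ1 hg]
        exact fullGroup_smul_eq γ (hγ ▸ Or.inl (Or.inl (Or.inl hg)))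
      · change γ • φ 1 x = φ 2 x
        rw [φ1 hg, φ2 hg hg']
        exact fullGroup_smul_eq γ (hγ ▸ Or.inl (Or.inl (Or.inr hg')))
      · change γ • φ 2 x = x
        rw [φ2 hg hg']
        have : (⟨(g' * g)⁻¹, g' • g • x⟩ : TransformationGroupoid G X) ∈ γ.1 := by
          rw [hγ]
          refine Or.inl (Or.inr ⟨_, ⟨_, hg', _, hg, rfl, rfl⟩, ?_⟩)
          simp [comp, inv, mul_smul]
        rw [fullGroup_smul_eq γ this]
        simp [mul_smul]
    · have : (⟨1, y⟩ : TransformationGroupoid G X) ∈ γ.1 := by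
        rw [hγ]
        refine Or.inr ⟨rfl, ?_⟩
        rintro ((hyU | hy1) | ⟨δ, hδ, hy2⟩)
        · exact hy 0 y hyU rfl
        · rw [← h.rng_eq_src] at hy1
          obtain ⟨β, hβ, rfl⟩ := hy1
          exact hy 1 β.src ⟨β, hβ, rfl⟩ (φ1 hβ)
        · obtain ⟨β, hβ, e⟩ := (h.rng_eq_src.symm ▸ mem_image_of_mem src hδ : δ.src ∈ rng '' B₁)
          refine hy 2 β.src ⟨β, hβ, rfl⟩ ?_
          rw [φ2 (g' := δ.elt) hβ (by change (⟨δ.elt, β.rng⟩ : TransformationGroupoid G X) ∈ B₂; rwa [e])]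
          exact (congrArg (δ.elt • ·) e).trans hy2
      exact (fullGroup_smul_eq γ this).trans (one_smul G y)
  rw [hγφ]
  obtain ⟨𝒱, h1, h2⟩ := exists_clopen_cover hUc
    (R := fun V => ∀ i, ∃ g : G, ∀ x ∈ U, x ∈ V → φ i x = g • x) (by
      intro x hx
      obtain ⟨g, g', hg, hg'⟩ := key x hx
      obtain ⟨V, hV, hxV, hVO⟩ := compact_exists_isClopen_in_isOpen
        ((isOpen_iff.1 o1 g).inter ((isOpen_iff.1 o2 g').preimage (continuous_const_smul g)))
        ⟨hg, hg'⟩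
      refine ⟨V, hV, hxV, fun i => ⟨![1, g, g' * g] i, fun y _ hy => ?_⟩⟩
      obtain ⟨hy1, hy2⟩ := hVO hy
      fin_cases i
      · exact (one_smul G y).symm
      · exact φ1 hy1
      · exact (φ2 hy1 hy2).trans (mul_smul _ _ _).symm)
  exact permute_mem_alt3 hUcl hφ (fun V hV => (h1 V hV).1) h2 fun V hV => (h1 V hV).2

/-- The arrows given by `g` over `V`. -/
def slice (g : G) (V : Set X) : Set (TransformationGroupoid G X) := {γ | γ.elt = g ∧ γ.src ∈ V}

theorem src_image_slice (g : G) (V : Set X) : src '' slice g V = V := by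
  ext x
  exact ⟨by rintro ⟨γ, h, rfl⟩; exact h.2, fun h => ⟨⟨g, x⟩, ⟨rfl, h⟩, rfl⟩⟩

theorem rng_image_slice (g : G) (V : Set X) : rng '' slice g V = (fun x => g⁻¹ • x) ⁻¹' V := by
  ext x
  constructor
  · rintro ⟨⟨k, y⟩, ⟨h1, h2⟩, rfl⟩
    change k = g at h1
    subst h1
    change k⁻¹ • k • y ∈ V
    rwa [inv_smul_smul]
  · intro h
    exact ⟨⟨g, g⁻¹ • x⟩, ⟨rfl, h⟩, smul_inv_smul g x⟩

theorem isCompactBisection_slice (g : G) {V : Set X} (hV : IsClopen V) :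
    IsCompactBisection (slice g V) := by
  have ho : IsOpen (slice g V) := by
    rw [isOpen_iff]
    intro k
    by_cases h : k = g
    · simpa [slice, h] using hV.isOpen
    · simp [slice, h]
  refine ⟨isBisection_iff.2 ⟨ho, ?_, ?_⟩, ?_⟩
  · rintro ⟨k, x⟩ ⟨h1, -⟩ ⟨k', x'⟩ ⟨h2, -⟩ e
    simp only at h1 h2 e
    subst h1 h2 e
    rfl
  · rintro ⟨k, x⟩ ⟨h1, -⟩ ⟨k', x'⟩ ⟨h2, -⟩ e
    simp only [rng] at h1 h2 e
    subst h1 h2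
    rw [MulAction.injective _ e]
  · have hc : Continuous (TransformationGroupoid.mk g : X → TransformationGroupoid G X) :=
      continuous_def.2 fun U hU => isOpen_iff.1 hU g
    have : slice g V = TransformationGroupoid.mk g '' V := by
      ext ⟨k, x⟩
      constructor
      · rintro ⟨h1, h2⟩
        change k = g at h1
        exact ⟨x, h2, by rw [h1]⟩
      · rintro ⟨y, hy, e⟩
        cases e
        exact ⟨rfl, hy⟩
    rw [this]
    exact hV.isClosed.isCompact.image hc

open Classical in
/-- The group element by which `cyc U a b c` acts at a point. -/
noncomputable def cycElt (U : Set X) (a b c : G) (x : X) : G :=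
  if a⁻¹ • x ∈ U then b * a⁻¹ else if b⁻¹ • x ∈ U then c * b⁻¹ else
    if c⁻¹ • x ∈ U then a * c⁻¹ else 1

theorem cycElt_smul {U : Set X} {a b c : G} (hs : Sep3 U a b c) (x : X) :
    cycElt U a b c x • x = cyc U a b c x := by
  have hJ := hs.jointlyInjOn
  rw [cycElt]
  split_ifs with h1 h2 h3
  · have := permute_apply hJ (finRotate 3) 0 h1
    change cyc U a b c (a • a⁻¹ • x) = b • a⁻¹ • x at this
    rw [smul_inv_smul] at this
    rw [this, mul_smul]
  · have := permute_apply hJ (finRotate 3) 1 h2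
    change cyc U a b c (b • b⁻¹ • x) = c • b⁻¹ • x at this
    rw [smul_inv_smul] at this
    rw [this, mul_smul]
  · have := permute_apply hJ (finRotate 3) 2 h3
    change cyc U a b c (c • c⁻¹ • x) = a • c⁻¹ • x at this
    rw [smul_inv_smul] at this
    rw [this, mul_smul]
  · rw [one_smul]
    refine (permute_apply_of_ne hJ _ fun i u hu => ?_).symm
    rintro rfl
    fin_cases i
    · exact h1 (by simpa using hu)
    · exact h2 (by simpa using hu)
    · exact h3 (by simpa using hu)

/-- The cyclic permutation of three translates of a clopen set belongs to the alternating
group. -/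
theorem exists_mem_alternating {U : Set X} (hU : IsClopen U) {a b c : G} (hs : Sep3 U a b c) :
    ∃ γ ∈ alternating G X, MulAction.toPermHom (FullGroup G X) X γ = cyc U a b c ∧
      ∀ u ∈ U, (⟨b * a⁻¹, a • u⟩ : TransformationGroupoid G X) ∈ γ.1 := by
  have hpre : ∀ g : G, IsClopen ((fun x => g⁻¹ • x) ⁻¹' U) := fun g =>
    hU.preimage (continuous_const_smul _)
  have hdis : ∀ {g h : G}, Sep U g h →
      Disjoint ((fun x => g⁻¹ • x) ⁻¹' U) ((fun x => h⁻¹ • x) ⁻¹' U) := by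
    intro g h hgh
    refine disjoint_left.2 fun x hx hx' => hgh _ hx _ hx' ?_
    simp
  -- The bisection is built as the graph of the group element acting at each point; that it is a
  -- `cycle` of two slices is checked afterwards.
  let B : Set (TransformationGroupoid G X) := {γ | γ.elt = cycElt U a b c γ.src}
  have hB : IsFullBisection B := by
    refine isFullBisection_iff.2 ⟨?_, ?_, ?_, ?_, ?_⟩
    · rw [isOpen_iff]
      intro g
      change IsOpen {x | g = cycElt U a b c x}
      have : {x | g = cycElt U a b c x} = ({x | a⁻¹ • x ∈ U} ∩ {_x | g = b * a⁻¹}) ∪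
          ({x | a⁻¹ • x ∈ U}ᶜ ∩ (({x | b⁻¹ • x ∈ U} ∩ {_x | g = c * b⁻¹}) ∪
          ({x | b⁻¹ • x ∈ U}ᶜ ∩ (({x | c⁻¹ • x ∈ U} ∩ {_x | g = a * c⁻¹}) ∪
            ({x | c⁻¹ • x ∈ U}ᶜ ∩ {_x | g = 1}))))) := by
        ext x
        simp only [cycElt, mem_ofPred_eq, mem_union, mem_inter_iff, mem_compl_iff]
        split_ifs <;> simp [*]
      rw [this]
      exact ((hpre a).isOpen.inter isOpen_const).union ((hpre a).compl.isOpen.inter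
        (((hpre b).isOpen.inter isOpen_const).union ((hpre b).compl.isOpen.inter
          (((hpre c).isOpen.inter isOpen_const).union ((hpre c).compl.isOpen.inter
            isOpen_const)))))
    · rintro ⟨g, x⟩ (h1 : g = _) ⟨g', x'⟩ (h2 : g' = _) (e : x = x')
      subst e
      rw [h1, h2]
    · rintro ⟨g, x⟩ (h1 : g = _) ⟨g', x'⟩ (h2 : g' = _) (e : g • x = g' • x')
      simp only at h1 h2
      have e' : x = x' := by
        rw [h1, h2, cycElt_smul hs, cycElt_smul hs] at e
        exact (cyc U a b c).injective e
      subst e'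
      rw [h1, h2]
    · exact eq_univ_of_forall fun x => ⟨⟨cycElt U a b c x, x⟩, rfl, rfl⟩
    · refine eq_univ_of_forall fun x => ⟨⟨cycElt U a b c ((cyc U a b c).symm x),
        (cyc U a b c).symm x⟩, rfl, ?_⟩
      exact (cycElt_smul hs _).trans (Equiv.apply_symm_apply _ _)
  let γ : FullGroup G X := ⟨B, hB⟩
  have hr : ∀ g h : G, rng '' slice (h * g⁻¹) ((fun x => g⁻¹ • x) ⁻¹' U) =
      (fun x => h⁻¹ • x) ⁻¹' U := by
    intro g h
    rw [rng_image_slice, preimage_preimage]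
    simp [mul_smul]
  have hpair : IsCyclePair (slice (b * a⁻¹) ((fun x => a⁻¹ • x) ⁻¹' U))
      (slice (c * b⁻¹) ((fun x => b⁻¹ • x) ⁻¹' U)) := by
    refine ⟨isCompactBisection_slice _ (hpre a), isCompactBisection_slice _ (hpre b), ?_, ?_, ?_, ?_⟩
    · rw [hr, src_image_slice]
    · rw [src_image_slice, src_image_slice]
      exact hdis hs.1
    · rw [src_image_slice, hr]
      exact hdis hs.3
    · rw [src_image_slice, hr]
      exact hdis hs.2
  refine ⟨γ, Subgroup.subset_closure ⟨_, _, hpair, ?_⟩, ?_, ?_⟩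
  · ext ⟨g, x⟩
    change g = cycElt U a b c x ↔ _
    have m3 : (⟨g, x⟩ : TransformationGroupoid G X) ∈
        setInv (setMul (slice (c * b⁻¹) ((fun x => b⁻¹ • x) ⁻¹' U))
          (slice (b * a⁻¹) ((fun x => a⁻¹ • x) ⁻¹' U))) ↔ g = a * c⁻¹ ∧ c⁻¹ • x ∈ U := by
      rw [mem_setInv]
      constructor
      · rintro ⟨⟨k, y⟩, ⟨h1, h2⟩, ⟨k', y'⟩, ⟨h1', h2'⟩, e, e'⟩
        simp only [inv, comp, mk.injEq] at h1 h2 h1' h2' e'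
        subst h1 h1'
        have hg : g = a * c⁻¹ := by
          rw [← inv_inj, e'.1]
          group
        refine ⟨hg, ?_⟩
        have h3 : a⁻¹ • y' ∈ U := h2'
        rw [← e'.2, hg] at h3
        simpa [mul_smul] using h3
      · rintro ⟨rfl, h⟩
        refine ⟨⟨c * b⁻¹, b • c⁻¹ • x⟩, ⟨rfl, by simpa using h⟩,
          ⟨b * a⁻¹, a • c⁻¹ • x⟩, ⟨rfl, by simpa using h⟩, ?_, ?_⟩
        · simp [rng, mul_smul]
        · simp [inv, comp, mul_smul]
    have n12 : ¬ (a⁻¹ • x ∈ U ∧ b⁻¹ • x ∈ U) := fun h => disjoint_left.1 (hdis hs.1) h.1 h.2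
    have n13 : ¬ (a⁻¹ • x ∈ U ∧ c⁻¹ • x ∈ U) := fun h => disjoint_left.1 (hdis hs.3) h.1 h.2
    have n23 : ¬ (b⁻¹ • x ∈ U ∧ c⁻¹ • x ∈ U) := fun h => disjoint_left.1 (hdis hs.2) h.1 h.2
    simp only [cycle, mem_union, m3, src_image_slice, hr]
    simp only [slice, units, mem_ofPred_eq, mem_preimage, mem_compl_iff, mem_union, cycElt]
    split_ifs <;> tauto
  · ext x
    change γ • x = _
    rw [fullGroup_smul_eq γ (g := cycElt U a b c x) rfl, cycElt_smul hs]
  · intro u hu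
    change b * a⁻¹ = cycElt U a b c (a • u)
    rw [cycElt, if_pos (by simpa using hu)]

theorem map_alternating :
    (alternating G X).map (MulAction.toPermHom (FullGroup G X) X) = alt3 G (clopenAlgebra X) := by
  refine le_antisymm ?_ ?_
  · refine Subgroup.map_le_iff_le_comap.2 ((Subgroup.closure_le _).2 ?_)
    rintro γ ⟨B₁, B₂, h, hγ⟩
    exact toPerm_mem_alt3 h hγ
  · refine (Subgroup.closure_le _).2 ?_
    rintro _ ⟨U, hU, a, b, c, hs, rfl⟩
    obtain ⟨γ, h1, h2, -⟩ := exists_mem_alternating hU hs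
    exact ⟨γ, h1, h2⟩

/-- The full bisections with values in a subgroup. -/
def fullGroupOf (H : Subgroup G) : Subgroup (FullGroup G X) where
  carrier := {B | ∀ γ ∈ B.1, γ.elt ∈ H}
  one_mem' := fun γ h => h.1 ▸ one_mem H
  mul_mem' := by
    rintro B C hB hC _ ⟨β, hβ, δ, hδ, -, rfl⟩
    exact mul_mem (hB β hβ) (hC δ hδ)
  inv_mem' := by
    rintro B hB _ ⟨β, hβ, rfl⟩
    exact inv_mem (hB β hβ)

/-- The slices {g} × X are open, so a compact set meets only finitely many of them. -/
theorem finite_elt_image {B : Set (TransformationGroupoid G X)} (hB : IsCompact B) :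
    (TransformationGroupoid.elt '' B).Finite := by
  refine hB.induction_on (p := fun S => (TransformationGroupoid.elt '' S).Finite) (by simp)
    (fun s t hst h => h.subset (image_mono hst))
    (fun s t h1 h2 => by rw [image_union]; exact h1.union h2) fun γ _ => ?_
  refine ⟨slice γ.elt univ, mem_nhdsWithin_of_mem_nhds
    ((isCompactBisection_slice γ.elt isClopen_univ).isOpen.mem_nhds ⟨rfl, mem_univ _⟩), ?_⟩
  refine (finite_singleton γ.elt).subset ?_
  rintro _ ⟨δ, hδ, rfl⟩
  exact hδ.1

end Cycle

/-! ### The first statement -/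

section Main

variable {G X : Type*} [Group G] [MetricSpace X] [CompactSpace X]
  [MulAction G X] [ContinuousConstSMul G X] [MulAction.IsMinimal G X]

theorem group_fg_iff_alternating_fg (hX : Nonempty (X ≃ₜ (ℕ → Bool)))
    (hexp : IsExpansiveAction G X) (hfree : IsEssentiallyFree G X) :
    Group.FG G ↔ Group.FG (alternating G X) := by
  classical
  obtain ⟨e⟩ := hX
  have : TotallyDisconnectedSpace X := e.symm.totallyDisconnectedSpace
  have : Infinite X := e.toEquiv.infinite_iff.2 inferInstance
  constructor
  · intro hG
    have h1 := alt3_clopen_fg (G := G) hexp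
    rw [← map_alternating, ← Group.fg_iff_subgroup_fg] at h1
    exact Group.fg_of_surjective (hG := h1) (f := ((alternating G X).equivMapOfInjective _
      (toPermHom_injective hfree)).symm.toMonoidHom) (MulEquiv.surjective _)
  · intro h
    obtain ⟨T, hT⟩ := Group.fg_iff_subgroup_fg _ |>.1 h
    -- The labels occurring in finitely many compact generators; they turn out to generate G.
    let E : Set G := ⋃ B ∈ T, TransformationGroupoid.elt '' B.1
    have hE : E.Finite := T.finite_toSet.biUnion fun B _ => finite_elt_image B.2.isCompact
    have hle : alternating G X ≤ fullGroupOf (Subgroup.closure E) := by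
      rw [← hT]
      refine (Subgroup.closure_le _).2 fun B hB γ hγ => Subgroup.subset_closure ?_
      exact mem_biUnion hB ⟨γ, hγ, rfl⟩
    refine Group.fg_def.2 ⟨hE.toFinset, ?_⟩
    rw [Finite.coe_toFinset]
    refine (Subgroup.eq_top_iff' _).2 fun g => ?_
    by_cases hg : g = 1
    · exact hg ▸ one_mem _
    obtain ⟨Y, hY, -, hfree⟩ := hfree
    have : Nonempty X := ⟨e.symm fun _ => true⟩
    obtain ⟨y, hy⟩ := hY.nonempty
    have hgy : y ≠ g • y := fun e => hg (hfree g y hy e.symm)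
    -- The third position k makes (1 g k) a three-cycle near y; its bisection contains the arrow
    -- with label g at y.
    obtain ⟨_, ⟨k, rfl⟩, hk⟩ := (orbit_infinite G y).exists_notMem_finset {y, g • y}
    simp only [Finset.mem_insert, Finset.mem_singleton, not_or] at hk
    obtain ⟨U, hU, hyU, hsep⟩ := exists_clopen_forall_sep {1, g, k} (by simp) y
    have hs : Sep3 U 1 g k := ⟨hsep _ (by simp) _ (by simp) (by simpa using hgy),
      hsep _ (by simp) _ (by simp) (Ne.symm hk.2),
      hsep _ (by simp) _ (by simp) (by simpa using Ne.symm hk.1)⟩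
    obtain ⟨γ, hγ, -, h3⟩ := exists_mem_alternating hU hs
    have := hle hγ _ (h3 y hyU)
    simpa using this

end Main

/-! ### Rotations of [0, 1) by elements of Γ -/

section Rotation

/-- Rotation of `[0, 1)` by `r`, extended to `[0, 1]` by fixing `1`. -/
noncomputable def rotate (r : ℝ) (x : Icc (0 : ℝ) 1) : Icc (0 : ℝ) 1 :=
  if x = 1 then 1 else ⟨Int.fract (x + r), Int.fract_nonneg _, (Int.fract_lt_one _).le⟩

theorem rotate_one (r : ℝ) : rotate r 1 = 1 := if_pos rfl

theorem rotate_val {r : ℝ} {x : Icc (0 : ℝ) 1} (hx : x ≠ 1) :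
    (rotate r x : ℝ) = Int.fract (x + r) := by rw [rotate, if_neg hx]

theorem val_lt_one {x : Icc (0 : ℝ) 1} (hx : x ≠ 1) : (x : ℝ) < 1 :=
  lt_of_le_of_ne x.2.2 fun h => hx (Subtype.ext h)

theorem ne_one_of_lt {x : Icc (0 : ℝ) 1} (hx : (x : ℝ) < 1) : x ≠ 1 := by
  rintro rfl
  exact lt_irrefl _ hx

theorem rotate_ne_one {r : ℝ} {x : Icc (0 : ℝ) 1} (hx : x ≠ 1) : rotate r x ≠ 1 :=
  ne_one_of_lt (by rw [rotate_val hx]; exact Int.fract_lt_one _)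

theorem rotate_add (r s : ℝ) (x : Icc (0 : ℝ) 1) : rotate (r + s) x = rotate r (rotate s x) := by
  by_cases hx : x = 1
  · subst hx; simp [rotate_one]
  · refine Subtype.ext ?_
    rw [rotate_val hx, rotate_val (rotate_ne_one hx), rotate_val hx, Int.fract_eq_fract]
    exact ⟨⌊(x : ℝ) + s⌋, by rw [← Int.self_sub_floor]; ring⟩

variable {Γ : AddSubgroup ℝ}

noncomputable instance rotationAction : MulAction (Multiplicative Γ) (Icc (0 : ℝ) 1) where
  smul g x := rotate (g.toAdd : ℝ) x
  one_smul x := by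
    by_cases hx : x = 1
    · subst hx; exact rotate_one _
    · refine Subtype.ext ((rotate_val hx).trans ?_)
      change Int.fract ((x : ℝ) + 0) = x
      rw [add_zero, Int.fract_eq_self]
      exact ⟨x.2.1, val_lt_one hx⟩
  mul_smul g h x := rotate_add _ _ x

theorem smul_one_eq (g : Multiplicative Γ) : g • (1 : Icc (0 : ℝ) 1) = 1 := rotate_one _

theorem smul_val (g : Multiplicative Γ) {x : Icc (0 : ℝ) 1} (hx : x ≠ 1) :
    ((g • x : Icc (0 : ℝ) 1) : ℝ) = Int.fract ((x : ℝ) + g.toAdd) := rotate_val hx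

theorem smul_ne_one (g : Multiplicative Γ) {x : Icc (0 : ℝ) 1} (hx : x ≠ 1) : g • x ≠ 1 :=
  rotate_ne_one hx

theorem exists_smul_val (g : Multiplicative Γ) {x : Icc (0 : ℝ) 1} (hx : x ≠ 1) :
    ∃ n : ℤ, ((g • x : Icc (0 : ℝ) 1) : ℝ) = x + g.toAdd + n :=
  ⟨-⌊(x : ℝ) + g.toAdd⌋, by rw [smul_val g hx, ← Int.self_sub_floor]; push_cast; ring⟩

theorem eq_smul {g : Multiplicative Γ} {x y : Icc (0 : ℝ) 1} (hx : x ≠ 1) (hy : y ≠ 1) (n : ℤ)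
    (h : (y : ℝ) = x + g.toAdd + n) : y = g • x := by
  refine Subtype.ext ?_
  rw [smul_val g hx, eq_comm, Int.fract_eq_iff]
  exact ⟨y.2.1, val_lt_one hy, -n, by rw [h]; push_cast; ring⟩

theorem exists_int_of_smul_eq_smul {g h : Multiplicative Γ} {x y : Icc (0 : ℝ) 1} (hx : x ≠ 1)
    (hy : y ≠ 1) (e : g • x = h • y) : ∃ n : ℤ, (x : ℝ) + g.toAdd = y + h.toAdd + n := by
  obtain ⟨n, hn⟩ := exists_smul_val g hx
  obtain ⟨m, hm⟩ := exists_smul_val h hy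
  refine ⟨m - n, ?_⟩
  rw [e] at hn
  push_cast
  linarith

theorem intCast_mem (h1 : (1 : ℝ) ∈ Γ) (n : ℤ) : (n : ℝ) ∈ Γ := by
  simpa using Γ.zsmul_mem h1 n

theorem isIntervalExchange_smul (h1 : (1 : ℝ) ∈ Γ) (g : Multiplicative Γ) :
    IsIntervalExchange Γ (MulAction.toPerm g) := by
  have hc : 1 - Int.fract (g.toAdd : ℝ) ∈ Icc (0 : ℝ) 1 :=
    ⟨by linarith [Int.fract_lt_one (g.toAdd : ℝ)], by linarith [Int.fract_nonneg (g.toAdd : ℝ)]⟩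
  -- The rotation wraps around at 1 minus the fractional part of its angle, and the breakpoint 1
  -- isolates the fixed endpoint.
  refine ⟨fun t => ?_, {1, ⟨1 - Int.fract (g.toAdd : ℝ), hc⟩}, ?_, ?_⟩
  · change ((g • t : Icc (0 : ℝ) 1) : ℝ) - t ∈ Γ
    by_cases ht : t = 1
    · subst ht
      rw [smul_one_eq, sub_self]
      exact Γ.zero_mem
    · obtain ⟨n, hn⟩ := exists_smul_val g ht
      rw [hn, show (t : ℝ) + g.toAdd + n - t = g.toAdd + n by ring]
      exact Γ.add_mem g.toAdd.2 (intCast_mem h1 n)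
  · intro s hs
    simp only [Finset.mem_insert, Finset.mem_singleton] at hs
    rcases hs with rfl | rfl
    · exact h1
    · change 1 - Int.fract (g.toAdd : ℝ) ∈ Γ
      rw [← Int.self_sub_floor]
      exact Γ.sub_mem h1 (Γ.sub_mem g.toAdd.2 (intCast_mem h1 _))
  · intro x y h
    have e1 := h 1 (by simp)
    have e2 := h ⟨1 - Int.fract (g.toAdd : ℝ), hc⟩ (by simp)
    have key : ∀ x : Icc (0 : ℝ) 1, x ≠ 1 → ((g • x : Icc (0 : ℝ) 1) : ℝ) - x =
        if 1 - Int.fract (g.toAdd : ℝ) ≤ x then Int.fract (g.toAdd : ℝ) - 1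
        else Int.fract (g.toAdd : ℝ) := by
      intro x hx
      have hx' := val_lt_one hx
      have hx0 := x.2.1
      have f0 := Int.fract_nonneg (g.toAdd : ℝ)
      have f1 := Int.fract_lt_one (g.toAdd : ℝ)
      have ff := Int.floor_add_fract (g.toAdd : ℝ)
      split_ifs with hc
      · rw [← eq_smul (y := ⟨x + (Int.fract (g.toAdd : ℝ) - 1), by linarith, by linarith⟩) hx
          (ne_one_of_lt (by change (x : ℝ) + _ < 1; linarith)) (-⌊(g.toAdd : ℝ)⌋ - 1)
          (by push_cast; linarith)]
        simp
      · push Not at hc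
        rw [← eq_smul (y := ⟨x + Int.fract (g.toAdd : ℝ), by linarith, by linarith⟩) hx
          (ne_one_of_lt (by change (x : ℝ) + _ < 1; linarith)) (-⌊(g.toAdd : ℝ)⌋)
          (by push_cast; linarith)]
        simp
    change ((g • x : Icc (0 : ℝ) 1) : ℝ) - x = (g • y : Icc (0 : ℝ) 1) - y
    have e1' : x = 1 ↔ y = 1 := by
      constructor
      · intro h; exact le_antisymm y.2.2 (e1.1 h.ge)
      · intro h; exact le_antisymm x.2.2 (e1.2 h.ge)
    by_cases hx : x = 1
    · rw [hx, e1'.1 hx]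
    · rw [key x hx, key y fun h => hx (e1'.2 h)]
      have e2' : 1 - Int.fract (g.toAdd : ℝ) ≤ x ↔ 1 - Int.fract (g.toAdd : ℝ) ≤ y := e2
      simp only [e2']

end Rotation

/-! ### The Boolean algebra of intervals with endpoints in Γ -/

section Algebra

variable (Γ : AddSubgroup ℝ)

/-- The Boolean algebra generated by the intervals `[s, 1]` with `s` in `Γ`. -/
def intervalAlgebra : BooleanSubalgebra (Set (Icc (0 : ℝ) 1)) where
  carrier := {U | ∃ S : Finset (Icc (0 : ℝ) 1), (∀ s ∈ S, (s : ℝ) ∈ Γ) ∧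
    ∀ x y, (∀ s ∈ S, s ≤ x ↔ s ≤ y) → (x ∈ U ↔ y ∈ U)}
  supClosed' := by
    classical
    rintro A ⟨S, h1, h2⟩ B ⟨T, h3, h4⟩
    refine ⟨S ∪ T, fun s hs => (Finset.mem_union.1 hs).elim (h1 s) (h3 s), fun x y h => ?_⟩
    exact or_congr (h2 x y fun s hs => h s (Finset.mem_union_left _ hs))
      (h4 x y fun s hs => h s (Finset.mem_union_right _ hs))
  infClosed' := by
    classical
    rintro A ⟨S, h1, h2⟩ B ⟨T, h3, h4⟩
    refine ⟨S ∪ T, fun s hs => (Finset.mem_union.1 hs).elim (h1 s) (h3 s), fun x y h => ?_⟩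
    exact and_congr (h2 x y fun s hs => h s (Finset.mem_union_left _ hs))
      (h4 x y fun s hs => h s (Finset.mem_union_right _ hs))
  compl_mem' := by
    rintro A ⟨S, h1, h2⟩
    exact ⟨S, h1, fun x y h => not_congr (h2 x y h)⟩
  bot_mem' := ⟨∅, by simp, fun x y _ => Iff.rfl⟩

variable {Γ}

theorem setOf_le_mem {r : ℝ} (hr : r ∈ Γ) : {x : Icc (0 : ℝ) 1 | r ≤ x} ∈ intervalAlgebra Γ := by
  by_cases h0 : 0 ≤ r
  · by_cases h1 : r ≤ 1
    · exact ⟨{⟨r, h0, h1⟩}, by simpa, fun x y h => h ⟨r, h0, h1⟩ (by simp)⟩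
    · exact ⟨∅, by simp, fun x y _ => ⟨fun h => absurd (h.trans x.2.2) h1,
        fun h => absurd (h.trans y.2.2) h1⟩⟩
  · push Not at h0
    exact ⟨∅, by simp, fun x y _ => ⟨fun _ => h0.le.trans y.2.1, fun _ => h0.le.trans x.2.1⟩⟩

theorem setOf_lt_mem {r : ℝ} (hr : r ∈ Γ) : {x : Icc (0 : ℝ) 1 | (x : ℝ) < r} ∈ intervalAlgebra Γ := by
  have := (intervalAlgebra Γ).compl_mem (setOf_le_mem hr)
  convert this using 1
  ext x
  simp

theorem setOf_Ico_mem {r s : ℝ} (hr : r ∈ Γ) (hs : s ∈ Γ) :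
    {x : Icc (0 : ℝ) 1 | r ≤ x ∧ (x : ℝ) < s} ∈ intervalAlgebra Γ :=
  (intervalAlgebra Γ).inf_mem (setOf_le_mem hr) (setOf_lt_mem hs)

/-- The breakpoints are those of f and the preimages of those of U. If no breakpoint of f separates
x < y, then f translates [x, y], so a breakpoint of U between f x and f y has its preimage between x
and y. -/
theorem preimage_mem_intervalAlgebra {f : Equiv.Perm (Icc (0 : ℝ) 1)}
    (hf : IsIntervalExchange Γ f) {U : Set (Icc (0 : ℝ) 1)} (hU : U ∈ intervalAlgebra Γ) :
    f ⁻¹' U ∈ intervalAlgebra Γ := by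
  classical
  obtain ⟨hf1, T, hT, hf2⟩ := hf
  obtain ⟨S, hS, hU⟩ := hU
  refine ⟨T ∪ S.image f.symm, ?_, ?_⟩
  · intro s hs
    rcases Finset.mem_union.1 hs with h | h
    · exact hT s h
    · obtain ⟨u, hu, rfl⟩ := Finset.mem_image.1 h
      have := Γ.sub_mem (hS u hu) (hf1 (f.symm u))
      simpa using this
  · have key : ∀ x y, x ≤ y → (∀ s ∈ T ∪ S.image f.symm, s ≤ x ↔ s ≤ y) →
        (f x ∈ U ↔ f y ∈ U) := by
      intro x y hxy h
      have hf' := hf2 x y fun s hs => h s (Finset.mem_union_left _ hs)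
      have hle : f x ≤ f y := by
        have : (x : ℝ) ≤ y := hxy
        change (f x : ℝ) ≤ f y
        linarith
      refine hU _ _ fun s hs => ⟨fun h' => h'.trans hle, fun h' => ?_⟩
      by_contra hlt
      have hlt' : (f x : ℝ) < s := not_le.1 hlt
      have hle' : (s : ℝ) ≤ f y := h'
      let t : Icc (0 : ℝ) 1 := ⟨x + (s - f x), by linarith [x.2.1], by linarith [y.2.2]⟩
      have ht : (t : ℝ) = x + (s - f x) := rfl
      have ht1 : x < t := by change (x : ℝ) < t; linarith
      have ht2 : t ≤ y := by change (t : ℝ) ≤ y; linarith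
      have hft := hf2 x t fun u hu => by
        have := h u (Finset.mem_union_left _ hu)
        exact ⟨fun h => h.trans ht1.le, fun h => this.2 (h.trans ht2)⟩
      have hfts : f t = s := Subtype.ext (by linarith)
      have hm := h (f.symm s) (Finset.mem_union_right _ (Finset.mem_image_of_mem _ hs))
      rw [← hfts, Equiv.symm_apply_apply] at hm
      exact absurd (hm.2 ht2) (not_le.2 ht1)
    intro x y h
    rcases le_total x y with hxy | hxy
    · exact key x y hxy h
    · exact (key y x hxy fun s hs => (h s hs).symm).symm

theorem preimage_smul_mem (h1 : (1 : ℝ) ∈ Γ) (g : Multiplicative Γ) (U : Set (Icc (0 : ℝ) 1))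
    (hU : U ∈ intervalAlgebra Γ) : (fun x => g • x) ⁻¹' U ∈ intervalAlgebra Γ :=
  preimage_mem_intervalAlgebra (isIntervalExchange_smul h1 g) hU

theorem mem_of_setOf_le_mem (𝒞 : BooleanSubalgebra (Set (Icc (0 : ℝ) 1)))
    (h : ∀ s : Icc (0 : ℝ) 1, (s : ℝ) ∈ Γ → {x | s ≤ x} ∈ 𝒞) : intervalAlgebra Γ ≤ 𝒞 := by
  classical
  rintro U ⟨S, hS, hU⟩
  induction S using Finset.induction_on generalizing U with
  | empty =>
    rcases U.eq_empty_or_nonempty with rfl | ⟨x, hx⟩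
    · exact 𝒞.bot_mem
    · rw [show U = univ from eq_univ_of_forall fun y => (hU x y (by simp)).1 hx]
      exact 𝒞.top_mem
  | insert s S _ ih =>
    have hS' : ∀ t ∈ S, (t : ℝ) ∈ Γ := fun t ht => hS t (Finset.mem_insert_of_mem ht)
    have hs := h s (hS s (Finset.mem_insert_self s S))
    -- The saturation of U ∩ Q with respect to S needs only the breakpoints in S. With Q one of the
    -- two sides of s, it agrees with U on that side.
    have key : ∀ Q : Set (Icc (0 : ℝ) 1), {x | ∃ y ∈ U, y ∈ Q ∧ ∀ t ∈ S, t ≤ x ↔ t ≤ y} ∈ 𝒞 := by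
      refine fun Q => ih hS' fun x x' hxx' => ⟨?_, ?_⟩
      · rintro ⟨y, h1, h2, h3⟩
        exact ⟨y, h1, h2, fun t ht => (hxx' t ht).symm.trans (h3 t ht)⟩
      · rintro ⟨y, h1, h2, h3⟩
        exact ⟨y, h1, h2, fun t ht => (hxx' t ht).trans (h3 t ht)⟩
    have e : U = ({x | ∃ y ∈ U, y ∈ {x | s ≤ x} ∧ ∀ t ∈ S, t ≤ x ↔ t ≤ y} ∩ {x | s ≤ x}) ∪
        ({x | ∃ y ∈ U, y ∈ {x | s ≤ x}ᶜ ∧ ∀ t ∈ S, t ≤ x ↔ t ≤ y} ∩ {x | s ≤ x}ᶜ) := by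
      ext x
      constructor
      · intro hx
        by_cases hsx : s ≤ x
        · exact Or.inl ⟨⟨x, hx, hsx, fun _ _ => Iff.rfl⟩, hsx⟩
        · exact Or.inr ⟨⟨x, hx, hsx, fun _ _ => Iff.rfl⟩, hsx⟩
      · rintro (⟨⟨y, hy, hsy, ht⟩, hsx⟩ | ⟨⟨y, hy, hsy, ht⟩, hsx⟩)
        · refine (hU x y fun t ht' => ?_).2 hy
          rcases Finset.mem_insert.1 ht' with rfl | ht'
          · exact iff_of_true hsx hsy
          · exact ht t ht'
        · refine (hU x y fun t ht' => ?_).2 hy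
          rcases Finset.mem_insert.1 ht' with rfl | ht'
          · exact iff_of_false hsx hsy
          · exact ht t ht'
    rw [e]
    exact 𝒞.sup_mem (𝒞.inf_mem (key _) hs) (𝒞.inf_mem (key _) (𝒞.compl_mem hs))

/-- An invariant Boolean algebra that contains one short interval contains all
intervals with endpoints in `Γ`. -/
theorem intervalAlgebra_le {c : ℝ} (hc : c ∈ Γ) (hc0 : 0 < c) (hc1 : c ≤ 1 / 2)
    (𝒞 : BooleanSubalgebra (Set (Icc (0 : ℝ) 1)))
    (hP : {x : Icc (0 : ℝ) 1 | (x : ℝ) < c} ∈ 𝒞)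
    (hinv : ∀ g : Multiplicative Γ, ∀ U ∈ 𝒞, (fun x => g • x) ⁻¹' U ∈ 𝒞) :
    intervalAlgebra Γ ≤ 𝒞 := by
  -- The interval [t, t + c) is the preimage of [0, c) under rotation by -t; it does not wrap around
  -- because t + c ≤ 1.
  have shift : ∀ t ∈ Γ, 0 ≤ t → t + c ≤ 1 → {x : Icc (0 : ℝ) 1 | t ≤ x ∧ (x : ℝ) < t + c} ∈ 𝒞 := by
    intro t ht ht0 htc
    have := hinv (Multiplicative.ofAdd ⟨-t, Γ.neg_mem ht⟩) _ hP
    convert this using 1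
    ext x
    simp only [mem_ofPred_eq, mem_preimage]
    by_cases hx : x = 1
    · subst hx
      rw [smul_one_eq]
      have e : ((1 : Icc (0 : ℝ) 1) : ℝ) = 1 := rfl
      rw [e]
      constructor
      · rintro ⟨-, h⟩; linarith
      · intro h; linarith
    · have hx' := val_lt_one hx
      have hx0 := x.2.1
      rcases le_or_gt t x with htx | htx
      · rw [← eq_smul (y := ⟨x - t, by linarith, by linarith⟩) hx
          (ne_one_of_lt (by change (x : ℝ) - t < 1; linarith)) 0
          (by change (x : ℝ) - t = x + -t + _; push_cast; ring)]
        change _ ↔ (x : ℝ) - t < c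
        constructor
        · rintro ⟨-, h⟩; linarith
        · intro h; exact ⟨htx, by linarith⟩
      · rw [← eq_smul (y := ⟨x - t + 1, by linarith, by linarith⟩) hx
          (ne_one_of_lt (by change (x : ℝ) - t + 1 < 1; linarith)) 1
          (by change (x : ℝ) - t + 1 = x + -t + _; push_cast; ring)]
        change _ ↔ (x : ℝ) - t + 1 < c
        constructor
        · rintro ⟨h, -⟩; linarith
        · intro h; linarith
  have lt_mem : ∀ n : ℕ, ∀ s ∈ Γ, 0 ≤ s → s ≤ 1 → s ≤ n * c →
      {x : Icc (0 : ℝ) 1 | (x : ℝ) < s} ∈ 𝒞 := by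
    intro n
    induction n with
    | zero =>
      intro s _ _ _ h
      rw [show {x : Icc (0 : ℝ) 1 | (x : ℝ) < s} = ∅ from eq_empty_of_forall_notMem fun x hx => by
        have h1 : (x : ℝ) < s := hx
        have h2 := x.2.1
        simp at h
        linarith]
      exact 𝒞.bot_mem
    | succ n ih =>
      intro s hs hs0 hs1 h
      push_cast at h
      -- For s ≤ c the interval [0, s) is [0, c) minus [s, s + c), which fits into [0, 1] because c
      -- ≤ 1/2. For larger s a block of length c is split off.
      rcases le_or_gt s c with hsc | hsc
      · have := BooleanSubalgebra.sdiff_mem hP (shift s hs hs0 (by linarith))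
        convert this using 1
        ext x
        simp only [mem_ofPred_eq, mem_sdiff]
        constructor
        · intro h; exact ⟨by linarith, fun h' => by linarith [h'.1]⟩
        · rintro ⟨h1, h2⟩
          by_contra! h3
          exact h2 ⟨h3, by linarith⟩
      · have := 𝒞.sup_mem (ih (s - c) (Γ.sub_mem hs hc) (by linarith) (by linarith) (by linarith))
          (shift (s - c) (Γ.sub_mem hs hc) (by linarith) (by linarith))
        convert this using 1
        ext x
        change (x : ℝ) < s ↔ (x : ℝ) < s - c ∨ (s - c ≤ x ∧ (x : ℝ) < s - c + c)
        constructor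
        · intro h
          rcases lt_or_ge (x : ℝ) (s - c) with h' | h'
          · exact Or.inl h'
          · exact Or.inr ⟨h', by linarith⟩
        · rintro (h | ⟨-, h⟩) <;> linarith
  refine mem_of_setOf_le_mem 𝒞 fun s hs => ?_
  obtain ⟨n, hn⟩ := exists_nat_ge ((s : ℝ) / c)
  have := 𝒞.compl_mem (lt_mem n s hs s.2.1 s.2.2 ((div_le_iff₀ hc0).1 hn))
  convert this using 1
  ext x
  simp

end Algebra

/-! ### Finite generation of the three-cycles of the rotation action -/

section Generation

variable {Γ : AddSubgroup ℝ}

theorem exists_mem_Ioo (hd : Dense (Γ : Set ℝ)) {a b : ℝ} (h : a < b) : ∃ c ∈ Γ, a < c ∧ c < b := by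
  obtain ⟨c, hc, h'⟩ := hd.exists_between h
  exact ⟨c, hc, h'⟩

theorem exists_large_orbits_rotation (hd : Dense (Γ : Set ℝ)) :
    ∃ F₀ : Finset (Multiplicative Γ), ∀ x : Icc (0 : ℝ) 1, x ≠ 1 →
      ∀ s : Set (Icc (0 : ℝ) 1), s.Finite → s.ncard < 8 → ∃ f ∈ F₀, f • x ∉ s := by
  classical
  -- With c < 1/8 the multiples 0, c, ..., 7c all lie in [0, 1), so they are distinct modulo 1.
  obtain ⟨c, hc, hc0, hc1⟩ := exists_mem_Ioo hd (show (0 : ℝ) < 1 / 8 by norm_num)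
  let g : Fin 8 → Multiplicative Γ := fun i =>
    Multiplicative.ofAdd ⟨(i : ℕ) * c, by simpa using Γ.nsmul_mem hc i⟩
  refine ⟨Finset.univ.image g, fun x hx s hs hcard => ?_⟩
  have hinj : Function.Injective fun i => g i • x := by
    intro i j e
    obtain ⟨n, hn⟩ := exists_int_of_smul_eq_smul hx hx e
    have hn' : (x : ℝ) + (i : ℕ) * c = x + (j : ℕ) * c + n := hn
    have hi : ((i : ℕ) : ℝ) ≤ 7 := by exact_mod_cast (by omega : (i : ℕ) ≤ 7)
    have hj : ((j : ℕ) : ℝ) ≤ 7 := by exact_mod_cast (by omega : (j : ℕ) ≤ 7)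
    have hi0 : (0 : ℝ) ≤ (i : ℕ) := Nat.cast_nonneg _
    have hj0 : (0 : ℝ) ≤ (j : ℕ) := Nat.cast_nonneg _
    have h1 : (n : ℝ) < 1 := by nlinarith
    have h2 : (-1 : ℝ) < n := by nlinarith
    have hn0 : n = 0 := by
      have : n < 1 := by exact_mod_cast h1
      have : -1 < n := by exact_mod_cast h2
      omega
    subst hn0
    have : ((i : ℕ) : ℝ) = (j : ℕ) := mul_right_cancel₀ hc0.ne' (by push_cast at hn'; linarith)
    exact Fin.ext (by exact_mod_cast this)
  by_contra! h
  have := ncard_le_ncard (s := range fun i => g i • x) (t := s) (by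
    rintro _ ⟨i, rfl⟩
    exact h _ (Finset.mem_image_of_mem _ (Finset.mem_univ i))) hs
  rw [← Nat.card_coe_set_eq, Nat.card_range_of_injective hinj] at this
  simp at this
  omega

/-- Whether two rotations agree at a point of [0, 1) does not depend on the point, so 0 can serve as
the test point. When they differ, the difference of their angles has positive distance from the
integers, and η is chosen below the finitely many distances. -/
theorem exists_forall_sep_rotation (E : Set (Multiplicative Γ)) (hE : E.Finite) :
    ∃ η > 0, ∀ V : Set (Icc (0 : ℝ) 1), (∀ u ∈ V, ∀ v ∈ V, u ≠ 1 ∧ |(u : ℝ) - v| < η) →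
      ∀ a ∈ E, ∀ b ∈ E, a • (0 : Icc (0 : ℝ) 1) ≠ b • (0 : Icc (0 : ℝ) 1) → Sep V a b := by
  have h : ∀ᶠ η in 𝓝[>] (0 : ℝ), ∀ a ∈ E, ∀ b ∈ E,
      a • (0 : Icc (0 : ℝ) 1) ≠ b • (0 : Icc (0 : ℝ) 1) →
        ∀ n : ℤ, η ≤ |(a.toAdd : ℝ) - b.toAdd - n| := by
    refine (Filter.eventually_all_finite hE).2 fun a _ => (Filter.eventually_all_finite hE).2
      fun b _ => ?_
    by_cases hab : a • (0 : Icc (0 : ℝ) 1) = b • (0 : Icc (0 : ℝ) 1)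
    · exact Filter.Eventually.of_forall fun _ h => absurd hab h
    have h01 : (0 : Icc (0 : ℝ) 1) ≠ 1 := zero_ne_one
    set r := (a.toAdd : ℝ) - b.toAdd with hr
    have hfr : 0 < Int.fract r := by
      refine lt_of_le_of_ne (Int.fract_nonneg r) fun h0 => hab ?_
      obtain ⟨n, hn⟩ := exists_smul_val a h01
      refine eq_smul h01 (smul_ne_one a h01) (n + ⌊r⌋) ?_
      have := Int.floor_add_fract r
      rw [← h0] at this
      rw [hn]
      push_cast
      linarith
    have hfr1 := Int.fract_lt_one r
    have hmin : 0 < min (Int.fract r) (1 - Int.fract r) := lt_min hfr (by linarith)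
    filter_upwards [Ioo_mem_nhdsGT hmin] with η hη _ n
    have e1 := hη.2.le.trans (min_le_left _ _)
    have e2 := hη.2.le.trans (min_le_right _ _)
    have ff := Int.floor_add_fract r
    rcases le_or_gt n ⌊r⌋ with hn | hn
    · have : (n : ℝ) ≤ ⌊r⌋ := by exact_mod_cast hn
      exact le_trans (by linarith) (le_abs_self _)
    · have : (⌊r⌋ : ℝ) + 1 ≤ n := by exact_mod_cast hn
      exact le_trans (by linarith) (neg_le_abs _)
  obtain ⟨η, h, hη⟩ := (h.and self_mem_nhdsWithin).exists
  refine ⟨η, hη, fun V hV a ha b hb hab u hu v hv e => ?_⟩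
  obtain ⟨n, hn⟩ := exists_int_of_smul_eq_smul (hV u hu u hu).1 (hV v hv v hv).1 e
  have h1 := h a ha b hb hab n
  have h2 := (hV v hv u hu).2
  rw [show (a.toAdd : ℝ) - b.toAdd - n = v - u by linarith] at h1
  linarith

theorem alt3_rotation_fg (h1 : (1 : ℝ) ∈ Γ) (hd : Dense (Γ : Set ℝ)) (hfg : AddGroup.FG Γ) :
    (alt3 (Multiplicative Γ) (intervalAlgebra Γ)).FG := by
  classical
  obtain ⟨F₀, hF₀⟩ := exists_large_orbits_rotation hd
  obtain ⟨c, hc, hc0, hc1⟩ := exists_mem_Ioo hd (show (0 : ℝ) < 1 / 2 by norm_num)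
  have hone : ({1} : Set (Icc (0 : ℝ) 1)) ∈ intervalAlgebra Γ := by
    convert setOf_le_mem h1 using 1
    ext x
    exact ⟨fun h => by rw [mem_singleton_iff.1 h]; exact le_refl (1 : ℝ),
      fun h => Subtype.ext (le_antisymm x.2.2 h)⟩
  have hfix : ∀ x : Icc (0 : ℝ) 1, (∃ g : Multiplicative Γ, g • x ≠ x) → x ≠ 1 := by
    rintro x ⟨g, hg⟩ rfl
    exact hg (smul_one_eq g)
  refine alt3_fg (preimage_smul_mem h1) {{x : Icc (0 : ℝ) 1 | (x : ℝ) < c}} (by simp) ?_ ?_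
    F₀ (fun x hx => hF₀ x (hfix x hx)) fun E hE => ?_
  · rintro U rfl
    exact setOf_lt_mem hc
  · intro 𝒞 hP hinv
    exact intervalAlgebra_le hc hc0 hc1.le 𝒞 (hP _ rfl) hinv
  · obtain ⟨η, hη, hsep⟩ := exists_forall_sep_rotation E hE
    obtain ⟨δ, hδ, hδ0, hδ1⟩ := exists_mem_Ioo hd hη
    obtain ⟨N, hN⟩ := exists_nat_gt (1 / δ)
    have hmul : ∀ k : ℕ, (k : ℝ) * δ ∈ Γ := fun k => by simpa using Γ.nsmul_mem hδ k
    -- Half-open intervals of length δ < η with endpoints in Γ; the endpoint 1 is removed because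
    -- every rotation fixes it.
    refine ⟨(Finset.range N).image fun k : ℕ => {x : Icc (0 : ℝ) 1 | (k : ℝ) * δ ≤ x ∧
      (x : ℝ) < ((k + 1 : ℕ) : ℝ) * δ} ∩ {1}ᶜ, ⟨?_, ?_⟩, ?_⟩
    · intro V hV
      obtain ⟨k, -, rfl⟩ := Finset.mem_image.1 hV
      exact (intervalAlgebra Γ).inf_mem (setOf_Ico_mem (hmul k) (hmul _))
        ((intervalAlgebra Γ).compl_mem hone)
    · intro x
      by_cases hx : x = 1
      · exact Or.inr fun g => hx ▸ smul_one_eq g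
      · left
        have hk := Nat.floor_le (div_nonneg x.2.1 hδ0.le)
        have hk' := Nat.lt_floor_add_one ((x : ℝ) / δ)
        rw [le_div_iff₀ hδ0] at hk
        rw [div_lt_iff₀ hδ0] at hk'
        refine ⟨_, Finset.mem_image_of_mem _ (Finset.mem_range.2 ?_ : ⌊(x : ℝ) / δ⌋₊ ∈ _),
          ⟨hk, by push_cast; exact hk'⟩, hx⟩
        rw [div_lt_iff₀ hδ0] at hN
        have h2 : (⌊(x : ℝ) / δ⌋₊ : ℝ) * δ < N * δ := hk.trans_lt (x.2.2.trans_lt hN)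
        exact_mod_cast lt_of_mul_lt_mul_right h2 hδ0.le
    · intro V hV
      obtain ⟨k, -, rfl⟩ := Finset.mem_image.1 hV
      refine ⟨0, ⟨Multiplicative.ofAdd ⟨c, hc⟩, fun e => ?_⟩, hsep _ ?_⟩
      · have h01 : (0 : Icc (0 : ℝ) 1) ≠ 1 := zero_ne_one
        have := congrArg Subtype.val e
        rw [smul_val _ h01] at this
        have h2 : Int.fract ((0 : ℝ) + c) = 0 := this
        rw [zero_add, Int.fract_eq_self.2 ⟨hc0.le, by linarith⟩] at h2
        linarith
      · rintro u ⟨⟨a1, a2⟩, hu⟩ v ⟨⟨b1, b2⟩, -⟩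
        push_cast at a2 b2
        exact ⟨hu, by rw [abs_lt]; constructor <;> linarith⟩

end Generation

/-! ### Exchanges of adjacent intervals as products of small ones -/

section Adjacent

/-- The exchange of the adjacent intervals `[a, b)` and `[b, c)`. -/
noncomputable def adjFun (a b c x : ℝ) : ℝ :=
  if x < a then x else if x < b then x + (c - b) else if x < c then x - (b - a) else x

theorem adjFun_adjFun {a b c : ℝ} (hab : a ≤ b) (hbc : b ≤ c) (x : ℝ) :
    adjFun a (a + c - b) c (adjFun a b c x) = x := by
  unfold adjFun
  split_ifs <;> linarith

theorem adjFun_mem {a b c : ℝ} (ha : 0 ≤ a) (hab : a ≤ b) (hbc : b ≤ c) (hc : c ≤ 1) {x : ℝ}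
    (hx : x ∈ Icc (0 : ℝ) 1) : adjFun a b c x ∈ Icc (0 : ℝ) 1 := by
  obtain ⟨h0, h1⟩ := hx
  unfold adjFun
  split_ifs <;> constructor <;> linarith

/-- The exchange of the adjacent intervals `[a, b)` and `[b, c)` as a permutation. -/
noncomputable def adj (a b c : ℝ) (ha : 0 ≤ a) (hab : a ≤ b) (hbc : b ≤ c) (hc : c ≤ 1) :
    Equiv.Perm (Icc (0 : ℝ) 1) where
  toFun x := ⟨adjFun a b c x, adjFun_mem ha hab hbc hc x.2⟩
  invFun x := ⟨adjFun a (a + c - b) c x,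
    adjFun_mem ha (by linarith) (by linarith) hc x.2⟩
  left_inv x := Subtype.ext (adjFun_adjFun hab hbc x)
  right_inv x := Subtype.ext (by
    have := adjFun_adjFun (a := a) (b := a + c - b) (c := c) (by linarith) (by linarith) x
    rwa [show a + c - (a + c - b) = b by ring] at this)

variable {Γ : AddSubgroup ℝ}

theorem adj_mem {h1 : (1 : ℝ) ∈ Γ} {a b c : ℝ} (ha : 0 ≤ a) (hab : a ≤ b) (hbc : b ≤ c)
    (hc : c ≤ 1) (haΓ : a ∈ Γ) (hbΓ : b ∈ Γ) (hcΓ : c ∈ Γ) : adj a b c ha hab hbc hc ∈ IE Γ h1 := by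
  refine ⟨fun x => ?_, {⟨a, ha, by linarith⟩, ⟨b, by linarith, by linarith⟩, ⟨c, by linarith, hc⟩},
    ?_, fun x y h => ?_⟩
  · change adjFun a b c x - x ∈ Γ
    unfold adjFun
    split_ifs
    · simp
    · simpa using Γ.sub_mem hcΓ hbΓ
    · simpa using Γ.sub_mem haΓ hbΓ
    · simp
  · intro s hs
    simp only [Finset.mem_insert, Finset.mem_singleton] at hs
    rcases hs with rfl | rfl | rfl
    exacts [haΓ, hbΓ, hcΓ]
  · simp only [Finset.mem_insert, Finset.mem_singleton, forall_eq_or_imp, forall_eq] at h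
    obtain ⟨ea, eb, ec⟩ := h
    have ea : a ≤ x ↔ a ≤ y := ea
    have eb : b ≤ x ↔ b ≤ y := eb
    have ec : c ≤ x ↔ c ≤ y := ec
    change adjFun a b c x - x = adjFun a b c y - y
    unfold adjFun
    simp only [← not_le, ea, eb, ec]
    split_ifs <;> ring

/-- The left block first jumps over [b, m), landing on [a + m - b, m), and then over [m, c). -/
theorem adj_eq_mul_right {a b c m : ℝ} (ha : 0 ≤ a) (hab : a ≤ b) (hbm : b ≤ m) (hmc : m ≤ c)
    (hc : c ≤ 1) : adj a b c ha hab (hbm.trans hmc) hc =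
      adj (a + m - b) m c (by linarith) (by linarith) hmc hc *
        adj a b m ha hab hbm (hmc.trans hc) := by
  ext x
  change adjFun a b c x = adjFun (a + m - b) m c (adjFun a b m x)
  unfold adjFun
  split_ifs <;> linarith

theorem adj_eq_mul_left {a b c m : ℝ} (ha : 0 ≤ a) (ham : a ≤ m) (hmb : m ≤ b) (hbc : b ≤ c)
    (hc : c ≤ 1) : adj a b c ha (ham.trans hmb) hbc hc =
      adj a m (m + c - b) ha ham (by linarith) (by linarith) *
        adj m b c (ha.trans ham) hmb hbc hc := by
  ext x
  change adjFun a b c x = adjFun a m (m + c - b) (adjFun m b c x)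
  unfold adjFun
  split_ifs <;> linarith

variable (Γ) in
/-- Interval exchanges supported in short intervals. -/
def smallExchanges : Set (Equiv.Perm (Icc (0 : ℝ) 1)) :=
  {f | IsIntervalExchange Γ f ∧ ∃ a ∈ Γ, ∃ c ∈ Γ, c ≤ 1 ∧ c - a < 1 / 10 ∧
    ∀ x : Icc (0 : ℝ) 1, ¬ (a ≤ x ∧ (x : ℝ) < c) → f x = x}

theorem adj_mem_closure_of_small (h1 : (1 : ℝ) ∈ Γ) {a b c : ℝ} (ha : 0 ≤ a) (hab : a ≤ b)
    (hbc : b ≤ c) (hc : c ≤ 1) (haΓ : a ∈ Γ) (hbΓ : b ∈ Γ) (hcΓ : c ∈ Γ) (h : c - a < 1 / 10) :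
    adj a b c ha hab hbc hc ∈ Subgroup.closure (smallExchanges Γ) := by
  refine Subgroup.subset_closure ⟨adj_mem (h1 := h1) ha hab hbc hc haΓ hbΓ hcΓ, a, haΓ, c, hcΓ, hc, h,
    fun x hx => Subtype.ext ?_⟩
  change adjFun a b c x = x
  unfold adjFun
  split_ifs with h2 h3 h4
  · rfl
  · exact absurd ⟨not_lt.1 h2, by linarith⟩ hx
  · exact absurd ⟨not_lt.1 h2, h4⟩ hx
  · rfl

/-- The right block is consumed in portions of length δ. Each elementary exchange involves two
blocks shorter than 1/20, so its support is shorter than 1/10. -/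
theorem adj_mem_closure_of_left_small (h1 : (1 : ℝ) ∈ Γ) {δ : ℝ} (hδ : δ ∈ Γ) (hδ0 : 0 < δ)
    (hδ1 : δ < 1 / 20) (n : ℕ) : ∀ (a b c : ℝ) (ha : 0 ≤ a) (hab : a ≤ b)
    (hbc : b ≤ c) (hc : c ≤ 1), a ∈ Γ → b ∈ Γ → c ∈ Γ → b - a < 1 / 20 → c - b ≤ n * δ →
    adj a b c ha hab hbc hc ∈ Subgroup.closure (smallExchanges Γ) := by
  induction n with
  | zero =>
    intro a b c ha hab hbc hc haΓ hbΓ hcΓ h h'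
    simp only [Nat.cast_zero, zero_mul] at h'
    exact adj_mem_closure_of_small h1 ha hab hbc hc haΓ hbΓ hcΓ (by linarith)
  | succ n ih =>
    intro a b c ha hab hbc hc haΓ hbΓ hcΓ h h'
    push_cast at h'
    rcases le_or_gt (c - b) δ with hs | hs
    · exact adj_mem_closure_of_small h1 ha hab hbc hc haΓ hbΓ hcΓ (by linarith)
    · have hmΓ := Γ.add_mem hbΓ hδ
      rw [adj_eq_mul_right (m := b + δ) ha hab (by linarith) (by linarith) hc]
      exact mul_mem (ih _ _ _ _ _ _ _ (Γ.sub_mem (Γ.add_mem haΓ hmΓ) hbΓ) hmΓ hcΓ (by linarith)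
        (by linarith)) (adj_mem_closure_of_small h1 _ _ _ _ haΓ hbΓ hmΓ (by linarith))

/-- The left block is cut in turn into portions of length at most δ, each of which is moved past a
right block of arbitrary length. -/
theorem adj_mem_closure (h1 : (1 : ℝ) ∈ Γ) (hd : Dense (Γ : Set ℝ)) {a b c : ℝ} (ha : 0 ≤ a)
    (hab : a ≤ b) (hbc : b ≤ c) (hc : c ≤ 1) (haΓ : a ∈ Γ) (hbΓ : b ∈ Γ) (hcΓ : c ∈ Γ) :
    adj a b c ha hab hbc hc ∈ Subgroup.closure (smallExchanges Γ) := by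
  obtain ⟨δ, hδ, hδ0, hδ1⟩ := exists_mem_Ioo hd (show (0 : ℝ) < 1 / 20 by norm_num)
  have left : ∀ (a b c : ℝ) (ha : 0 ≤ a) (hab : a ≤ b) (hbc : b ≤ c) (hc : c ≤ 1),
      a ∈ Γ → b ∈ Γ → c ∈ Γ → b - a < 1 / 20 →
      adj a b c ha hab hbc hc ∈ Subgroup.closure (smallExchanges Γ) := by
    intro a b c ha hab hbc hc haΓ hbΓ hcΓ h
    obtain ⟨n, hn⟩ := exists_nat_ge ((c - b) / δ)
    exact adj_mem_closure_of_left_small h1 hδ hδ0 hδ1 n a b c ha hab hbc hc haΓ hbΓ hcΓ h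
      ((div_le_iff₀ hδ0).1 hn)
  have all : ∀ n : ℕ, ∀ (a b c : ℝ) (ha : 0 ≤ a) (hab : a ≤ b) (hbc : b ≤ c) (hc : c ≤ 1),
      a ∈ Γ → b ∈ Γ → c ∈ Γ → b - a ≤ n * δ →
      adj a b c ha hab hbc hc ∈ Subgroup.closure (smallExchanges Γ) := by
    intro n
    induction n with
    | zero =>
      intro a b c ha hab hbc hc haΓ hbΓ hcΓ h
      simp only [Nat.cast_zero, zero_mul] at h
      exact left a b c ha hab hbc hc haΓ hbΓ hcΓ (by linarith)
    | succ n ih =>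
      intro a b c ha hab hbc hc haΓ hbΓ hcΓ h
      push_cast at h
      rcases le_or_gt (b - a) δ with hs | hs
      · exact left a b c ha hab hbc hc haΓ hbΓ hcΓ (by linarith)
      · have hmΓ := Γ.sub_mem hbΓ hδ
        rw [adj_eq_mul_left (m := b - δ) ha (by linarith) (by linarith) hbc hc]
        exact mul_mem (ih _ _ _ _ _ _ _ haΓ hmΓ (Γ.sub_mem (Γ.add_mem hmΓ hcΓ) hbΓ) (by linarith))
          (left _ _ _ _ _ _ _ hmΓ hbΓ hcΓ (by linarith))
  obtain ⟨n, hn⟩ := exists_nat_ge ((b - a) / δ)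
  exact all n a b c ha hab hbc hc haΓ hbΓ hcΓ ((div_le_iff₀ hδ0).1 hn)

end Adjacent

/-! ### Generation of IE(Γ) by exchanges with small support -/

section Exchanges

variable {Γ : AddSubgroup ℝ} {f : Equiv.Perm (Icc (0 : ℝ) 1)}

/-- If f w = 1 with w < 1, right continuity would push points just to the right of w beyond 1. -/
theorem apply_one_of_isIntervalExchange (hf : IsIntervalExchange Γ f) : f 1 = 1 := by
  classical
  obtain ⟨-, S, -, hf⟩ := hf
  obtain ⟨w, hw⟩ := f.surjective 1
  rcases eq_or_ne w 1 with rfl | hw1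
  · exact hw
  exfalso
  have hlt : w < 1 := lt_of_le_of_ne w.2.2 hw1
  obtain ⟨b, hb, hmin⟩ := Finset.exists_min_image ((insert 1 S).filter (w < ·)) id
    ⟨1, Finset.mem_filter.2 ⟨Finset.mem_insert_self _ _, hlt⟩⟩
  have hwb : (w : ℝ) < b := (Finset.mem_filter.1 hb).2
  let v : Icc (0 : ℝ) 1 := ⟨(w + b) / 2, by linarith [w.2.1, b.2.1], by linarith [w.2.2, b.2.2]⟩
  have hv : (v : ℝ) = (w + b) / 2 := rfl
  have hwv : w ≤ v := by change (w : ℝ) ≤ v; linarith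
  have hvb : v < b := by change (v : ℝ) < b; linarith
  have := hf w v fun s hs => ⟨fun h => h.trans hwv, fun h => by
    by_contra hlt
    exact absurd (hmin s (Finset.mem_filter.2 ⟨Finset.mem_insert_of_mem hs, not_le.1 hlt⟩))
      (not_le.2 (h.trans_lt hvb))⟩
  rw [hw] at this
  have h2 := (f v).2.2
  have h3 : ((1 : Icc (0 : ℝ) 1) : ℝ) = 1 := rfl
  linarith

theorem exists_pieces (hf : IsIntervalExchange Γ f) :
    ∃ 𝒱 : Finset (Set (Icc (0 : ℝ) 1)), (∀ V ∈ 𝒱, V ∈ intervalAlgebra Γ) ∧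
      (∀ x, ∃ V ∈ 𝒱, x ∈ V) ∧ ∀ V ∈ 𝒱, ∃ g : Multiplicative Γ, ∀ x ∈ V, f x = g • x := by
  classical
  have hf1 := apply_one_of_isIntervalExchange hf
  obtain ⟨hfΓ, S, hS, hf⟩ := hf
  refine ⟨S.powerset.image fun T => {x | ∀ s ∈ S, s ≤ x ↔ s ∈ T}, ?_, ?_, ?_⟩
  · intro V hV
    obtain ⟨T, -, rfl⟩ := Finset.mem_image.1 hV
    exact ⟨S, hS, fun x y h => forall₂_congr fun s hs => by rw [h s hs]⟩
  · intro x
    refine ⟨_, Finset.mem_image_of_mem _ (Finset.mem_powerset.2 (Finset.filter_subset (· ≤ x) S)),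
      fun s hs => ?_⟩
    simp [hs]
  · intro V hV
    obtain ⟨T, -, rfl⟩ := Finset.mem_image.1 hV
    rcases eq_empty_or_nonempty {x | ∀ s ∈ S, s ≤ x ↔ s ∈ T} with he | ⟨x, hx⟩
    · exact ⟨1, fun x hx => by rw [he] at hx; exact absurd hx (notMem_empty x)⟩
    · refine ⟨Multiplicative.ofAdd ⟨_, hfΓ x⟩, fun y hy => ?_⟩
      have hxy := hf x y fun s hs => (hx s hs).trans (hy s hs).symm
      by_cases hy1 : y = 1
      · rw [hy1, hf1, smul_one_eq]
      · refine eq_smul hy1 (fun e => hy1 (f.injective (e.trans hf1.symm))) 0 ?_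
        change (f y : ℝ) = y + (f x - x) + _
        push_cast
        linarith

theorem isIntervalExchange_of_pieces (h1 : (1 : ℝ) ∈ Γ) {𝒱 : Finset (Set (Icc (0 : ℝ) 1))}
    (h𝒱 : ∀ V ∈ 𝒱, V ∈ intervalAlgebra Γ) (hcov : ∀ x, ∃ V ∈ 𝒱, x ∈ V)
    (hf : ∀ V ∈ 𝒱, ∃ g : Multiplicative Γ, ∀ x ∈ V, f x = g • x) : IsIntervalExchange Γ f := by
  classical
  choose! g hg using hf
  choose! S hS hSV using h𝒱
  choose T hT hTg using fun g : Multiplicative Γ => (isIntervalExchange_smul h1 g).2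
  refine ⟨fun x => ?_, 𝒱.biUnion fun V => S V ∪ T (g V), ?_, fun x y h => ?_⟩
  · obtain ⟨V, hV, hx⟩ := hcov x
    rw [hg V hV x hx]
    exact (isIntervalExchange_smul h1 (g V)).1 x
  · intro s hs
    obtain ⟨V, hV, hs⟩ := Finset.mem_biUnion.1 hs
    exact (Finset.mem_union.1 hs).elim (hS V hV s) (hT _ s)
  · obtain ⟨V, hV, hx⟩ := hcov x
    have hy : y ∈ V := (hSV V hV x y fun s hs =>
      h s (Finset.mem_biUnion.2 ⟨V, hV, Finset.mem_union_left _ hs⟩)).1 hx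
    rw [hg V hV x hx, hg V hV y hy]
    exact hTg (g V) x y fun s hs => h s (Finset.mem_biUnion.2 ⟨V, hV, Finset.mem_union_right _ hs⟩)

/-- A piecewise translation that is the identity from `v` on is a product of exchanges of
adjacent intervals, by induction on the number of its breakpoints. -/
theorem mem_closure_of_breakpoints (h1 : (1 : ℝ) ∈ Γ) (hd : Dense (Γ : Set ℝ)) (n : ℕ) :
    ∀ (f : Equiv.Perm (Icc (0 : ℝ) 1)) (S : Finset (Icc (0 : ℝ) 1)) (v : Icc (0 : ℝ) 1),
      S.card = n → (∀ s ∈ S, (s : ℝ) ∈ Γ) → (v : ℝ) ∈ Γ → (∀ x, (f x : ℝ) - x ∈ Γ) →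
      (∀ x, v ≤ x → f x = x) →
      (∀ x y, x < v → y < v → (∀ s ∈ S, s ≤ x ↔ s ≤ y) → (f x : ℝ) - x = f y - y) →
      f ∈ Subgroup.closure (smallExchanges Γ) := by
  classical
  induction n with
  | zero =>
    intro f S v hS _ _ _ hid hf
    have hS : S = ∅ := Finset.card_eq_zero.1 hS
    subst hS
    have hlt : ∀ x, x < v → f x < v := by
      intro x hx
      by_contra h
      rw [f.injective (hid _ (not_lt.1 h))] at h
      exact h hx
    suffices f = 1 from this ▸ one_mem _
    ext x
    rcases lt_or_ge x v with hx | hx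
    · have h0v : (0 : Icc (0 : ℝ) 1) < v := lt_of_le_of_lt x.2.1 hx
      have e := hf 0 x h0v hx (by simp)
      have h0 : ((0 : Icc (0 : ℝ) 1) : ℝ) = 0 := rfl
      have h2 := (f 0).2.1
      rcases h2.eq_or_lt with h3 | h3
      · change (f x : ℝ) = x
        linarith
      -- Without breakpoints f is a translation that preserves [0, v); a positive angle f 0 would
      -- send v - f 0 to v.
      · exfalso
        have hv0 : (0 : ℝ) < v := h0v
        have hf0 : (f 0 : ℝ) < v := hlt 0 h0v
        let y : Icc (0 : ℝ) 1 := ⟨v - f 0, by linarith, by linarith [v.2.2]⟩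
        have hy : (y : ℝ) = v - f 0 := rfl
        have hyv : y < v := by change (y : ℝ) < v; linarith
        have e2 := hf 0 y h0v hyv (by simp)
        have h4 : (f y : ℝ) < v := hlt y hyv
        linarith
    · rw [hid x hx]; rfl
  | succ n ih =>
    intro f S v hS hSΓ hvΓ hfΓ hid hf
    have hlt : ∀ x, x < v → f x < v := by
      intro x hx
      by_contra h
      rw [f.injective (hid _ (not_lt.1 h))] at h
      exact h hx
    -- The last piece [w, v) is translated by some t ≤ 0. An exchange h of adjacent intervals brings
    -- its image back, so `h * f` is the identity from w on.
    obtain ⟨w, hwS, hmax⟩ := Finset.exists_max_image S id (Finset.card_pos.1 (by omega))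
    have hcard : (S.erase w).card = n := by rw [Finset.card_erase_of_mem hwS]; omega
    have hSΓ' : ∀ s ∈ S.erase w, (s : ℝ) ∈ Γ := fun s hs => hSΓ s (Finset.mem_of_mem_erase hs)
    have extend : ∀ {x y : Icc (0 : ℝ) 1}, (w ≤ x ↔ w ≤ y) → (∀ s ∈ S.erase w, s ≤ x ↔ s ≤ y) →
        ∀ s ∈ S, s ≤ x ↔ s ≤ y := by
      intro x y hw h s hs
      by_cases hsw : s = w
      · rwa [hsw]
      · exact h s (Finset.mem_erase.2 ⟨hsw, hs⟩)
    rcases le_or_gt v w with hvw | hwv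
    · exact ih f (S.erase w) v hcard hSΓ' hvΓ hfΓ hid fun x y hx hy h =>
        hf x y hx hy (extend (iff_of_false (not_le.2 (hx.trans_le hvw))
          (not_le.2 (hy.trans_le hvw))) h)
    have hwv' : (w : ℝ) < v := hwv
    have hwΓ := hSΓ w hwS
    set t : ℝ := f w - w with ht
    have htΓ : t ∈ Γ := hfΓ w
    have htr : ∀ x, w ≤ x → x < v → (f x : ℝ) = x + t := by
      intro x hwx hxv
      have := hf w x hwv hxv fun s hs =>
        iff_of_true (hmax s hs) ((hmax s hs : s ≤ w).trans hwx)
      linarith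
    have ht0 : t ≤ 0 := by
      by_contra! h
      have hmax' : max (w : ℝ) (v - t) < v := max_lt hwv' (by linarith)
      let x : Icc (0 : ℝ) 1 := ⟨max w (v - t), w.2.1.trans (le_max_left _ _), hmax'.le.trans v.2.2⟩
      have hx := htr x (le_max_left (w : ℝ) (v - t)) hmax'
      have h2 : (f x : ℝ) < v := hlt x hmax'
      have h3 : v - t ≤ (x : ℝ) := le_max_right _ _
      linarith
    have hfw : (f w : ℝ) = w + t := by linarith
    have ha : 0 ≤ (w : ℝ) + t := hfw ▸ (f w).2.1
    have haΓ := Γ.add_mem hwΓ htΓ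
    have hbΓ := Γ.add_mem hvΓ htΓ
    set h := adj (w + t) (v + t) v ha (by linarith) (by linarith) v.2.2 with hh
    have hmem : h ∈ Subgroup.closure (smallExchanges Γ) :=
      adj_mem_closure h1 hd _ _ _ _ haΓ hbΓ hvΓ
    have hhΓ : ∀ x, (h x : ℝ) - x ∈ Γ :=
      (adj_mem (h1 := h1) (Γ := Γ) ha (by linarith) (by linarith) v.2.2 haΓ hbΓ hvΓ).1
    have hval : ∀ x, (h x : ℝ) = adjFun (w + t) (v + t) v x := fun _ => rfl
    -- The interval [w + t, v + t) is already taken up by the image of [w, v).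
    have hgap : ∀ x, x < w → (f x : ℝ) < w + t ∨ (v : ℝ) + t ≤ f x := by
      intro x hx
      by_contra! hc
      let y : Icc (0 : ℝ) 1 := ⟨f x - t, by linarith [w.2.1], by linarith [v.2.2]⟩
      have hy : (y : ℝ) = f x - t := rfl
      have hwy : w ≤ y := by change (w : ℝ) ≤ y; linarith
      have hyv : y < v := by change (y : ℝ) < v; linarith
      have e := htr y hwy hyv
      have : x = y := f.injective (Subtype.ext (by linarith))
      exact absurd hwy (not_le.2 (this ▸ hx))
    have key : h * f ∈ Subgroup.closure (smallExchanges Γ) := by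
      refine ih (h * f) (S.erase w) w hcard hSΓ' hwΓ (fun x => ?_) (fun x hx => ?_) ?_
      · have := Γ.add_mem (hhΓ (f x)) (hfΓ x)
        simpa using this
      · refine Subtype.ext ?_
        change (h (f x) : ℝ) = x
        have hx' : (w : ℝ) ≤ x := hx
        rcases lt_or_ge x v with hxv | hxv
        · have hxv' : (x : ℝ) < v := hxv
          rw [hval, htr x hx hxv, adjFun]
          split_ifs <;> linarith
        · have hxv' : (v : ℝ) ≤ x := hxv
          rw [hval, hid x hxv, adjFun]
          split_ifs <;> linarith
      · have half : ∀ x y, x ≤ y → x < w → y < w → (∀ s ∈ S.erase w, s ≤ x ↔ s ≤ y) →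
            ((h * f) x : ℝ) - x = (h * f) y - y := by
          intro x y hxy hx hy hs
          have hxy' : (x : ℝ) ≤ y := hxy
          have e := hf x y (hx.trans hwv) (hy.trans hwv)
            (extend (iff_of_false (not_le.2 hx) (not_le.2 hy)) hs)
          have hfv : ∀ x, x < w → (f x : ℝ) < v := fun x hx => hlt x (hx.trans hwv)
          have hfx := hfv x hx
          have hfy := hfv y hy
          change (h (f x) : ℝ) - x = h (f y) - y
          rw [hval, hval]
          rcases hgap x hx with h2 | h2 <;> rcases hgap y hy with h3 | h3
          · rw [adjFun, adjFun, if_pos h2, if_pos h3, e]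
          -- A translated piece cannot jump across the gap: some z between x and y would be sent to
          -- w + t, which is inside the gap.
          · exfalso
            let z : Icc (0 : ℝ) 1 := ⟨x + (w + t - f x), by linarith [x.2.1],
              by linarith [y.2.2]⟩
            have hz : (z : ℝ) = x + (w + t - f x) := rfl
            have hxz : x ≤ z := by change (x : ℝ) ≤ z; linarith
            have hzy : z ≤ y := by change (z : ℝ) ≤ y; linarith
            have hzw : z < w := hzy.trans_lt hy
            have e2 := hf x z (hx.trans hwv) (hzw.trans hwv)
              (extend (iff_of_false (not_le.2 hx) (not_le.2 hzw)) fun s hs' =>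
                ⟨fun h => h.trans hxz, fun h => (hs s hs').2 (h.trans hzy)⟩)
            rcases hgap z hzw with h4 | h4 <;> linarith
          · exfalso; linarith
          · rw [adjFun, adjFun]
            split_ifs <;> linarith
        intro x y hx hy hs
        rcases le_total x y with hxy | hxy
        · exact half x y hxy hx hy hs
        · exact (half y x hxy hy hx fun s hs' => (hs s hs').symm).symm
    exact (Subgroup.mul_mem_cancel_left _ hmem).1 key

theorem mem_closure_smallExchanges (h1 : (1 : ℝ) ∈ Γ) (hd : Dense (Γ : Set ℝ))
    (hf : IsIntervalExchange Γ f) : f ∈ Subgroup.closure (smallExchanges Γ) := by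
  have hf1 := apply_one_of_isIntervalExchange hf
  obtain ⟨hfΓ, S, hS, hf⟩ := hf
  refine mem_closure_of_breakpoints h1 hd S.card f S 1 rfl hS h1 hfΓ (fun x hx => ?_)
    fun x y _ _ h => hf x y h
  have : x = 1 := le_antisymm x.2.2 hx
  rw [this, hf1]

end Exchanges

/-- If the generators commute modulo a normal subgroup, then it contains the derived subgroup. -/
theorem commutator_le_of_generators {H : Type*} [Group H] {N : Subgroup H} [N.Normal] {R : Set H}
    (hR : Subgroup.closure R = ⊤)
    (h : ∀ x ∈ R, ∀ y ∈ R, Commute (x : H ⧸ N) (y : H ⧸ N)) : commutator H ≤ N := by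
  rw [commutator_def, Subgroup.commutator_le]
  rintro x - y -
  have hx : x ∈ Subgroup.closure R := hR ▸ Subgroup.mem_top x
  have hy : y ∈ Subgroup.closure R := hR ▸ Subgroup.mem_top y
  have key : Commute (x : H ⧸ N) (y : H ⧸ N) := by
    induction hx, hy using Subgroup.closure_induction₂ with
    | mem x y hx hy => exact h x hx y hy
    | one_left x _ => exact Commute.one_left _
    | one_right x _ => exact Commute.one_right _
    | mul_left x y z _ _ _ h1 h2 => exact h1.mul_left h2
    | mul_right x y z _ _ _ h1 h2 => exact h1.mul_right h2
    | inv_left x y _ _ h => exact h.inv_left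
    | inv_right x y _ _ h => exact h.inv_right
  rw [← QuotientGroup.eq_one_iff]
  change ⁅(x : H ⧸ N), (y : H ⧸ N)⁆ = 1
  exact commutatorElement_eq_one_iff_commute.2 key

/-! ### The derived subgroup of IE(Γ) and the second statement -/

section IE

variable {Γ : AddSubgroup ℝ}

theorem permute_mem_IE (h1 : (1 : ℝ) ∈ Γ) {n : ℕ} {g : Fin n → Multiplicative Γ}
    {U : Set (Icc (0 : ℝ) 1)} (hU : U ∈ intervalAlgebra Γ)
    (h : JointlyInjOn (fun i (x : Icc (0 : ℝ) 1) => g i • x) U) (σ : Equiv.Perm (Fin n)) :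
    permute (fun i (x : Icc (0 : ℝ) 1) => g i • x) U σ ∈ IE Γ h1 := by
  classical
  let W : Fin n → Set (Icc (0 : ℝ) 1) := fun i => (fun x => (g i)⁻¹ • x) ⁻¹' U
  have hW : ∀ i, W i ∈ intervalAlgebra Γ := fun i => preimage_smul_mem h1 _ U hU
  have hWc : (⋂ i, (W i)ᶜ) ∈ intervalAlgebra Γ := by
    have : ∀ s : Finset (Fin n), (⋂ i ∈ s, (W i)ᶜ) ∈ intervalAlgebra Γ := by
      intro s
      induction s using Finset.induction_on with
      | empty => simpa using (intervalAlgebra Γ).top_mem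
      | insert i s _ ih =>
        rw [Finset.set_biInter_insert]
        exact (intervalAlgebra Γ).inf_mem ((intervalAlgebra Γ).compl_mem (hW i)) ih
    simpa using this Finset.univ
  refine isIntervalExchange_of_pieces h1 (𝒱 := insert (⋂ i, (W i)ᶜ) (Finset.univ.image W)) ?_ ?_ ?_
  · intro V hV
    rcases Finset.mem_insert.1 hV with rfl | hV
    · exact hWc
    · obtain ⟨i, -, rfl⟩ := Finset.mem_image.1 hV
      exact hW i
  · intro x
    by_cases hx : ∃ i, x ∈ W i
    · obtain ⟨i, hi⟩ := hx
      exact ⟨W i, Finset.mem_insert_of_mem (Finset.mem_image_of_mem _ (Finset.mem_univ i)), hi⟩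
    · push Not at hx
      exact ⟨_, Finset.mem_insert_self _ _, mem_iInter.2 hx⟩
  · intro V hV
    rcases Finset.mem_insert.1 hV with rfl | hV
    · refine ⟨1, fun x hx => ?_⟩
      rw [one_smul]
      refine permute_apply_of_ne h _ ?_
      rintro i u hu rfl
      refine mem_iInter.1 hx i ?_
      change (g i)⁻¹ • g i • u ∈ U
      rwa [inv_smul_smul]
    · obtain ⟨i, -, rfl⟩ := Finset.mem_image.1 hV
      refine ⟨g (σ i) * (g i)⁻¹, fun x hx => ?_⟩
      have := permute_apply h σ i hx
      rw [mul_smul, ← this]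
      simp

/-- A three-cycle is the commutator of two transpositions, and the transpositions of the pieces
belong to IE(Γ). -/
theorem alt3_le_map_commutator (h1 : (1 : ℝ) ∈ Γ) :
    alt3 (Multiplicative Γ) (intervalAlgebra Γ) ≤
      (commutator (IE Γ h1)).map (IE Γ h1).subtype := by
  refine (Subgroup.closure_le _).2 ?_
  rintro _ ⟨U, hU, a, b, c, hs, rfl⟩
  have hJ := hs.jointlyInjOn
  let σ : Equiv.Perm (Fin 3) := Equiv.swap 0 1
  let τ : Equiv.Perm (Fin 3) := Equiv.swap 0 2
  have e : finRotate 3 = ⁅σ, τ⁆ := by decide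
  refine ⟨⁅⟨_, permute_mem_IE h1 hU hJ σ⟩, ⟨_, permute_mem_IE h1 hU hJ τ⟩⁆,
    Subgroup.commutator_mem_commutator (Subgroup.mem_top _) (Subgroup.mem_top _), ?_⟩
  rw [map_commutatorElement]
  change ⁅permute _ U σ, permute _ U τ⁆ = permute _ U (finRotate 3)
  rw [permute_commutator hJ subset_rfl subset_rfl, inter_self, ← e]

/-- An even permutation of intervals moves the support of one small exchange off the support of
another one. -/
theorem exists_conj_commute (hd : Dense (Γ : Set ℝ))
    {f f' : Equiv.Perm (Icc (0 : ℝ) 1)} (hf : f ∈ smallExchanges Γ) (hf' : f' ∈ smallExchanges Γ) :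
    ∃ β ∈ alt3 (Multiplicative Γ) (intervalAlgebra Γ), Commute (β * f * β⁻¹) f' := by
  obtain ⟨-, a, haΓ, c, hcΓ, hc1, hac, hf⟩ := hf
  obtain ⟨-, a', -, c', -, hc1', hac', hf'⟩ := hf'
  -- Supports are shorter than 1/10. With γ between 1/5 and 1/4, the translates of U by 0, γ, 2γ are
  -- disjoint modulo 1, and [a', c') cannot meet both the second and the third.
  obtain ⟨γ, hγ, hγ1, hγ2⟩ := exists_mem_Ioo hd (show (1 / 5 : ℝ) < 1 / 4 by norm_num)
  let g : Multiplicative Γ := Multiplicative.ofAdd ⟨γ, hγ⟩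
  let g' : Multiplicative Γ := Multiplicative.ofAdd ⟨2 * γ, by simpa using Γ.nsmul_mem hγ 2⟩
  let U : Set (Icc (0 : ℝ) 1) := {x | a ≤ x ∧ (x : ℝ) < c}
  have hU : U ∈ intervalAlgebra Γ := setOf_Ico_mem haΓ hcΓ
  have hU1 : ∀ u ∈ U, u ≠ 1 := fun u hu => ne_one_of_lt (hu.2.trans_le hc1)
  have noint : ∀ (n : ℤ) (r : ℝ), 0 < r → r < 1 → (n : ℝ) ≠ r := by
    rintro n r h0 h1 rfl
    have h2 : 0 < n := by exact_mod_cast h0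
    have h3 : n < 1 := by exact_mod_cast h1
    omega
  have sep : ∀ k k' : Multiplicative Γ, 1 / 5 < (k'.toAdd : ℝ) - k.toAdd →
      (k'.toAdd : ℝ) - k.toAdd < 1 / 2 → Sep U k k' := by
    intro k k' h2 h3 u hu v hv e
    obtain ⟨n, hn⟩ := exists_int_of_smul_eq_smul (hU1 v hv) (hU1 u hu) e.symm
    refine noint n ((v : ℝ) - u + (k'.toAdd - k.toAdd)) ?_ ?_ (by linarith)
    · linarith [hu.1, hu.2, hv.1, hv.2]
    · linarith [hu.1, hu.2, hv.1, hv.2]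
  have g0 : (((1 : Multiplicative Γ)).toAdd : ℝ) = 0 := rfl
  have gγ : (g.toAdd : ℝ) = γ := rfl
  have gγ' : (g'.toAdd : ℝ) = 2 * γ := rfl
  have hs : Sep3 U 1 g g' :=
    ⟨sep _ _ (by rw [g0, gγ]; linarith) (by rw [g0, gγ]; linarith),
      sep _ _ (by rw [gγ, gγ']; linarith) (by rw [gγ, gγ']; linarith),
      sep _ _ (by rw [g0, gγ']; linarith) (by rw [g0, gγ']; linarith)⟩
  have hα : cyc U 1 g g' ∈ alt3 (Multiplicative Γ) (intervalAlgebra Γ) :=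
    Subgroup.subset_closure ⟨U, hU, 1, g, g', hs, rfl⟩
  have e1 : ∀ u ∈ U, cyc U 1 g g' u = g • u := by
    intro u hu
    have := permute_apply hs.jointlyInjOn (finRotate 3) 0 hu
    change cyc U 1 g g' ((1 : Multiplicative Γ) • u) = g • u at this
    rwa [one_smul] at this
  have e2 : ∀ u ∈ U, (cyc U 1 g g')⁻¹ u = g' • u := by
    intro u hu
    have := permute_apply hs.jointlyInjOn (finRotate 3) 2 hu
    change cyc U 1 g g' (g' • u) = (1 : Multiplicative Γ) • u at this
    rw [one_smul] at this
    rw [Equiv.Perm.inv_eq_iff_eq, this]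
  have main : ∀ β ∈ alt3 (Multiplicative Γ) (intervalAlgebra Γ),
      (∀ u ∈ U, ¬ (a' ≤ (β u : ℝ) ∧ (β u : ℝ) < c')) →
      ∃ β ∈ alt3 (Multiplicative Γ) (intervalAlgebra Γ), Commute (β * f * β⁻¹) f' := by
    intro β hβ h
    refine ⟨β, hβ, Equiv.Perm.Disjoint.commute fun x => ?_⟩
    by_cases hx : β⁻¹ x ∈ U
    · right
      refine hf' x ?_
      simpa using h _ hx
    · left
      change β (f (β⁻¹ x)) = x
      rw [hf _ hx]
      simp
  -- If gU meets [a', c'), the inverse three-cycle, which sends U to g'U, is used instead. If g'U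
  -- met it as well, γ would be within 1/5 of an integer, whereas 1/5 < γ < 1/4.
  by_cases hcase : ∀ u ∈ U, ¬ (a' ≤ ((g • u : Icc (0 : ℝ) 1) : ℝ) ∧
      ((g • u : Icc (0 : ℝ) 1) : ℝ) < c')
  · exact main _ hα fun u hu => by rw [e1 u hu]; exact hcase u hu
  · push Not at hcase
    obtain ⟨u, hu, hu1, hu2⟩ := hcase
    refine main _ (inv_mem hα) fun v hv => ?_
    rw [e2 v hv]
    rintro ⟨hv1, hv2⟩
    obtain ⟨n, hn⟩ := exists_smul_val g (hU1 u hu)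
    obtain ⟨m, hm⟩ := exists_smul_val g' (hU1 v hv)
    rw [gγ] at hn
    rw [gγ'] at hm
    have hint : ((n - m : ℤ) : ℝ) = (g • u : Icc (0 : ℝ) 1) - (g' • v : Icc (0 : ℝ) 1) -
        (u - v) + γ := by
      push_cast
      linarith
    refine noint _ _ ?_ ?_ hint
    · linarith [hu.1, hu.2, hv.1, hv.2]
    · linarith [hu.1, hu.2, hv.1, hv.2]

/-- `alt3` is normal in IE(Γ), and conjugating by one of its elements changes nothing modulo it.
Hence small exchanges, which generate IE(Γ) and commute after such a conjugation, commute in the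
quotient. -/
theorem commutator_IE (h1 : (1 : ℝ) ∈ Γ) (hd : Dense (Γ : Set ℝ)) :
    (commutator (IE Γ h1)).map (IE Γ h1).subtype =
      alt3 (Multiplicative Γ) (intervalAlgebra Γ) := by
  refine le_antisymm ?_ (alt3_le_map_commutator h1)
  have hnormal : ((alt3 (Multiplicative Γ) (intervalAlgebra Γ)).subgroupOf (IE Γ h1)).Normal := by
    refine ⟨fun τ hτ f => ?_⟩
    obtain ⟨𝒱, h2, h3, h4⟩ := exists_pieces f.2
    exact alt3_conj_mem (preimage_smul_mem h1) h2 h3 h4 hτ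
  have hle : alt3 (Multiplicative Γ) (intervalAlgebra Γ) ≤ IE Γ h1 :=
    (alt3_le_map_commutator h1).trans (Subgroup.map_subtype_le _)
  have hgen : Subgroup.closure ((IE Γ h1).subtype ⁻¹' smallExchanges Γ) = ⊤ := by
    apply Subgroup.map_injective (IE Γ h1).subtype_injective
    rw [MonoidHom.map_closure, image_preimage_eq_of_subset]
    · refine le_antisymm ?_ fun f hf => ?_
      · rw [← MonoidHom.range_eq_map, Subgroup.range_subtype]
        exact (Subgroup.closure_le _).2 fun f hf => hf.1
      · rw [← MonoidHom.range_eq_map, Subgroup.range_subtype] at hf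
        exact mem_closure_smallExchanges h1 hd hf
    · rintro f hf
      exact ⟨⟨f, hf.1⟩, rfl⟩
  refine Subgroup.map_le_iff_le_comap.2
    (commutator_le_of_generators (N := (alt3 (Multiplicative Γ) (intervalAlgebra Γ)).subgroupOf
      (IE Γ h1)) hgen fun f hf f' hf' => ?_)
  obtain ⟨β, hβ, hcomm⟩ := exists_conj_commute hd hf hf'
  let β' : IE Γ h1 := ⟨β, hle hβ⟩
  have hβ1 : (β' : IE Γ h1 ⧸ (alt3 (Multiplicative Γ) (intervalAlgebra Γ)).subgroupOf (IE Γ h1)) = 1 :=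
    (QuotientGroup.eq_one_iff β').2 hβ
  have hc : Commute (β' * f * β'⁻¹) f' := Subtype.ext hcomm
  have := hc.map (QuotientGroup.mk' ((alt3 (Multiplicative Γ) (intervalAlgebra Γ)).subgroupOf
    (IE Γ h1)))
  simpa [hβ1] using this

/-- The piecewise translations with angles in a subgroup. -/
def angleSubgroup (Δ : AddSubgroup ℝ) : Subgroup (Equiv.Perm (Icc (0 : ℝ) 1)) where
  carrier := {f | ∀ x, (f x : ℝ) - x ∈ Δ}
  one_mem' := fun x => by simp
  mul_mem' := by
    intro f g hf hg x
    have := Δ.add_mem (hf (g x)) (hg x)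
    simpa using this
  inv_mem' := by
    intro f hf x
    have := Δ.neg_mem (hf (f⁻¹ x))
    simpa using this

/-- The angle at x depends only on the set of breakpoints that are at most x. -/
theorem finite_angles {f : Equiv.Perm (Icc (0 : ℝ) 1)} (hf : IsIntervalExchange Γ f) :
    (range fun x => (f x : ℝ) - x).Finite := by
  classical
  obtain ⟨-, S, -, hf⟩ := hf
  let φ : Icc (0 : ℝ) 1 → Finset (Icc (0 : ℝ) 1) := fun x => S.filter (· ≤ x)
  have hfac : Function.FactorsThrough (fun x => (f x : ℝ) - x) φ := by
    intro x y h
    refine hf x y fun s hs => ?_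
    have := congrArg (s ∈ ·) h
    simpa [φ, hs] using this
  have hφ : (range φ).Finite := S.powerset.finite_toSet.subset (by
    rintro _ ⟨x, rfl⟩
    exact Finset.mem_coe.2 (Finset.mem_powerset.2 (Finset.filter_subset _ _)))
  refine (hφ.image (Function.extend φ (fun x => (f x : ℝ) - x) 0)).subset ?_
  rintro _ ⟨x, rfl⟩
  exact ⟨φ x, ⟨x, rfl⟩, hfac.extend_apply 0 x⟩

/-- Division with remainder by one small element of Γ leaves a remainder that is itself small or
zero. -/
theorem mem_of_forall_small (hd : Dense (Γ : Set ℝ)) {Δ : AddSubgroup ℝ}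
    (h : ∀ γ ∈ Γ, 0 < γ → γ < 1 / 10 → γ ∈ Δ) : Γ ≤ Δ := by
  intro x hx
  obtain ⟨γ, hγ, hγ0, hγ1⟩ := exists_mem_Ioo hd (show (0 : ℝ) < 1 / 10 by norm_num)
  have hΔ := h γ hγ hγ0 hγ1
  have e : x = (x - ⌊x / γ⌋ • γ) + ⌊x / γ⌋ • γ := by ring
  rw [e]
  refine Δ.add_mem ?_ (Δ.zsmul_mem hΔ _)
  have hr := Γ.sub_mem hx (Γ.zsmul_mem hγ ⌊x / γ⌋)
  have h1 : (⌊x / γ⌋ : ℝ) * γ ≤ x := (le_div_iff₀ hγ0).1 (Int.floor_le _)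
  have h2 : x < (⌊x / γ⌋ + 1 : ℝ) * γ := (div_lt_iff₀ hγ0).1 (Int.lt_floor_add_one _)
  rw [zsmul_eq_mul] at hr ⊢
  rcases h1.eq_or_lt with h3 | h3
  · rw [h3, sub_self]; exact Δ.zero_mem
  · exact h _ hr (by linarith) (by linarith)

theorem commutator_IE_fg_iff (h1 : (1 : ℝ) ∈ Γ) (hd : Dense (Γ : Set ℝ)) :
    Group.FG (commutator (IE Γ h1)) ↔ AddGroup.FG Γ := by
  constructor
  · intro h
    obtain ⟨T, hT⟩ := Group.fg_iff_subgroup_fg _ |>.1 h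
    -- The angles occurring in finitely many generators; they turn out to generate Γ.
    let A : Set ℝ := ⋃ f ∈ T, range fun x => ((f : Equiv.Perm (Icc (0 : ℝ) 1)) x : ℝ) - x
    have hA : A.Finite := T.finite_toSet.biUnion fun f _ => finite_angles f.2
    have hle : alt3 (Multiplicative Γ) (intervalAlgebra Γ) ≤
        angleSubgroup (AddSubgroup.closure A) := by
      refine (alt3_le_map_commutator h1).trans (Subgroup.map_le_iff_le_comap.2 ?_)
      rw [← hT]
      refine (Subgroup.closure_le _).2 fun f hf x => AddSubgroup.subset_closure ?_
      exact mem_biUnion hf ⟨x, rfl⟩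
    have hΓ : Γ = AddSubgroup.closure A := by
      refine le_antisymm (mem_of_forall_small hd fun γ hγ hγ0 hγ1 => ?_)
        ((AddSubgroup.closure_le _).2 ?_)
      -- The three-cycle of [0, γ), [γ, 2γ), [2γ, 3γ) moves 0 by exactly γ, so γ is generated by the
      -- angles in A.
      · let g : Multiplicative Γ := Multiplicative.ofAdd ⟨γ, hγ⟩
        let g' : Multiplicative Γ := Multiplicative.ofAdd ⟨2 * γ, by simpa using Γ.nsmul_mem hγ 2⟩
        let U : Set (Icc (0 : ℝ) 1) := {x | (x : ℝ) < γ}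
        have hU1 : ∀ u ∈ U, u ≠ 1 := fun u hu => ne_one_of_lt (lt_trans hu (by linarith))
        have sep : ∀ k k' : Multiplicative Γ, γ ≤ (k'.toAdd : ℝ) - k.toAdd →
            (k'.toAdd : ℝ) - k.toAdd < 1 / 2 → Sep U k k' := by
          intro k k' h2 h3 u hu v hv e
          obtain ⟨n, hn⟩ := exists_int_of_smul_eq_smul (hU1 v hv) (hU1 u hu) e.symm
          have hu' : (u : ℝ) < γ := hu
          have hv' : (v : ℝ) < γ := hv
          have hn0 : (0 : ℝ) < n := by linarith [u.2.1, v.2.1]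
          have hn1 : (n : ℝ) < 1 := by linarith [u.2.1, v.2.1]
          have : 0 < n := by exact_mod_cast hn0
          have : n < 1 := by exact_mod_cast hn1
          omega
        have g0 : (((1 : Multiplicative Γ)).toAdd : ℝ) = 0 := rfl
        have gγ : (g.toAdd : ℝ) = γ := rfl
        have gγ' : (g'.toAdd : ℝ) = 2 * γ := rfl
        have hs : Sep3 U 1 g g' :=
          ⟨sep _ _ (by rw [g0, gγ]; linarith) (by rw [g0, gγ]; linarith),
            sep _ _ (by rw [gγ, gγ']; linarith) (by rw [gγ, gγ']; linarith),
            sep _ _ (by rw [g0, gγ']; linarith) (by rw [g0, gγ']; linarith)⟩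
        have hmem := hle (Subgroup.subset_closure ⟨U, setOf_lt_mem hγ, 1, g, g', hs, rfl⟩) 0
        have h0 : (0 : Icc (0 : ℝ) 1) ∈ U := hγ0
        have e1 := permute_apply hs.jointlyInjOn (finRotate 3) 0 h0
        change cyc U 1 g g' ((1 : Multiplicative Γ) • (0 : Icc (0 : ℝ) 1)) = g • 0 at e1
        rw [one_smul] at e1
        have e2 : ((g • (0 : Icc (0 : ℝ) 1) : Icc (0 : ℝ) 1) : ℝ) = γ := by
          rw [smul_val g (hU1 0 h0), gγ, Int.fract_eq_iff]
          exact ⟨hγ0.le, by linarith, 0, by simp⟩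
        rw [e1, e2] at hmem
        simpa using hmem
      · intro r hr
        obtain ⟨f, hf, x, rfl⟩ := mem_iUnion₂.1 hr
        exact f.2.1 x
    rw [AddGroup.fg_iff_addSubgroup_fg, hΓ]
    exact ⟨hA.toFinset, by simp⟩
  · intro h
    have h2 := alt3_rotation_fg h1 hd h
    rw [← commutator_IE h1 hd, ← Group.fg_iff_subgroup_fg] at h2
    exact Group.fg_of_surjective (hG := h2) (f := ((commutator (IE Γ h1)).equivMapOfInjective _
      (IE Γ h1).subtype_injective).symm.toMonoidHom) (MulEquiv.surjective _)

end IE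

end FullGroups

theorem mainTheorem11 :
    (∀ (G X : Type*) [Group G] [Countable G] [MetricSpace X] [CompactSpace X]
      [MulAction G X] [ContinuousConstSMul G X] [MulAction.IsMinimal G X],
      Nonempty (X ≃ₜ (ℕ → Bool)) → IsExpansiveAction G X → IsEssentiallyFree G X →
        (Group.FG G ↔ Group.FG (TransformationGroupoid.alternating G X))) ∧
    (∀ (Γ : AddSubgroup ℝ) (h1 : (1 : ℝ) ∈ Γ), (Γ : Set ℝ).Countable → Dense (Γ : Set ℝ) →
      (Group.FG (commutator (IE Γ h1)) ↔ AddGroup.FG Γ)) := by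
  refine ⟨?_, fun Γ h1 _ hd => FullGroups.commutator_IE_fg_iff h1 hd⟩
  intro G X _ _ _ _ _ _ _ hX hexp hfree
  exact FullGroups.group_fg_iff_alternating_fg hX hexp hfree
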